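/- **Conventions.** Vectors are in $\mathbb R^n$ with Euclidean inner product $\langle\cdot,\cdot\rangle$ and norm $\|\cdot\|$; $\mathbb D=\{\|x\|\le 1\}$ (also in $\mathbb R^{2n}$), $A_*=A\setminus\{0\}$, $\langle x,y\rangle_A=xAy'$, $\|x\|_A^2=xAx'$. A covariance matrix is a symmetric positive semidefinite matrix. We write $X\sim L^n(m,\Theta,\mathcal X)$ if $X$ is a Lévy process in $\mathbb R^n$ with $\mathbb E e^{i\langle\theta,X(t)\rangle}=e^{t\Psi_X(\theta)}$, $$\Psi_X(\theta)=i\langle m,\theta\rangle-\tfrac12\|\theta\|_\Theta^2+\int_{\mathbb R^n_*}\big(e^{i\langle\theta,x\rangle}-1-i\langle\theta,x\rangle\mathbf 1_{\mathbb D}(x)\big)\,\mathcal X(dx),$$ where $\Theta$ is a covariance matrix and $\int(\|x\|^2\wedge1)\,\mathcal X(dx)<\infty$. For $t\in[0,\infty)^n$ put $t\diamond\mu=(t_k\mu_k)_k$, $(t\diamond\Sigma)_{kl}=\Sigma_{kl}(t_k\wedge t_l)$, and $X(t)=(X_1(t_1),\dots,X_n(t_n))$ for an $n$-dimensional process $X$.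 Let $d\in[0,\infty)^n$, $\mu\in\mathbb R^n$, let $\Sigma\in\mathbb R^{n\times n}$ be a covariance matrix, and let $\mathcal U$ be a Thorin measure, that is, a Borel measure on $[0,\infty)^n_*$ with $\int(1+\ln^-\|u\|)\wedge(1/\|u\|)\,\mathcal U(du)<\infty$, where $\ln^-x=-\mathbf 1_{(0,1]}(x)\ln x$. Let $B\sim L^n(\mu,\Sigma,0)$ be a Brownian motion, and let $T$ be a Thorin subordinator with parameters $(d,\mathcal U)$, that is, a Lévy process with nondecreasing components with, for all $t\ge0$ and $\lambda\in[0,\infty)^n$, $$-\ln\mathbb E e^{-\langle\lambda,T(t)\rangle}=t\langle d,\lambda\rangle+t\int\ln\frac{\|u\|^2+\langle\lambda,u\rangle}{\|u\|^2}\,\mathcal U(du).$$ Let $\mathcal T$ be the Lévy measure of $T$. Weak subordination: $Z=(Z_1,Z_2)$ has the law of $(T,B\odot T)$ if $Z\sim L^{2n}\big((m_1,\hat m_2),\,0\oplus(d\diamond\Sigma),\,\mathcal Z\big)$, where $d$ is the drift of $T$, $\mathcal Z(dt,dx)=\mathbb P(B(t)\in dx)\,\mathcal T(dt)$, $m_1=d+\int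 t\,\mathbb P((t,B(t))\in\mathbb D)\,\mathcal T(dt)$ and $\hat m_2=d\diamond\mu+\int\mathbb E[B(t)\mathbf 1_{\mathbb D}(t,B(t))]\,\mathcal T(dt)$. A Lévy process $Y$ is a $VGG^n(d,\mu,\Sigma,\mathcal U)$ process if it has the law of $B\odot T$, that is, of $Z_2$. For $b>0$ let $\mathcal V_{b,\mu,\Sigma}(dy)=\int_{(0,\infty)}N(g\mu,g\Sigma)(dy)\,b e^{-bg}\,dg/g$ on $\mathbb R^n_*$, where $N$ denotes the normal law. **Theorem 4.1.** Let $Y\sim VGG^n(d,\mu,\Sigma,\mathcal U)$. Then $Y\sim L^n(m_2,d\diamond\Sigma,\mathcal Y)$, where $$\mathcal Y=\Big\{\frac{\mathcal U(du)}{\|u\|^2}\otimes\mathcal V_{\|u\|^2,\,u\diamond\mu,\,u\diamond\Sigma}(dy)\Big\}\circ\big((u,y)\mapsto y\big)^{-1},$$ $$m_2=d\diamond\mu+\int_{[0,\infty)^n_*}\Big(\int_{\mathbb D_*}y\,\mathcal V_{\|u\|^2,\,u\diamond\mu,\,u\diamond\Sigma}(dy)\Big)\frac{\mathcal U(du)}{\|u\|^2}.$$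 Here the inner integral converges absolutely for every $u\in[0,\infty)^n_*$, and so does the outer one; if $\int_{\mathbb D_*}\|y\|\,\mathcal Y(dy)<\infty$, then also $m_2=d\diamond\mu+\int_{\mathbb D_*}y\,\mathcal Y(dy)$. For all $\theta\in\mathbb R^n$, with the principal branch of $\ln$ and an absolutely convergent integral, $$\Psi_Y(\theta)=i\langle d\diamond\mu,\theta\rangle-\tfrac12\|\theta\|^2_{d\diamond\Sigma}-\int_{[0,\infty)^n_*}\ln\frac{\|u\|^2-i\langle u\diamond\mu,\theta\rangle+\frac12\|\theta\|^2_{u\diamond\Sigma}}{\|u\|^2}\,\mathcal U(du).$$ Suppose in addition that $\Sigma$ is invertible. For $\emptyset\ne J\subseteq\{1,\dots,n\}$ let $\mathbb R_J=\{\sum_{j\in J}x_je_j\}$, $V_J=\{y\in\mathbb R_J:y_j\ne0\ \forall j\in J\}$ and $C_J=\{u\in\mathbb R_J:u_j>0\ \forall j\in J\}$; for $u\in C_J$ let $(u\diamond\Sigma)_J$ be the restriction of $u\diamond\Sigma$ to $\mathbb R_J$, with inverse $(u\diamond\Sigma)_J^{-1}$ and determinant $|u\diamond\Sigma|_J$.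 Then $\mathcal Y=\sum_{\emptyset\ne J\subseteq\{1,\dots,n\}}\mathcal Y_J$ with measures $\mathcal Y_J$ that vanish outside $V_J$ and are absolutely continuous with respect to Lebesgue measure on $\mathbb R_J$ with density $v_J(y)=\int_{C_J}\nu_J(u,y)\,\mathcal U(du)$, $y\in V_J$, where $$\nu_J(u,y)=\frac{2}{(2\pi)^{\#J/2}}\;\frac{\exp\{\langle y,u\diamond\mu\rangle_{(u\diamond\Sigma)_J^{-1}}\}}{|u\diamond\Sigma|_J^{1/2}\,\|y\|_{(u\diamond\Sigma)_J^{-1}}^{\#J}}\;\mathfrak K_{\#J/2}\Big\{\|y\|_{(u\diamond\Sigma)_J^{-1}}\big(2\|u\|^2+\|u\diamond\mu\|^2_{(u\diamond\Sigma)_J^{-1}}\big)^{1/2}\Big\},$$ $\mathfrak K_\rho(r)=r^\rho K_\rho(r)$, and $K_\rho$ is the modified Bessel function of the second kind. -/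

import Mathlib

open MeasureTheory ProbabilityTheory Set Filter Topology
open scoped NNReal ENNReal

noncomputable section

namespace VGG

/-! ### Coordinates, norms and the outer products -/

/-- The Euclidean space `ℝ^ι`. -/
abbrev E (ι : Type) [Fintype ι] : Type := EuclideanSpace ℝ ι

/-- The form `⟨x, y⟩_A = x A y'`. -/
def form {ι : Type} [Fintype ι] (A : Matrix ι ι ℝ) (x y : E ι) : ℝ :=
  x.ofLp ⬝ᵥ A.mulVec y.ofLp

/-- The seminorm `‖x‖_A = (x A x')^{1/2}`, for `A` positive semidefinite. -/
def formNorm {ι : Type} [Fintype ι] (A : Matrix ι ι ℝ) (x : E ι) : ℝ :=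
  Real.sqrt (form A x x)

/-- The closed Euclidean unit ball. -/
def unitBall (ι : Type) [Fintype ι] : Set (E ι) := Metric.closedBall 0 1

/-- `[0,∞)^ι` without the origin. -/
def orthantStar (ι : Type) [Fintype ι] : Set (E ι) := {t | (∀ i, 0 ≤ t i) ∧ t ≠ 0}

/-- `t ◇ μ = (t₁ μ₁, …, tₙ μₙ)`. -/
def outerVec {n : ℕ} (t μ : E (Fin n)) : E (Fin n) := WithLp.toLp 2 fun k => t k * μ k

/-- `(t ◇ S)_{kl} = S_{kl} (t_k ∧ t_l)`. -/
def outerMat {n : ℕ} (t : E (Fin n)) (S : Matrix (Fin n) (Fin n) ℝ) :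
    Matrix (Fin n) (Fin n) ℝ :=
  Matrix.of fun k l => S k l * min (t k) (t l)

/-- The projection `π_J(x) = ∑_{j ∈ J} x_j e_j`. -/
def proj {n : ℕ} (J : Finset (Fin n)) (x : E (Fin n)) : E (Fin n) :=
  WithLp.toLp 2 fun k => if k ∈ J then x k else 0

/-- The `k`-th smallest coordinate `t_{(k)}` of `t`; here `Tuple.sort` is a permutation that sorts
the coordinates in nondecreasing order. -/
def ordered {n : ℕ} (t : E (Fin n)) (k : Fin n) : ℝ := t (Tuple.sort t.ofLp k)

/-- The spacings `Δt_{(k)} = t_{(k)} - t_{(k-1)}`, where `t_{(0)} = 0` (indices start at `0`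
in the code). -/
def spacing {n : ℕ} (t : E (Fin n)) (k : Fin n) : ℝ :=
  ordered t k -
    if h : (k : ℕ) = 0 then 0 else ordered t ⟨(k : ℕ) - 1, by have := k.isLt; omega⟩

/-- The index set `{(k), …, (n)}`. -/
def upperSet {n : ℕ} (t : E (Fin n)) (k : Fin n) : Finset (Fin n) :=
  (Finset.Ici k).image (Tuple.sort t.ofLp)

/-- The projection `𝒳_J` of a measure on `ℝⁿ∖{0}`, `J` nonempty. -/
def projMeasure {n : ℕ} (J : Finset (Fin n)) (𝒳 : Measure (E (Fin n))) : Measure (E (Fin n)) :=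
  (𝒳.map (proj J)).restrict {0}ᶜ

/-- `t ◇ 𝒳 = ∑_k Δt_{(k)} 𝒳_{{(k), …, (n)}}`. -/
def outerMeasure {n : ℕ} (t : E (Fin n)) (𝒳 : Measure (E (Fin n))) : Measure (E (Fin n)) :=
  ∑ k : Fin n, ENNReal.ofReal (spacing t k) • projMeasure (upperSet t k) 𝒳

/-- The compensation term
`c(t, 𝒳) = ∑_{k ≥ 2} Δt_{(k)} ∫_{𝔻ᶜ} π_{{(k), …, (n)}}(x) 1_𝔻(π_{{(k), …, (n)}}(x)) 𝒳(dx)`. -/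
def compensation {n : ℕ} (t : E (Fin n)) (𝒳 : Measure (E (Fin n))) : E (Fin n) :=
  ∑ k ∈ Finset.univ.filter (fun k : Fin n => 0 < (k : ℕ)), spacing t k •
    ∫ x in (unitBall (Fin n))ᶜ, (unitBall (Fin n)).indicator id (proj (upperSet t k) x) ∂𝒳

/-! ### Lévy processes and their characteristics -/

/-- A Lévy process: it starts at `0`, has independent and stationary increments, and almost all
of its paths are càdlàg. -/
structure IsLevyProcess {ι : Type} [Fintype ι] {Ω : Type*} [MeasurableSpace Ω] (P : Measure Ω)
    (X : ℝ≥0 → Ω → E ι) : Prop where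
  measurable : ∀ t, Measurable (X t)
  zero : ∀ᵐ ω ∂P, X 0 ω = 0
  indep : HasIndepIncrements X P
  stationary : ∀ s h, P.map (fun ω => X (s + h) ω - X s ω) = P.map (X h)
  cadlag : ∀ᵐ ω ∂P, ∀ t, ContinuousWithinAt (fun s => X s ω) (Ici t) t ∧
    ∃ l, Tendsto (fun s => X s ω) (𝓝[<] t) (𝓝 l)

/-- Lévy measures; measures on `ℝ^ι∖{0}` are measures on `ℝ^ι` without mass at `0`. -/
structure IsLevyMeasure {ι : Type} [Fintype ι] (𝒳 : Measure (E ι)) : Prop where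
  zero : 𝒳 {0} = 0
  finite : ∫⁻ x, ENNReal.ofReal (min (‖x‖ ^ 2) 1) ∂𝒳 < ∞

/-- The Lévy exponent with characteristics `(μ, S, 𝒳)`. -/
def levyExponent {ι : Type} [Fintype ι] (μ : E ι) (S : Matrix ι ι ℝ) (𝒳 : Measure (E ι))
    (θ : E ι) : ℂ :=
  Complex.I * (inner ℝ μ θ : ℝ) - (1 / 2) * (form S θ θ : ℝ) +
    ∫ x, (Complex.exp (Complex.I * (inner ℝ θ x : ℝ)) - 1 -
      (unitBall ι).indicator (fun x => Complex.I * (inner ℝ θ x : ℝ)) x) ∂𝒳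

/-- `X ∼ L(μ, S, 𝒳)`: a Lévy process with canonical triplet `(μ, S, 𝒳)`. -/
structure HasTriplet {ι : Type} [Fintype ι] {Ω : Type*} [MeasurableSpace Ω] (P : Measure Ω)
    (X : ℝ≥0 → Ω → E ι) (μ : E ι) (S : Matrix ι ι ℝ) (𝒳 : Measure (E ι)) : Prop where
  isLevyProcess : IsLevyProcess P X
  posSemidef : S.PosSemidef
  isLevyMeasure : IsLevyMeasure 𝒳
  charFun_eq : ∀ (t : ℝ≥0) (θ : E ι),
    charFun (P.map (X t)) θ = Complex.exp ((t : ℝ) * levyExponent μ S 𝒳 θ)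

/-- Brownian motion `BM(μ, S)` with drift `μ` and covariance matrix `S`. -/
def IsBrownianMotion {ι : Type} [Fintype ι] {Ω : Type*} [MeasurableSpace Ω] (P : Measure Ω)
    (B : ℝ≥0 → Ω → E ι) (μ : E ι) (S : Matrix ι ι ℝ) : Prop :=
  HasTriplet P B μ S 0

/-- A subordinator: a Lévy process with nondecreasing components. -/
structure IsSubordinator {ι : Type} [Fintype ι] {Ω : Type*} [MeasurableSpace Ω] (P : Measure Ω)
    (T : ℝ≥0 → Ω → E ι) : Prop where
  isLevyProcess : IsLevyProcess P T
  mono : ∀ᵐ ω ∂P, ∀ s t : ℝ≥0, s ≤ t → ∀ i, T s ω i ≤ T t ω i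

/-- `T ∼ S(d, 𝒯)`: a subordinator with drift `d ∈ [0,∞)^ι` and Lévy measure `𝒯`
on `[0,∞)^ι∖{0}`. -/
structure IsSubordinatorWith {ι : Type} [Fintype ι] {Ω : Type*} [MeasurableSpace Ω]
    (P : Measure Ω) (T : ℝ≥0 → Ω → E ι) (d : E ι) (𝒯 : Measure (E ι)) : Prop where
  isSubordinator : IsSubordinator P T
  drift_nonneg : ∀ i, 0 ≤ d i
  support : 𝒯 (orthantStar ι)ᶜ = 0
  integrable : IntegrableOn (fun x => x) (unitBall ι) 𝒯
  hasTriplet : HasTriplet P T (d + ∫ x in unitBall ι, x ∂𝒯) 0 𝒯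

/-! ### Weak subordination -/

/-- `(x, y) ∈ ℝ²ⁿ`. -/
def pair {n : ℕ} (x y : E (Fin n)) : E (Fin n ⊕ Fin n) :=
  WithLp.toLp 2 (Sum.elim x.ofLp y.ofLp)

/-- The second component `Z₂` of `Z = (Z₁, Z₂) ∈ ℝ²ⁿ`. -/
def second {n : ℕ} (z : E (Fin n ⊕ Fin n)) : E (Fin n) :=
  WithLp.toLp 2 fun k => z (Sum.inr k)

/-- The process at a multivariate time point, `X(t) = (X₁(t₁), …, Xₙ(tₙ))`, `t ∈ [0,∞)ⁿ`. -/
def multiTime {n : ℕ} {Ω : Type*} (X : ℝ≥0 → Ω → E (Fin n)) (t : E (Fin n)) (ω : Ω) : E (Fin n) :=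
  WithLp.toLp 2 fun k => X (t k).toNNReal ω k

/-- `m₁ = d + ∫ t P((t, X(t)) ∈ 𝔻) 𝒯(dt)`. -/
def weakDrift₁ {n : ℕ} {Ω : Type*} [MeasurableSpace Ω] (P : Measure Ω)
    (X : ℝ≥0 → Ω → E (Fin n)) (d : E (Fin n)) (𝒯 : Measure (E (Fin n))) : E (Fin n) :=
  d + ∫ t, (P {ω | pair t (multiTime X t ω) ∈ unitBall (Fin n ⊕ Fin n)}).toReal • t ∂𝒯

/-- `m₂ = c(d, 𝒳) + d ◇ μ + ∫ E[X(t) 1_𝔻(t, X(t))] 𝒯(dt)`. -/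
def weakDrift₂ {n : ℕ} {Ω : Type*} [MeasurableSpace Ω] (P : Measure Ω)
    (X : ℝ≥0 → Ω → E (Fin n)) (μ : E (Fin n)) (𝒳 : Measure (E (Fin n)))
    (d : E (Fin n)) (𝒯 : Measure (E (Fin n))) : E (Fin n) :=
  compensation d 𝒳 + outerVec d μ +
    ∫ t, (∫ ω in {ω | pair t (multiTime X t ω) ∈ unitBall (Fin n ⊕ Fin n)},
      multiTime X t ω ∂P) ∂𝒯

/-- `𝒵(dt, dx) = (δ₀ ⊗ (d ◇ 𝒳))(dt, dx) + P(X(t) ∈ dx) 𝒯(dt)`, a measure on `ℝ²ⁿ`. -/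
def weakLevyMeasure {n : ℕ} {Ω : Type*} [MeasurableSpace Ω] (P : Measure Ω)
    (X : ℝ≥0 → Ω → E (Fin n)) (𝒳 : Measure (E (Fin n)))
    (d : E (Fin n)) (𝒯 : Measure (E (Fin n))) : Measure (E (Fin n ⊕ Fin n)) :=
  (outerMeasure d 𝒳).map (pair 0) + 𝒯.bind fun t => P.map fun ω => pair t (multiTime X t ω)

/-- `Z` is the subordinator `T ∼ S(d, 𝒯)` subordinating `X ∼ L(μ, S, 𝒳)` in the weak sense, that
is, `Z` has the law of `(T, X ⊙ T)`. -/
structure IsWeakSubordination {n : ℕ} {ΩX ΩT ΩZ : Type*} [MeasurableSpace ΩX] [MeasurableSpace ΩT]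
    [MeasurableSpace ΩZ] (PX : Measure ΩX) (X : ℝ≥0 → ΩX → E (Fin n)) (μ : E (Fin n))
    (S : Matrix (Fin n) (Fin n) ℝ) (𝒳 : Measure (E (Fin n)))
    (PT : Measure ΩT) (T : ℝ≥0 → ΩT → E (Fin n)) (d : E (Fin n)) (𝒯 : Measure (E (Fin n)))
    (PZ : Measure ΩZ) (Z : ℝ≥0 → ΩZ → E (Fin n ⊕ Fin n)) : Prop where
  subordinate : HasTriplet PX X μ S 𝒳
  subordinator : IsSubordinatorWith PT T d 𝒯
  hasTriplet : HasTriplet PZ Z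
    (pair (weakDrift₁ PX X d 𝒯) (weakDrift₂ PX X μ 𝒳 d 𝒯))
    (Matrix.fromBlocks 0 0 0 (outerMat d S))
    (weakLevyMeasure PX X 𝒳 d 𝒯)

/-! ### Thorin subordinators and variance generalised gamma convolutions -/

/-- `ln⁻ x = -1_{(0,1]}(x) ln x`. -/
def lnMinus (x : ℝ) : ℝ := -(Ioc (0 : ℝ) 1).indicator Real.log x

/-- Thorin measures on `[0,∞)ⁿ∖{0}`. -/
structure IsThorinMeasure {n : ℕ} (U : Measure (E (Fin n))) : Prop where
  support : U (orthantStar (Fin n))ᶜ = 0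
  finite : ∫⁻ u, ENNReal.ofReal (min (1 + lnMinus ‖u‖) (1 / ‖u‖)) ∂U < ∞

/-- Thorin subordinators `T ∼ GGC_S(d, U)`, by means of the Laplace transform. -/
structure IsThorinSubordinator {n : ℕ} {Ω : Type*} [MeasurableSpace Ω] (P : Measure Ω)
    (T : ℝ≥0 → Ω → E (Fin n)) (d : E (Fin n)) (U : Measure (E (Fin n))) : Prop where
  isSubordinator : IsSubordinator P T
  drift_nonneg : ∀ i, 0 ≤ d i
  isThorinMeasure : IsThorinMeasure U
  laplace : ∀ (t : ℝ≥0) (l : E (Fin n)), (∀ i, 0 ≤ l i) →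
    -Real.log (∫ ω, Real.exp (-inner ℝ l (T t ω)) ∂P) =
      t * inner ℝ d l + t * ∫ u, Real.log ((‖u‖ ^ 2 + inner ℝ l u) / ‖u‖ ^ 2) ∂U

/-- `Y ∼ VGG(d, μ, S, U)`: `Y` is a Lévy process with the law of `B ⊙ T`, where `B ∼ BM(μ, S)`
and `T ∼ GGC_S(d, U)`. The process `Z` has the law of `(T, B ⊙ T)`, thus `Z₂` that of `B ⊙ T`.
The processes may live on different probability spaces. -/
structure IsVGG {n : ℕ} {ΩB ΩT ΩZ ΩY : Type*} [MeasurableSpace ΩB] [MeasurableSpace ΩT]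
    [MeasurableSpace ΩZ] [MeasurableSpace ΩY]
    (PB : Measure ΩB) (B : ℝ≥0 → ΩB → E (Fin n)) (PT : Measure ΩT) (T : ℝ≥0 → ΩT → E (Fin n))
    (PZ : Measure ΩZ) (Z : ℝ≥0 → ΩZ → E (Fin n ⊕ Fin n))
    (PY : Measure ΩY) (Y : ℝ≥0 → ΩY → E (Fin n))
    (d μ : E (Fin n)) (S : Matrix (Fin n) (Fin n) ℝ) (U : Measure (E (Fin n))) : Prop where
  brownian : IsBrownianMotion PB B μ S
  thorin : IsThorinSubordinator PT T d U
  weak : ∃ (d' : E (Fin n)) (𝒯 : Measure (E (Fin n))),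
    IsWeakSubordination PB B μ S 0 PT T d' 𝒯 PZ Z
  levy : IsLevyProcess PY Y
  law : IdentDistrib (fun ω t => Y t ω) (fun ω t => second (Z t ω)) PY PZ

/-! ### Variance-gamma Lévy measures and their mixtures -/

/-- The variance-gamma Lévy measure on `ℝⁿ∖{0}`,
`𝒱_{b,μ,S}(dy) = ∫_{(0,∞)} P(B(g) ∈ dy) b e^{-bg} dg/g`, where `B(g) ∼ N(gμ, gS)`. -/
def vgLevyMeasure {n : ℕ} (b : ℝ) (μ : E (Fin n)) (S : Matrix (Fin n) (Fin n) ℝ) :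
    Measure (E (Fin n)) :=
  (((volume.restrict (Ioi (0 : ℝ))).withDensity
    fun g => ENNReal.ofReal (b * Real.exp (-b * g) / g)).bind
      fun g => multivariateGaussian (g • μ) (g • S)).restrict {0}ᶜ

/-- The measure `𝒱_{‖u‖², u ◇ μ, u ◇ S}`. -/
def vgAt {n : ℕ} (μ : E (Fin n)) (S : Matrix (Fin n) (Fin n) ℝ) (u : E (Fin n)) :
    Measure (E (Fin n)) :=
  vgLevyMeasure (‖u‖ ^ 2) (outerVec u μ) (outerMat u S)

/-- The mixture `{U(du)/‖u‖² ⊗ 𝒱_{‖u‖², u ◇ μ, u ◇ S}(dy)} ∘ ((u, y) ↦ y)⁻¹`. -/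
def vggLevyMeasure {n : ℕ} (μ : E (Fin n)) (S : Matrix (Fin n) (Fin n) ℝ)
    (U : Measure (E (Fin n))) : Measure (E (Fin n)) :=
  (U.withDensity fun u => ENNReal.ofReal (1 / ‖u‖ ^ 2)).bind (vgAt μ S)

/-! ### The densities on coordinate subspaces -/

/-- The modified Bessel function of the second kind, for `ρ ≥ 0` and `r > 0`, by the integral
representation `∫₀^∞ x^{ν-1} e^{-β/x-γx} dx = 2 (β/γ)^{ν/2} K_ν(2√(βγ))` with
`ν = -ρ`, `β = r²/4`, `γ = 1`, and `K_{-ρ} = K_ρ`. -/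
def besselK (ρ r : ℝ) : ℝ :=
  1 / 2 * (r / 2) ^ ρ * ∫ x in Ioi (0 : ℝ), x ^ (-ρ - 1) * Real.exp (-(r ^ 2 / 4) / x - x)

/-- `𝔎_ρ(r) = r^ρ K_ρ(r)`. -/
def besselKK (ρ r : ℝ) : ℝ := r ^ ρ * besselK ρ r

/-- `C_J`: the vectors `∑_{j ∈ J} u_j e_j` with `u_j > 0` for all `j ∈ J`. -/
def coneJ {n : ℕ} (J : Finset (Fin n)) : Set (E (Fin n)) :=
  {u | (∀ j ∈ J, 0 < u j) ∧ ∀ j ∉ J, u j = 0}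

/-- `V_J`: the vectors `∑_{j ∈ J} y_j e_j` with `y_j ≠ 0` for all `j ∈ J`. -/
def spaceJ {n : ℕ} (J : Finset (Fin n)) : Set (E (Fin n)) :=
  {y | (∀ j ∈ J, y j ≠ 0) ∧ ∀ j ∉ J, y j = 0}

/-- Lebesgue measure on the coordinate subspace `ℝⁿ π_J`, as a measure on `ℝⁿ`. -/
def lebesgueJ {n : ℕ} (J : Finset (Fin n)) : Measure (E (Fin n)) :=
  (volume : Measure (J → ℝ)).map fun x =>
    WithLp.toLp 2 fun k : Fin n => if h : k ∈ J then x ⟨k, h⟩ else 0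

/-- The coordinates of `x` with index in `J`. -/
def restrictJ {n : ℕ} (J : Finset (Fin n)) (x : E (Fin n)) : E J := WithLp.toLp 2 fun k => x k

/-- The matrix of the restriction `(u ◇ S)_J` of `u ◇ S` to `ℝⁿ π_J`, for `u ∈ C_J`. -/
def blockJ {n : ℕ} (J : Finset (Fin n)) (S : Matrix (Fin n) (Fin n) ℝ) (u : E (Fin n)) :
    Matrix J J ℝ :=
  (outerMat u S).submatrix (fun k => (k : Fin n)) (fun k => (k : Fin n))

/-- The kernel `ν_J(u, y)`, for `u ∈ C_J` and `y ∈ V_J`. -/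
def nuJ {n : ℕ} (μ : E (Fin n)) (S : Matrix (Fin n) (Fin n) ℝ) (J : Finset (Fin n))
    (u y : E (Fin n)) : ℝ :=
  let A : Matrix J J ℝ := (blockJ J S u)⁻¹
  let m : E J := restrictJ J (outerVec u μ)
  let z : E J := restrictJ J y
  2 / (2 * Real.pi) ^ ((J.card : ℝ) / 2) *
    besselKK ((J.card : ℝ) / 2) (formNorm A z * Real.sqrt (2 * ‖u‖ ^ 2 + formNorm A m ^ 2)) *
    Real.exp (form A z m) /
    (Real.sqrt (blockJ J S u).det * formNorm A z ^ J.card)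

/-- The density `v_J(y) = ∫_{C_J} ν_J(u, y) U(du)`. -/
def densityJ {n : ℕ} (μ : E (Fin n)) (S : Matrix (Fin n) (Fin n) ℝ) (U : Measure (E (Fin n)))
    (J : Finset (Fin n)) (y : E (Fin n)) : ℝ≥0∞ :=
  ∫⁻ u in coneJ J, ENNReal.ofReal (nuJ μ S J u y) ∂U

end VGG

end

/-!
A Thorin measure `U` gives the Lévy measure `𝒯 = thorinLevy U`, the image of
`e^{-g‖u‖²} dg/g U(du)` under `(u, g) ↦ g u`. Everything rests on two facts about `𝒯`.

* The Frullani integral along the rays `g ↦ g u` (`integral_one_sub_exp_neg_thorinLevy`) gives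
  `∫ (1 - e^{-w(t)}) 𝒯(dt) = ∫ ln (1 + w(u)/‖u‖²) U(du)` for homogeneous `w` with nonnegative real
  part.
* A Thorin subordinator `T` has Lévy measure `𝒯` and drift `d` (`thorin_triplet`). Only its Laplace
  transform on `[0,∞)ⁿ` is given. The exponents `ε ∑ᵢ xᵢ + z ⟨θ, x⟩` connect the points of the
  orthant, at real `z`, with imaginary arguments, at `z = -i`, by analytic continuation in a strip;
  `ε → 0` then yields the characteristic function (`charFun_of_thorin_laplace`). Drift and Lévy
  measure are recovered from the exponent, because its second differences are the Fourier
  transforms of the finite measures `(1 - cos ⟨h, x⟩) 𝒯(dx)` (`measure_eq_of_jumpExponent_eq`).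

Independence of the increments of `B` over the spacings of the ordered coordinates of `t` shows that
`B(t)` has the law `N(t ◇ μ, t ◇ Σ)` (`map_multiTime`). These laws form the Markov kernel
`gaussKernel`, and the Lévy measure of `(T, B ⊙ T)` is `𝒯 ⊗ₘ gaussKernel`. The choice of a
truncation set affects the drift only, so that the exponents of the weakly subordinated process at
`(0, θ)` and of the claimed triplet are both equal to
`i ⟨d ◇ μ, θ⟩ - ‖θ‖²_{d ◇ Σ} / 2 + ∫ (E e^{i⟨θ, B(t)⟩} - 1) 𝒯(dt)` (`levyExponent_weak`,
`levyExponent_mixture`). The Frullani integral turns this into the logarithmic form. On the side of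
the Lévy measure, polar coordinates for `𝒯` identify the mixture of variance-gamma measures with
the image of `𝒯` under the kernel, without the origin (`vggLevyMeasure_eq`). The drift correction
converges as an iterated integral, since the truncated means are of order `‖t‖ ∧ 1`, whereas
`∫ ‖y‖ 𝒴(dy)` near the origin may be infinite.

For invertible `Σ`, the punctured orthant is the disjoint union of the cones `C_J`. For `u ∈ C_J`
the kernel `min (u k) (u l)` dominates a positive constant on `J`, and therefore the block of
`u ◇ Σ` is positive definite (`posDef_blockJ`). Then `N(g u ◇ μ, g u ◇ Σ)` has a normal density on
the coordinate subspace of `J`, whose integral over `e^{-g‖u‖²} dg/g` is the Bessel integral in `ν_J`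
(`lintegral_normalDensity`), and Tonelli's theorem gives the density `v_J`
(`vggLevyMeasure_eq_sum`).
-/

noncomputable section

namespace VGG

section

/-! ### Frullani integrals -/

theorem intervalIntegral_frullani_kernel (b : ℝ) (w : ℂ) {g : ℝ} (hg : 0 < g) :
    ∫ s in (0 : ℝ)..1, w * Complex.exp (-(b + s * w) * g) =
      (Real.exp (-b * g) / g) • (1 - Complex.exp (-(w * g))) := by
  have hg' : (g : ℂ) ≠ 0 := by exact_mod_cast hg.ne'
  have hd : ∀ s ∈ uIcc (0 : ℝ) 1, HasDerivAt
      (fun s : ℝ => -(Complex.exp (-(b + s * w) * g)) / g)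
      (w * Complex.exp (-(b + s * w) * g)) s := by
    intro s _
    have h1 : HasDerivAt (fun s : ℝ => -((b : ℂ) + s * w) * g) (-(1 * w) * g) s := by
      have := ((Complex.ofRealCLM.hasDerivAt (x := s)).mul_const w).const_add (b : ℂ)
      simpa using (this.neg.mul_const (g : ℂ))
    have h2 := (h1.cexp.neg).div_const (g : ℂ)
    refine h2.congr_deriv ?_
    field_simp
  rw [intervalIntegral.integral_eq_sub_of_hasDerivAt hd
    (Continuous.intervalIntegrable (by fun_prop) _ _)]
  rw [Complex.real_smul]
  push_cast
  have : Complex.exp (-(b + 1 * w) * g) = Complex.exp (-b * g) * Complex.exp (-(w * g)) := by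
    rw [← Complex.exp_add]; ring_nf
  rw [this]
  simp
  field_simp
  ring

theorem integrable_frullani_kernel {b : ℝ} (hb : 0 < b) {w : ℂ} (hw : 0 ≤ w.re) :
    Integrable (Function.uncurry fun (s g : ℝ) => w * Complex.exp (-(b + s * w) * g))
      ((volume.restrict (uIoc 0 1)).prod (volume.restrict (Ioi 0))) := by
  have hbound : Integrable (fun p : ℝ × ℝ => (1 : ℝ) * (‖w‖ * Real.exp (-b * p.2)))
      ((volume.restrict (uIoc 0 1)).prod (volume.restrict (Ioi 0))) := by
    refine Integrable.mul_prod (f := fun _ : ℝ => (1 : ℝ)) (g := fun g => ‖w‖ * Real.exp (-b * g))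
      ?_ ?_
    · rw [uIoc_of_le zero_le_one]
      exact integrable_const _
    · exact (integrableOn_exp_mul_Ioi (by linarith) 0).const_mul _
  refine hbound.mono' (by fun_prop) ?_
  rw [Measure.prod_restrict]
  refine ae_restrict_of_forall_mem (measurableSet_uIoc.prod measurableSet_Ioi) ?_
  rintro ⟨s, g⟩ ⟨hs, hg⟩
  rw [uIoc_of_le zero_le_one] at hs
  have hs0 : 0 < s := hs.1
  have hg0 : 0 < g := hg
  simp only [Function.uncurry, norm_mul, Complex.norm_exp, one_mul]
  gcongr
  simp
  nlinarith [mul_nonneg (mul_nonneg hs0.le hw) hg0.le]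

/-- The complex Frullani integral. Write the integrand as an integral of `w e^{-(b + s w) g}` over
`s ∈ [0, 1]`, and exchange the integrals. -/
theorem integral_frullani {b : ℝ} (hb : 0 < b) {w : ℂ} (hw : 0 ≤ w.re) :
    IntegrableOn (fun g : ℝ => (Real.exp (-b * g) / g) • (1 - Complex.exp (-(w * g)))) (Ioi 0) ∧
    ∫ g in Ioi (0 : ℝ), (Real.exp (-b * g) / g) • (1 - Complex.exp (-(w * g))) =
      Complex.log (1 + w / b) := by
  have hint := integrable_frullani_kernel hb hw
  have hb' : (b : ℂ) ≠ 0 := by exact_mod_cast hb.ne'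
  have hre : ∀ s : ℝ, 0 ≤ s → 0 < (1 + s * (w / b)).re := by
    intro s hs
    simp only [Complex.add_re, Complex.one_re, Complex.mul_re, Complex.ofReal_re,
      Complex.ofReal_im, zero_mul, sub_zero, Complex.div_ofReal_re]
    positivity
  have hcongr : ∀ g ∈ Ioi (0 : ℝ), ∫ s in (0 : ℝ)..1, w * Complex.exp (-(b + s * w) * g) =
      (Real.exp (-b * g) / g) • (1 - Complex.exp (-(w * g))) :=
    fun g hg => intervalIntegral_frullani_kernel b w hg
  constructor
  · have h := hint.integral_prod_right
    refine IntegrableOn.congr_fun (f := fun g : ℝ => ∫ s in (0 : ℝ)..1,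
      w * Complex.exp (-(b + s * w) * g)) ?_ hcongr measurableSet_Ioi
    simpa only [IntegrableOn, intervalIntegral.integral_of_le zero_le_one, Function.uncurry,
      uIoc_of_le (zero_le_one' ℝ)] using h
  · rw [← setIntegral_congr_fun measurableSet_Ioi hcongr, ← intervalIntegral_integral_swap hint]
    have hlog : ∀ s ∈ uIcc (0 : ℝ) 1, HasDerivAt (fun s : ℝ => Complex.log (1 + s * (w / b)))
        ((w / b) / (1 + s * (w / b))) s := by
      intro s hs
      rw [uIcc_of_le zero_le_one] at hs
      have h1 : HasDerivAt (fun s : ℝ => (1 : ℂ) + s * (w / b)) (1 * (w / b)) s := by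
        simpa using ((Complex.ofRealCLM.hasDerivAt (x := s)).mul_const (w / b)).const_add (1 : ℂ)
      rw [one_mul] at h1
      exact h1.clog_real (Or.inl (hre s hs.1))
    have hne : ∀ s ∈ uIcc (0 : ℝ) 1, (1 : ℂ) + s * (w / b) ≠ 0 := by
      intro s hs h
      rw [uIcc_of_le zero_le_one] at hs
      have := hre s hs.1
      rw [h] at this
      simp at this
    have hcalc : ∫ s in (0 : ℝ)..1, (w / b) / (1 + s * (w / b)) = Complex.log (1 + w / b) := by
      rw [intervalIntegral.integral_eq_sub_of_hasDerivAt hlog]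
      · simp
      · refine ContinuousOn.intervalIntegrable ?_
        exact ContinuousOn.div (by fun_prop) (by fun_prop) hne
    rw [← hcalc]
    refine intervalIntegral.integral_congr fun s hs => ?_
    have hs' := hs
    rw [uIcc_of_le zero_le_one] at hs
    have hneg : (-(b + s * w) : ℂ).re < 0 := by
      simp only [Complex.neg_re, Complex.add_re, Complex.ofReal_re, Complex.mul_re,
        Complex.ofReal_im, zero_mul, sub_zero]
      have := mul_nonneg hs.1 hw
      linarith
    have hne' : (b + s * w : ℂ) ≠ 0 := by
      intro h; rw [h] at hneg; simp at hneg
    rw [integral_const_mul, integral_exp_mul_complex_Ioi hneg]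
    have h3 : (1 : ℂ) + s * (w / b) = (b + s * w) / b := by field_simp
    rw [h3, Complex.ofReal_zero, mul_zero, Complex.exp_zero, neg_div_neg_eq]
    field_simp

/-- The real Frullani integral. -/
theorem lintegral_frullani {b r : ℝ} (hb : 0 < b) (hr : 0 ≤ r) :
    ∫⁻ g in Ioi (0 : ℝ), ENNReal.ofReal ((1 - Real.exp (-(r * g))) * (Real.exp (-b * g) / g)) =
      ENNReal.ofReal (Real.log (1 + r / b)) := by
  obtain ⟨hi, he⟩ := integral_frullani hb (w := (r : ℂ)) (by simpa using hr)
  have hc : ∀ g : ℝ, (Real.exp (-b * g) / g) • (1 - Complex.exp (-((r : ℂ) * g))) =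
      (((1 - Real.exp (-(r * g))) * (Real.exp (-b * g) / g) : ℝ) : ℂ) := by
    intro g; rw [Complex.real_smul]; push_cast; ring
  simp only [hc] at hi he
  have hi' : IntegrableOn (fun g => (1 - Real.exp (-(r * g))) * (Real.exp (-b * g) / g))
      (Ioi 0) := by
    have := hi.re
    exact this
  rw [integral_complex_ofReal] at he
  rw [← ofReal_integral_eq_lintegral_ofReal hi']
  · congr 1
    apply Complex.ofReal_injective
    rw [he, Complex.ofReal_log (by positivity)]
    push_cast; rfl
  · refine ae_restrict_of_forall_mem measurableSet_Ioi fun g hg => ?_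
    have hg : 0 < g := hg
    have : Real.exp (-(r * g)) ≤ 1 := Real.exp_le_one_iff.2 (by nlinarith [mul_nonneg hr hg.le])
    have : 0 ≤ 1 - Real.exp (-(r * g)) := by linarith
    positivity

theorem norm_one_sub_exp_neg_le {w : ℂ} (hw : 0 ≤ w.re) :
    ‖1 - Complex.exp (-w)‖ ≤ ‖w‖ := by
  have h := Convex.norm_image_sub_le_of_norm_hasDerivWithin_le (𝕜 := ℂ)
    (f := fun z => Complex.exp (-z)) (f' := fun z => -Complex.exp (-z)) (C := 1)
    (s := {z : ℂ | 0 ≤ z.re}) (x := w) (y := 0) (fun z _ => by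
      simpa using ((hasDerivAt_neg z).cexp).hasDerivWithinAt)
    (fun z hz => by
      rw [norm_neg, Complex.norm_exp]
      exact Real.exp_le_one_iff.2 (by simpa using hz)) (convex_halfSpace_re_ge 0) hw (by simp)
  simpa using h

theorem norm_one_sub_exp_neg_le_max_mul_min {w : ℂ} {K r : ℝ} (hw : 0 ≤ w.re)
    (hK : ‖w‖ ≤ K * r) (hr : 0 ≤ r) :
    ‖1 - Complex.exp (-w)‖ ≤ max 2 K * min 1 r := by
  rcases le_total 1 r with h | h
  · rw [min_eq_left h, mul_one]
    refine le_trans ((norm_sub_le _ _).trans ?_) (le_max_left 2 K)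
    have : ‖Complex.exp (-w)‖ ≤ 1 := by
      rw [Complex.norm_exp]; exact Real.exp_le_one_iff.2 (by simpa using hw)
    rw [norm_one]; linarith
  · rw [min_eq_right h]
    refine (norm_one_sub_exp_neg_le hw).trans (hK.trans ?_)
    gcongr
    exact le_max_right _ _

theorem min_one_le_two_mul_one_sub_exp_neg {x : ℝ} (hx : 0 ≤ x) :
    min 1 x ≤ 2 * (1 - Real.exp (-x)) := by
  have h1 : 1 - Real.exp (-x) ≥ x / (1 + x) := by
    have h2 : Real.exp (-x) ≤ 1 / (1 + x) := by
      rw [Real.exp_neg, ← one_div]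
      exact one_div_le_one_div_of_le (by linarith) (by linarith [Real.add_one_le_exp x])
    have h3 : x / (1 + x) = 1 - 1 / (1 + x) := by field_simp; ring
    linarith
  have h4 : min 1 x ≤ 2 * (x / (1 + x)) := by
    rw [← mul_div_assoc, le_div_iff₀ (by linarith)]
    rcases le_total x 1 with h | h
    · rw [min_eq_right h]; nlinarith
    · rw [min_eq_left h]; nlinarith
  linarith

/-! ### Thorin measures -/

/-- The integrability condition in the definition of a Thorin measure controls logarithms of
`1 + K / ‖u‖`, both near the origin and at infinity. -/
theorem log_one_add_div_le {K r : ℝ} (hK : 0 ≤ K) (hr : 0 < r) :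
    Real.log (1 + K / r) ≤ (1 + K) * min (1 + lnMinus r) (1 / r) := by
  have h1 : Real.log (1 + K / r) ≤ K / r := by
    have := Real.log_le_sub_one_of_pos (show 0 < 1 + K / r by positivity)
    linarith
  have h2 : K / r ≤ (1 + K) * (1 / r) := by
    rw [mul_one_div]; gcongr; linarith
  rcases lt_or_ge 1 r with h | h
  · have : lnMinus r = 0 := by
      simp [lnMinus, h]
    rw [this, add_zero, min_eq_right]
    · exact h1.trans h2
    · rw [div_le_one hr]; exact h.le
  · have hl : lnMinus r = -Real.log r := by
      simp [lnMinus, h, hr]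
    rw [hl]
    have h3 : Real.log r ≤ 0 := Real.log_nonpos hr.le h
    have h4 : 1 + -Real.log r ≤ 1 / r := by
      have := Real.log_le_sub_one_of_pos (show 0 < 1 / r by positivity)
      rw [Real.log_div one_ne_zero hr.ne', Real.log_one] at this
      linarith
    rw [min_eq_left h4]
    have h5 : Real.log (1 + K / r) ≤ Real.log ((1 + K) / r) := by
      apply Real.log_le_log (by positivity)
      rw [add_div]
      gcongr
      rw [le_div_iff₀ hr]; linarith
    rw [Real.log_div (by positivity) hr.ne'] at h5
    have h6 : Real.log (1 + K) ≤ K := by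
      have := Real.log_le_sub_one_of_pos (show 0 < 1 + K by positivity)
      linarith
    nlinarith

theorem ae_orthantStar {n : ℕ} {U : Measure (E (Fin n))} (hU : IsThorinMeasure U) :
    ∀ᵐ u ∂U, u ∈ orthantStar (Fin n) := by
  rw [ae_iff]; exact hU.support

theorem measurable_lnMinus : Measurable lnMinus :=
  ((Real.measurable_log).indicator measurableSet_Ioc).neg

theorem IsThorinMeasure.sigmaFinite {n : ℕ} {U : Measure (E (Fin n))} (hU : IsThorinMeasure U) :
    SigmaFinite U := by
  set f : E (Fin n) → ℝ≥0∞ := fun u => ENNReal.ofReal (min (1 + lnMinus ‖u‖) (1 / ‖u‖)) with hf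
  have hfm : Measurable f := by
    have := measurable_lnMinus
    fun_prop
  have hpos : ∀ᵐ u ∂U, f u ≠ 0 := by
    filter_upwards [ae_orthantStar hU] with u hu
    have hu' : 0 < ‖u‖ := norm_pos_iff.2 hu.2
    rw [hf, ne_eq, ENNReal.ofReal_eq_zero, not_le]
    have h := log_one_add_div_le zero_le_one hu'
    have : 0 < Real.log (1 + 1 / ‖u‖) := Real.log_pos (by simpa using hu')
    linarith
  have : IsFiniteMeasure (U.withDensity f) := isFiniteMeasure_withDensity hU.finite.ne
  rw [← withDensity_inv_same hfm hpos (ae_of_all _ fun u => ENNReal.ofReal_ne_top)]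
  have hac : U.withDensity f ≪ U := withDensity_absolutelyContinuous _ _
  exact SigmaFinite.withDensity_of_ne_top
    (hac.ae_le (hpos.mono fun u hu => by simpa using hu))

theorem IsThorinMeasure.integrable_log {n : ℕ} {U : Measure (E (Fin n))}
    (hU : IsThorinMeasure U) {K : ℝ} (hK : 0 ≤ K) :
    Integrable (fun u => Real.log (1 + K / ‖u‖)) U := by
  have hb : Integrable (fun u => (1 + K) * min (1 + lnMinus ‖u‖) (1 / ‖u‖)) U := by
    refine Integrable.const_mul ⟨?_, ?_⟩ _
    · have := measurable_lnMinus
      exact Measurable.aestronglyMeasurable (by fun_prop)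
    · rw [hasFiniteIntegral_iff_norm]
      refine lt_of_eq_of_lt (lintegral_congr_ae ?_) hU.finite
      filter_upwards [ae_orthantStar hU] with u hu
      have hu' : 0 < ‖u‖ := norm_pos_iff.2 hu.2
      have h := log_one_add_div_le zero_le_one hu'
      have : 0 < Real.log (1 + 1 / ‖u‖) := Real.log_pos (by simpa using hu')
      rw [Real.norm_of_nonneg (by linarith)]
  refine hb.mono' (Measurable.aestronglyMeasurable (by fun_prop)) ?_
  filter_upwards [ae_orthantStar hU] with u hu
  have hu' : 0 < ‖u‖ := norm_pos_iff.2 hu.2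
  rw [Real.norm_of_nonneg (Real.log_nonneg (by simpa using by positivity))]
  exact log_one_add_div_le hK hu'

end

section

/-! ### The Lévy measure of a Thorin subordinator -/

/-- The measure `e^{-g‖u‖²} dg/g U(du)` on pairs `(u, g)`, `g > 0`. -/
def thorinPolar {n : ℕ} (U : Measure (E (Fin n))) : Measure (E (Fin n) × ℝ) :=
  (U.prod (volume.restrict (Ioi (0 : ℝ)))).withDensity
    fun p => ENNReal.ofReal (Real.exp (-‖p.1‖ ^ 2 * p.2) / p.2)

/-- The Lévy measure of a Thorin subordinator with Thorin measure `U`: the image of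
`e^{-g‖u‖²} dg/g U(du)` under `(u, g) ↦ g u`. -/
def thorinLevy {n : ℕ} (U : Measure (E (Fin n))) : Measure (E (Fin n)) :=
  (thorinPolar U).map fun p => p.2 • p.1

variable {n : ℕ} {U : Measure (E (Fin n))}

instance [SFinite U] : SFinite (thorinLevy U) := by
  unfold thorinLevy thorinPolar; infer_instance

theorem ae_polar_pos {ν : Measure (E (Fin n))} [SFinite ν] :
    ∀ᵐ p ∂(ν.prod (volume.restrict (Ioi (0 : ℝ)))), 0 < p.2 := by
  have h : ∀ᵐ g ∂(volume.restrict (Ioi (0 : ℝ))), 0 < g :=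
    ae_restrict_of_forall_mem measurableSet_Ioi fun g hg => hg
  exact Measure.quasiMeasurePreserving_snd.ae h

theorem lintegral_thorinLevy [SFinite U] {f : E (Fin n) → ℝ≥0∞} (hf : Measurable f) :
    ∫⁻ x, f x ∂(thorinLevy U) = ∫⁻ u, (∫⁻ g in Ioi (0 : ℝ),
      ENNReal.ofReal (Real.exp (-‖u‖ ^ 2 * g) / g) * f (g • u)) ∂U := by
  rw [thorinLevy, lintegral_map hf (by fun_prop), thorinPolar,
    lintegral_withDensity_eq_lintegral_mul _ (by fun_prop) (by fun_prop),
    lintegral_prod]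
  · rfl
  · exact Measurable.aemeasurable (by fun_prop)

theorem measurableSet_orthantStar : MeasurableSet (orthantStar (Fin n)) := by
  unfold orthantStar
  refine MeasurableSet.inter ?_ (measurableSet_singleton (0 : E (Fin n))).compl
  exact measurableSet_setOfPred.2 (by fun_prop)

theorem smul_mem_orthantStar {u : E (Fin n)} (hu : u ∈ orthantStar (Fin n)) {g : ℝ} (hg : 0 < g) :
    g • u ∈ orthantStar (Fin n) :=
  ⟨fun i => mul_nonneg hg.le (hu.1 i), smul_ne_zero hg.ne' hu.2⟩

theorem ae_thorinLevy_orthantStar [SFinite U] (hU : ∀ᵐ u ∂U, u ∈ orthantStar (Fin n)) :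
    ∀ᵐ x ∂(thorinLevy U), x ∈ orthantStar (Fin n) := by
  unfold thorinLevy
  refine (ae_map_iff (by fun_prop) measurableSet_orthantStar).2 ?_
  unfold thorinPolar
  refine (withDensity_absolutelyContinuous _ _).ae_le ?_
  filter_upwards [ae_polar_pos (ν := U), Measure.quasiMeasurePreserving_fst.ae hU] with p h1 h2
  exact smul_mem_orthantStar h2 h1

/-- The jumps of a Thorin subordinator are of finite variation: `min 1 ‖g u‖` is dominated by
`2 (1 - e^{-g ‖u‖})`, whose integral is a Frullani integral. -/
theorem lintegral_min_thorinLevy_lt_top (hU : IsThorinMeasure U) :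
    ∫⁻ x, ENNReal.ofReal (min 1 ‖x‖) ∂(thorinLevy U) < ∞ := by
  have := hU.sigmaFinite
  rw [lintegral_thorinLevy (by fun_prop)]
  have hle : ∀ᵐ u ∂U, ∫⁻ g in Ioi (0 : ℝ),
      ENNReal.ofReal (Real.exp (-‖u‖ ^ 2 * g) / g) * ENNReal.ofReal (min 1 ‖g • u‖) ≤
      2 * ENNReal.ofReal (Real.log (1 + 1 / ‖u‖)) := by
    filter_upwards [ae_orthantStar hU] with u hu
    have hu' : 0 < ‖u‖ := norm_pos_iff.2 hu.2
    have h := lintegral_frullani (b := ‖u‖ ^ 2) (r := ‖u‖) (by positivity) hu'.le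
    have h2 : ‖u‖ / ‖u‖ ^ 2 = 1 / ‖u‖ := by field_simp
    rw [← h2, ← h, ← lintegral_const_mul _ (by fun_prop)]
    refine setLIntegral_mono' measurableSet_Ioi fun g hg => ?_
    have hg : 0 < g := hg
    have h3 : (2 : ℝ≥0∞) = ENNReal.ofReal 2 := by simp
    simp only [h3]
    rw [← ENNReal.ofReal_mul (by positivity), ← ENNReal.ofReal_mul zero_le_two]
    refine ENNReal.ofReal_le_ofReal ?_
    rw [norm_smul, Real.norm_of_nonneg hg.le, mul_comm g]
    have := min_one_le_two_mul_one_sub_exp_neg (x := ‖u‖ * g) (by positivity)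
    calc _ ≤ (Real.exp (-‖u‖ ^ 2 * g) / g) * (2 * (1 - Real.exp (-(‖u‖ * g)))) := by gcongr
      _ = _ := by ring
  refine (lintegral_mono_ae hle).trans_lt ?_
  rw [lintegral_const_mul' _ _ (by simp)]
  refine ENNReal.mul_lt_top (by simp) ?_
  have := (hU.integrable_log zero_le_one).hasFiniteIntegral
  refine lt_of_le_of_lt (lintegral_mono fun u => ?_) this
  rw [← ofReal_norm]
  exact ENNReal.ofReal_le_ofReal (le_abs_self _)

theorem integrable_min_thorinLevy (hU : IsThorinMeasure U) :
    Integrable (fun x => min 1 ‖x‖) (thorinLevy U) := by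
  refine ⟨by fun_prop, ?_⟩
  rw [hasFiniteIntegral_iff_ofReal (ae_of_all _ fun x => by positivity)]
  exact lintegral_min_thorinLevy_lt_top hU

theorem isLevyMeasure_thorinLevy (hU : IsThorinMeasure U) : IsLevyMeasure (thorinLevy U) := by
  have := hU.sigmaFinite
  refine ⟨?_, ?_⟩
  · have h := ae_thorinLevy_orthantStar (ae_orthantStar hU)
    rw [ae_iff] at h
    refine measure_mono_null (fun x hx => ?_) h
    exact fun h2 => h2.2 hx
  · refine lt_of_le_of_lt (lintegral_mono fun x => ENNReal.ofReal_le_ofReal ?_)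
      (lintegral_min_thorinLevy_lt_top hU)
    rw [min_comm]
    rcases le_total 1 ‖x‖ with h | h
    · rw [min_eq_left (one_le_pow₀ h), min_eq_left h]
    · rw [min_eq_right (pow_le_one₀ (norm_nonneg _) h), min_eq_right h]
      nlinarith [norm_nonneg x]

variable {F : Type*} [NormedAddCommGroup F] [NormedSpace ℝ F]

theorem integrable_polar_of_integrable_thorinLevy [SFinite U] {f : E (Fin n) → F}
    (hf : Integrable f (thorinLevy U)) :
    Integrable (fun p : E (Fin n) × ℝ => (Real.exp (-‖p.1‖ ^ 2 * p.2) / p.2) • f (p.2 • p.1))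
      (U.prod (volume.restrict (Ioi (0 : ℝ)))) := by
  have h := (integrable_map_measure hf.aestronglyMeasurable (by fun_prop)).1 hf
  rw [thorinPolar, integrable_withDensity_iff_integrable_smul' (by fun_prop)
    (ae_of_all _ fun _ => by simp)] at h
  refine h.congr ?_
  filter_upwards [ae_polar_pos (ν := U)] with p hp
  rw [ENNReal.toReal_ofReal (by positivity)]
  rfl

theorem integral_thorinLevy [CompleteSpace F] [SFinite U] {f : E (Fin n) → F}
    (hf : Integrable f (thorinLevy U)) :
    ∫ x, f x ∂(thorinLevy U) = ∫ u, (∫ g in Ioi (0 : ℝ),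
      (Real.exp (-‖u‖ ^ 2 * g) / g) • f (g • u)) ∂U := by
  have h := integrable_polar_of_integrable_thorinLevy hf
  rw [thorinLevy, integral_map (by fun_prop) hf.aestronglyMeasurable, thorinPolar,
    integral_withDensity_eq_integral_toReal_smul (by fun_prop) (ae_of_all _ fun _ => by simp),
    ← integral_prod _ h]
  refine integral_congr_ae ?_
  filter_upwards [ae_polar_pos (ν := U)] with p hp
  rw [ENNReal.toReal_ofReal (by positivity)]

/-- The Laplace-type exponent of `thorinLevy U`, for exponents `w` that are positively homogeneous
of degree one with nonnegative real part: a Frullani integral along each ray. It applies both to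
`w u = ⟨l, u⟩`, and to the exponents of a Brownian motion at the time `u`. -/
theorem integral_one_sub_exp_neg_thorinLevy (hU : IsThorinMeasure U) {w : E (Fin n) → ℂ}
    {K : ℝ} (hw : Measurable w) (hre : ∀ u ∈ orthantStar (Fin n), 0 ≤ (w u).re)
    (hK : ∀ u ∈ orthantStar (Fin n), ‖w u‖ ≤ K * ‖u‖)
    (hhom : ∀ u ∈ orthantStar (Fin n), ∀ g : ℝ, 0 < g → w (g • u) = w u * g) :
    Integrable (fun x => 1 - Complex.exp (-w x)) (thorinLevy U) ∧
    Integrable (fun u => Complex.log (1 + w u / (‖u‖ ^ 2 : ℝ))) U ∧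
    ∫ x, (1 - Complex.exp (-w x)) ∂(thorinLevy U) =
      ∫ u, Complex.log (1 + w u / (‖u‖ ^ 2 : ℝ)) ∂U := by
  have := hU.sigmaFinite
  have hmeas : Measurable fun x => 1 - Complex.exp (-w x) := by fun_prop
  have hint : Integrable (fun x => 1 - Complex.exp (-w x)) (thorinLevy U) := by
    refine ((integrable_min_thorinLevy hU).const_mul (max 2 K)).mono' hmeas.aestronglyMeasurable ?_
    filter_upwards [ae_thorinLevy_orthantStar (ae_orthantStar hU)] with x hx
    exact norm_one_sub_exp_neg_le_max_mul_min (hre x hx) (hK x hx) (norm_nonneg x)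
  have heq : ∀ u ∈ orthantStar (Fin n), ∫ g in Ioi (0 : ℝ),
      (Real.exp (-‖u‖ ^ 2 * g) / g) • (1 - Complex.exp (-w (g • u))) =
      Complex.log (1 + w u / (‖u‖ ^ 2 : ℝ)) := by
    intro u hu
    have hu' : 0 < ‖u‖ := norm_pos_iff.2 hu.2
    rw [← (integral_frullani (b := ‖u‖ ^ 2) (by positivity) (hre u hu)).2]
    refine setIntegral_congr_fun measurableSet_Ioi fun g hg => ?_
    simp only [hhom u hu g hg]
  refine ⟨hint, ?_, ?_⟩
  · refine (integrable_polar_of_integrable_thorinLevy hint).integral_prod_left.congr ?_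
    filter_upwards [ae_orthantStar hU] with u hu using heq u hu
  · rw [integral_thorinLevy hint]
    refine integral_congr_ae ?_
    filter_upwards [ae_orthantStar hU] with u hu using heq u hu

end

section

variable {n : ℕ}

/-! ### Laplace exponents on complex strips -/

/-- The exponent `ε ∑ᵢ xᵢ + z ⟨θ, x⟩`. At real `z` close to `0` it is the exponent of a Laplace
transform at a point of the positive orthant; at `z = -i`, for `ε → 0`, it becomes the exponent
`-i ⟨θ, x⟩` of a Fourier transform. -/
def tiltExponent (θ : E (Fin n)) (ε : ℝ) (z : ℂ) (x : E (Fin n)) : ℂ :=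
  ε * (∑ i, x i : ℝ) + z * (inner ℝ θ x : ℝ)

/-- The strip `|Re z| ‖θ‖ < ε / 2`, on which `tiltExponent` has nonnegative real part for all
`x` in the positive orthant. -/
def tiltStrip (θ : E (Fin n)) (ε : ℝ) : Set ℂ := {z | |z.re| * ‖θ‖ < ε / 2}

theorem norm_le_sum_of_nonneg {x : E (Fin n)} (hx : ∀ i, 0 ≤ x i) : ‖x‖ ≤ ∑ i, x i := by
  have h := Finset.sum_nonneg fun i (_ : i ∈ Finset.univ) => hx i
  rw [EuclideanSpace.norm_eq]
  refine Real.sqrt_le_iff.2 ⟨h, ?_⟩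
  simp only [Real.norm_eq_abs, sq_abs]
  exact Finset.sum_sq_le_sq_sum_of_nonneg fun i _ => hx i

theorem abs_coord_le_norm (x : E (Fin n)) (i : Fin n) : |x i| ≤ ‖x‖ := by
  simpa using PiLp.norm_apply_le x i

theorem sum_le_mul_norm (x : E (Fin n)) : ∑ i, x i ≤ n * ‖x‖ := by
  calc ∑ i, x i ≤ ∑ _i : Fin n, ‖x‖ :=
        Finset.sum_le_sum fun i _ => (le_abs_self _).trans (abs_coord_le_norm x i)
    _ = n * ‖x‖ := by simp

theorem measurable_tiltExponent (θ : E (Fin n)) (ε : ℝ) (z : ℂ) :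
    Measurable (tiltExponent θ ε z) := by
  unfold tiltExponent; fun_prop

theorem re_tiltExponent_ge {θ : E (Fin n)} {ε : ℝ} (hε : 0 ≤ ε) {z : ℂ} (hz : z ∈ tiltStrip θ ε)
    {x : E (Fin n)} (hx : ∀ i, 0 ≤ x i) : ε / 2 * ‖x‖ ≤ (tiltExponent θ ε z x).re := by
  have h1 := norm_le_sum_of_nonneg hx
  have h2 : |z.re * inner ℝ θ x| ≤ |z.re| * ‖θ‖ * ‖x‖ := by
    rw [abs_mul, mul_assoc]
    gcongr
    exact abs_real_inner_le_norm θ x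
  have h3 : |z.re| * ‖θ‖ < ε / 2 := hz
  have h4 := (abs_le.1 h2).1
  have h5 : (tiltExponent θ ε z x).re = ε * (∑ i, x i) + z.re * inner ℝ θ x := by
    simp only [tiltExponent, Complex.add_re, Complex.mul_re, Complex.ofReal_re, Complex.ofReal_im,
      mul_zero, sub_zero]
  rw [h5]
  nlinarith [mul_le_mul_of_nonneg_left h1 hε, mul_le_mul_of_nonneg_right h3.le (norm_nonneg x)]

theorem norm_tiltExponent_le (θ : E (Fin n)) {ε : ℝ} (hε : 0 ≤ ε) (z : ℂ) {x : E (Fin n)}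
    (hx : ∀ i, 0 ≤ x i) : ‖tiltExponent θ ε z x‖ ≤ (ε * n + ‖z‖ * ‖θ‖) * ‖x‖ := by
  have hs := Finset.sum_nonneg fun i (_ : i ∈ Finset.univ) => hx i
  have h1 := sum_le_mul_norm x
  refine (norm_add_le _ _).trans ?_
  rw [norm_mul, norm_mul, Complex.norm_real, Complex.norm_real, Complex.norm_real,
    Real.norm_of_nonneg hε, Real.norm_of_nonneg hs, add_mul, mul_assoc, mul_assoc]
  gcongr
  exact norm_inner_le_norm _ _

variable {m : Measure (E (Fin n))}

theorem integrable_tilt (hm : Integrable (fun x => min 1 ‖x‖) m)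
    (hpos : ∀ᵐ x ∂m, ∀ i, 0 ≤ x i) {θ : E (Fin n)} {ε : ℝ} (hε : 0 ≤ ε) {z : ℂ}
    (hz : z ∈ tiltStrip θ ε) :
    Integrable (fun x => 1 - Complex.exp (-tiltExponent θ ε z x)) m := by
  have := measurable_tiltExponent θ ε z
  refine (hm.const_mul (max 2 (ε * n + ‖z‖ * ‖θ‖))).mono'
    (Measurable.aestronglyMeasurable (by fun_prop)) ?_
  filter_upwards [hpos] with x hx
  exact norm_one_sub_exp_neg_le_max_mul_min
    (le_trans (by positivity) (re_tiltExponent_ge hε hz hx)) (norm_tiltExponent_le θ hε z hx)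
    (norm_nonneg x)

theorem isOpen_tiltStrip (θ : E (Fin n)) (ε : ℝ) : IsOpen (tiltStrip θ ε) :=
  isOpen_lt (by fun_prop) continuous_const

theorem convex_tiltStrip (θ : E (Fin n)) (ε : ℝ) : Convex ℝ (tiltStrip θ ε) := by
  intro z hz w hw a b ha hb hab
  have h1 : |z.re| * ‖θ‖ < ε / 2 := hz
  have h2 : |w.re| * ‖θ‖ < ε / 2 := hw
  have h3 : |(a • z + b • w).re| ≤ a * |z.re| + b * |w.re| := by
    simp only [Complex.add_re, Complex.smul_re, smul_eq_mul]
    refine (abs_add_le _ _).trans ?_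
    rw [abs_mul, abs_mul, abs_of_nonneg ha, abs_of_nonneg hb]
  have h4 : a * (|z.re| * ‖θ‖) + b * (|w.re| * ‖θ‖) < ε / 2 := by
    have hm : max (|z.re| * ‖θ‖) (|w.re| * ‖θ‖) < ε / 2 := max_lt h1 h2
    calc _ ≤ a * max (|z.re| * ‖θ‖) (|w.re| * ‖θ‖) + b * max (|z.re| * ‖θ‖) (|w.re| * ‖θ‖) := by
          gcongr <;> simp
      _ = max (|z.re| * ‖θ‖) (|w.re| * ‖θ‖) := by rw [← add_mul, hab, one_mul]
      _ < _ := hm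
  calc _ ≤ (a * |z.re| + b * |w.re|) * ‖θ‖ := by gcongr
    _ = a * (|z.re| * ‖θ‖) + b * (|w.re| * ‖θ‖) := by ring
    _ < _ := h4

theorem differentiableOn_integral_tilt (hm : Integrable (fun x => min 1 ‖x‖) m)
    (hpos : ∀ᵐ x ∂m, ∀ i, 0 ≤ x i) (θ : E (Fin n)) {ε : ℝ} (hε : 0 < ε) :
    DifferentiableOn ℂ (fun z => ∫ x, (1 - Complex.exp (-tiltExponent θ ε z x)) ∂m)
      (tiltStrip θ ε) := by
  intro z hz
  have hderiv : ∀ x : E (Fin n), ∀ w : ℂ,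
      HasDerivAt (fun w => 1 - Complex.exp (-tiltExponent θ ε w x))
        ((inner ℝ θ x : ℝ) * Complex.exp (-tiltExponent θ ε w x)) w := by
    intro x w
    have h1 : HasDerivAt (fun w => tiltExponent θ ε w x) (1 * ((inner ℝ θ x : ℝ) : ℂ)) w :=
      ((hasDerivAt_id w).mul_const _).const_add _
    refine ((h1.neg.cexp).const_sub 1).congr_deriv ?_
    simp only [Pi.neg_apply]
    ring
  have h := (hasDerivAt_integral_of_dominated_loc_of_deriv_le (𝕜 := ℂ) (μ := m)
    (F := fun z x => 1 - Complex.exp (-tiltExponent θ ε z x))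
    (F' := fun z x => (inner ℝ θ x : ℝ) * Complex.exp (-tiltExponent θ ε z x))
    (bound := fun x => (‖θ‖ * max 1 (2 / ε)) * min 1 ‖x‖)
    (x₀ := z) ((isOpen_tiltStrip θ ε).mem_nhds hz) ?_ (integrable_tilt hm hpos hε.le hz) ?_ ?_
    (hm.const_mul _) (ae_of_all _ fun x w _ => hderiv x w)).2
  · exact h.differentiableAt.differentiableWithinAt
  · refine Eventually.of_forall fun w => ?_
    have := measurable_tiltExponent θ ε w
    exact Measurable.aestronglyMeasurable (by fun_prop)
  · have := measurable_tiltExponent θ ε z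
    exact Measurable.aestronglyMeasurable (by fun_prop)
  · filter_upwards [hpos] with x hx w hw
    have h1 := re_tiltExponent_ge hε.le hw hx
    rw [norm_mul, Complex.norm_real, Complex.norm_exp, Complex.neg_re]
    have h2 : ‖inner ℝ θ x‖ ≤ ‖θ‖ * ‖x‖ := norm_inner_le_norm _ _
    have h3 : Real.exp (-(tiltExponent θ ε w x).re) ≤ Real.exp (-(ε / 2 * ‖x‖)) := by gcongr
    have h4 : ‖x‖ * Real.exp (-(ε / 2 * ‖x‖)) ≤ max 1 (2 / ε) * min 1 ‖x‖ := by
      rcases le_total 1 ‖x‖ with h | h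
      · rw [min_eq_left h, mul_one]
        refine le_trans ?_ (le_max_right _ _)
        rw [Real.exp_neg, ← div_eq_mul_inv, div_le_div_iff₀ (Real.exp_pos _) hε]
        linarith [Real.add_one_le_exp (ε / 2 * ‖x‖)]
      · rw [min_eq_right h, mul_comm]
        gcongr
        refine le_trans ?_ (le_max_left _ _)
        exact Real.exp_le_one_iff.2 (by simp; positivity)
    calc _ ≤ (‖θ‖ * ‖x‖) * Real.exp (-(ε / 2 * ‖x‖)) := by gcongr
      _ = ‖θ‖ * (‖x‖ * Real.exp (-(ε / 2 * ‖x‖))) := by ring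
      _ ≤ ‖θ‖ * (max 1 (2 / ε) * min 1 ‖x‖) := by gcongr
      _ = _ := by ring

theorem neg_I_mem_tiltStrip (θ : E (Fin n)) {ε : ℝ} (hε : 0 < ε) :
    -Complex.I ∈ tiltStrip θ ε := by
  simp [tiltStrip, hε]

theorem tendsto_integral_tilt (hm : Integrable (fun x => min 1 ‖x‖) m)
    (hpos : ∀ᵐ x ∂m, ∀ i, 0 ≤ x i) (θ : E (Fin n)) :
    Tendsto (fun ε : ℝ => ∫ x, (1 - Complex.exp (-tiltExponent θ ε (-Complex.I) x)) ∂m)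
      (𝓝[>] 0) (𝓝 (∫ x, (1 - Complex.exp (Complex.I * (inner ℝ θ x : ℝ))) ∂m)) := by
  refine tendsto_integral_filter_of_dominated_convergence
    (fun x => max 2 (1 * n + 1 * ‖θ‖) * min 1 ‖x‖) ?_ ?_ (hm.const_mul _) ?_
  · refine Eventually.of_forall fun ε => ?_
    have := measurable_tiltExponent θ ε (-Complex.I)
    exact Measurable.aestronglyMeasurable (by fun_prop)
  · have h1 : ∀ᶠ ε : ℝ in 𝓝[>] 0, ε < 1 :=
      nhdsWithin_le_nhds (Iio_mem_nhds zero_lt_one)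
    filter_upwards [self_mem_nhdsWithin, h1] with ε hε h1
    have hε : 0 < ε := hε
    filter_upwards [hpos] with x hx
    refine norm_one_sub_exp_neg_le_max_mul_min
      (le_trans (by positivity) (re_tiltExponent_ge hε.le (neg_I_mem_tiltStrip θ hε) hx)) ?_
      (norm_nonneg x)
    refine (norm_tiltExponent_le θ hε.le _ hx).trans ?_
    rw [norm_neg, Complex.norm_I]
    gcongr
  · refine ae_of_all _ fun x => ?_
    refine Tendsto.mono_left ?_ nhdsWithin_le_nhds
    have : Continuous fun ε : ℝ => 1 - Complex.exp (-tiltExponent θ ε (-Complex.I) x) := by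
      unfold tiltExponent; fun_prop
    have h := this.tendsto 0
    convert h using 3
    simp [tiltExponent]

end

section

variable {n : ℕ}

/-! ### From the Laplace transform to the characteristic function -/

theorem tiltExponent_ofReal (θ : E (Fin n)) (ε y : ℝ) (x : E (Fin n)) :
    tiltExponent θ ε y x =
      ((inner ℝ (WithLp.toLp 2 fun i => ε + y * θ i : E (Fin n)) x : ℝ) : ℂ) := by
  simp only [tiltExponent, PiLp.inner_apply, RCLike.inner_apply, conj_trivial, mul_add,
    Finset.sum_add_distrib]
  push_cast
  rw [Finset.mul_sum, Finset.mul_sum]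
  congr 1
  · exact Finset.sum_congr rfl fun i _ => mul_comm _ _
  · exact Finset.sum_congr rfl fun i _ => by ring

theorem integral_one_sub_exp_inner_thorinLevy {U : Measure (E (Fin n))} (hU : IsThorinMeasure U)
    {l : E (Fin n)} (hl : ∀ i, 0 ≤ l i) :
    ∫ x, (1 - Complex.exp (-((inner ℝ l x : ℝ) : ℂ))) ∂(thorinLevy U) =
      ((∫ u, Real.log ((‖u‖ ^ 2 + inner ℝ l u) / ‖u‖ ^ 2) ∂U : ℝ) : ℂ) := by
  have hnn : ∀ u ∈ orthantStar (Fin n), 0 ≤ inner ℝ l u := by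
    intro u hu
    rw [PiLp.inner_apply]
    exact Finset.sum_nonneg fun i _ => by
      simpa using mul_nonneg (hu.1 i) (hl i)
  obtain ⟨-, -, h⟩ := integral_one_sub_exp_neg_thorinLevy hU (w := fun x => ((inner ℝ l x : ℝ) : ℂ))
    (K := ‖l‖) (by fun_prop) (fun u hu => by simpa using hnn u hu)
    (fun u hu => by rw [Complex.norm_real]; exact norm_inner_le_norm _ _)
    (fun u hu g hg => by
      have : inner ℝ l (g • u) = inner ℝ l u * g := by rw [inner_smul_right, mul_comm]
      simp only [this, Complex.ofReal_mul])
  rw [h, ← integral_complex_ofReal]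
  refine integral_congr_ae ?_
  filter_upwards [ae_orthantStar hU] with u hu
  have hu' : 0 < ‖u‖ := norm_pos_iff.2 hu.2
  have := hnn u hu
  rw [Complex.ofReal_log (by positivity)]
  congr 1
  have hne : (‖u‖ : ℂ) ≠ 0 := by exact_mod_cast hu'.ne'
  push_cast
  field_simp

/-- The characteristic function of a positive random vector whose Laplace transform is that of a
Thorin subordinator: both sides extend analytically from the real points of a strip. -/
theorem charFun_of_thorin_laplace {Ω : Type*} [MeasurableSpace Ω] {P : Measure Ω}
    [IsProbabilityMeasure P] {V : Ω → E (Fin n)} (hV : Measurable V)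
    (hpos : ∀ᵐ ω ∂P, ∀ i, 0 ≤ V ω i) {U : Measure (E (Fin n))} (hU : IsThorinMeasure U)
    {t : ℝ} {d : E (Fin n)} (hL : ∀ l : E (Fin n), (∀ i, 0 ≤ l i) →
      -Real.log (∫ ω, Real.exp (-inner ℝ l (V ω)) ∂P) =
        t * inner ℝ d l + t * ∫ u, Real.log ((‖u‖ ^ 2 + inner ℝ l u) / ‖u‖ ^ 2) ∂U)
    (θ : E (Fin n)) :
    charFun (P.map V) θ = Complex.exp (t * (Complex.I * (inner ℝ d θ : ℝ) +
      ∫ x, (Complex.exp (Complex.I * (inner ℝ θ x : ℝ)) - 1) ∂(thorinLevy U))) := by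
  have := hU.sigmaFinite
  have : IsProbabilityMeasure (P.map V) := Measure.isProbabilityMeasure_map hV.aemeasurable
  have hposV : ∀ᵐ x ∂(P.map V), ∀ i, 0 ≤ x i := by
    rw [ae_map_iff hV.aemeasurable (measurableSet_setOfPred.2 (by fun_prop))]
    exact hpos
  have hminV : Integrable (fun x => min 1 ‖x‖) (P.map V) := by
    refine (integrable_const (1 : ℝ)).mono' (by fun_prop) (ae_of_all _ fun x => ?_)
    rw [Real.norm_of_nonneg (by positivity)]
    exact min_le_left _ _
  have hposU : ∀ᵐ x ∂(thorinLevy U), ∀ i, 0 ≤ x i :=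
    (ae_thorinLevy_orthantStar (ae_orthantStar hU)).mono fun x hx => hx.1
  have hminU := integrable_min_thorinLevy hU
  -- the identity theorem extends the hypothesis from real `z` to the whole strip
  have hstrip : ∀ ε : ℝ, 0 < ε → ∀ z ∈ tiltStrip θ ε,
      1 - ∫ x, (1 - Complex.exp (-tiltExponent θ ε z x)) ∂(P.map V) =
        Complex.exp (-(t * (tiltExponent θ ε z d +
          ∫ x, (1 - Complex.exp (-tiltExponent θ ε z x)) ∂(thorinLevy U)))) := by
    intro ε hε
    have hd1 := (differentiableOn_integral_tilt hminV hposV θ hε).const_sub 1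
    have hd2 := differentiableOn_integral_tilt hminU hposU θ hε
    have hd3 : DifferentiableOn ℂ (fun z => tiltExponent θ ε z d) (tiltStrip θ ε) := by
      unfold tiltExponent; fun_prop
    have hd4 : DifferentiableOn ℂ (fun z => Complex.exp (-(t * (tiltExponent θ ε z d +
          ∫ x, (1 - Complex.exp (-tiltExponent θ ε z x)) ∂(thorinLevy U))))) (tiltStrip θ ε) :=
      (((hd3.add hd2).const_mul (t : ℂ)).neg).cexp
    have ho := isOpen_tiltStrip θ ε
    have h0 : (0 : ℂ) ∈ tiltStrip θ ε := by simp [tiltStrip, hε]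
    have hreal : ∀ y : ℝ, (y : ℂ) ∈ tiltStrip θ ε →
        1 - ∫ x, (1 - Complex.exp (-tiltExponent θ ε y x)) ∂(P.map V) =
        Complex.exp (-(t * (tiltExponent θ ε y d +
          ∫ x, (1 - Complex.exp (-tiltExponent θ ε y x)) ∂(thorinLevy U)))) := by
      intro y hy
      set l : E (Fin n) := WithLp.toLp 2 fun i => ε + y * θ i with hldef
      have hl : ∀ i, 0 ≤ l i := by
        intro i
        have h1 : |y| * ‖θ‖ < ε / 2 := by simpa [tiltStrip] using hy
        have h2 : |y * θ i| ≤ |y| * ‖θ‖ := by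
          rw [abs_mul]; gcongr; exact abs_coord_le_norm θ i
        have h3 := (abs_le.1 h2).1
        simp only [hldef]
        linarith
      simp only [tiltExponent_ofReal, ← hldef]
      rw [integral_one_sub_exp_inner_thorinLevy hU hl]
      have hexp : Integrable (fun ω => Real.exp (-inner ℝ l (V ω))) P := by
        refine (integrable_const (1 : ℝ)).mono' (by fun_prop) ?_
        filter_upwards [hpos] with ω hω
        rw [Real.norm_of_nonneg (Real.exp_pos _).le, Real.exp_le_one_iff, PiLp.inner_apply,
          neg_nonpos]
        exact Finset.sum_nonneg fun i _ => by simpa using mul_nonneg (hω i) (hl i)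
      have hL' := hL l hl
      have hLpos : 0 < ∫ ω, Real.exp (-inner ℝ l (V ω)) ∂P := integral_exp_pos hexp
      have hlhs : 1 - ∫ x, (1 - Complex.exp (-((inner ℝ l x : ℝ) : ℂ))) ∂(P.map V) =
          ((∫ ω, Real.exp (-inner ℝ l (V ω)) ∂P : ℝ) : ℂ) := by
        rw [integral_map hV.aemeasurable (by fun_prop)]
        have hc : ∀ ω, (1 : ℂ) - Complex.exp (-((inner ℝ l (V ω) : ℝ) : ℂ)) =
            ((1 - Real.exp (-inner ℝ l (V ω)) : ℝ) : ℂ) := by intro ω; push_cast; rfl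
        simp only [hc]
        rw [integral_complex_ofReal, integral_sub (integrable_const _) hexp]
        simp
      rw [hlhs, ← Real.exp_log hLpos]
      have : Real.log (∫ ω, Real.exp (-inner ℝ l (V ω)) ∂P) = -(t * (inner ℝ l d +
          ∫ u, Real.log ((‖u‖ ^ 2 + inner ℝ l u) / ‖u‖ ^ 2) ∂U)) := by
        rw [real_inner_comm]; linarith
      rw [this]
      push_cast
      rfl
    have hfreq : ∃ᶠ z in 𝓝[≠] (0 : ℂ),
        1 - ∫ x, (1 - Complex.exp (-tiltExponent θ ε z x)) ∂(P.map V) =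
        Complex.exp (-(t * (tiltExponent θ ε z d +
          ∫ x, (1 - Complex.exp (-tiltExponent θ ε z x)) ∂(thorinLevy U)))) := by
      have hmap : Tendsto (fun y : ℝ => (y : ℂ)) (𝓝[≠] 0) (𝓝[≠] 0) := by
        refine tendsto_nhdsWithin_iff.2 ⟨?_, ?_⟩
        · exact (Complex.continuous_ofReal.tendsto 0).mono_left nhdsWithin_le_nhds
        · filter_upwards [self_mem_nhdsWithin] with y hy
          simpa using hy
      refine hmap.frequently (Eventually.frequently ?_)
      have := (Complex.continuous_ofReal.tendsto 0).eventually (ho.mem_nhds (by simpa using h0))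
      filter_upwards [nhdsWithin_le_nhds this] with y hy using hreal y hy
    exact fun z hz => AnalyticOnNhd.eqOn_of_preconnected_of_frequently_eq
      (hd1.analyticOnNhd ho) (hd4.analyticOnNhd ho)
      (convex_tiltStrip θ ε).isPreconnected h0 hfreq hz
  -- let `ε → 0` at `z = -i`
  have hl1 := (tendsto_integral_tilt hminV hposV θ).const_sub 1
  have hl2 := tendsto_integral_tilt hminU hposU θ
  have hl3 : Tendsto (fun ε : ℝ => tiltExponent θ ε (-Complex.I) d) (𝓝[>] (0 : ℝ))
      (𝓝 (-Complex.I * (inner ℝ θ d : ℝ))) := by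
    refine Tendsto.mono_left ?_ nhdsWithin_le_nhds
    have : Continuous fun ε : ℝ => tiltExponent θ ε (-Complex.I) d := by
      unfold tiltExponent; fun_prop
    convert this.tendsto 0 using 2
    simp [tiltExponent]
  have hl4 := ((hl3.add hl2).const_mul (t : ℂ)).neg.cexp
  have hl5 := hl1.congr' (eventually_nhdsWithin_of_forall fun ε hε =>
    hstrip ε hε _ (neg_I_mem_tiltStrip θ hε))
  have heq := tendsto_nhds_unique (l := 𝓝[>] (0 : ℝ)) hl5 hl4
  have hintV : Integrable (fun x => Complex.exp (Complex.I * (inner ℝ θ x : ℝ))) (P.map V) := by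
    refine (integrable_const (1 : ℝ)).mono' (Measurable.aestronglyMeasurable (by fun_prop))
      (ae_of_all _ fun x => ?_)
    rw [mul_comm, Complex.norm_exp_ofReal_mul_I]
  have hchar : charFun (P.map V) θ =
      1 - ∫ x, (1 - Complex.exp (Complex.I * (inner ℝ θ x : ℝ))) ∂(P.map V) := by
    rw [integral_sub (integrable_const _) hintV, charFun_apply]
    simp only [integral_const, probReal_univ, one_smul, sub_sub_cancel]
    refine integral_congr_ae (ae_of_all _ fun x => ?_)
    simp only [real_inner_comm, mul_comm]
  rw [hchar, heq]
  congr 1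
  rw [real_inner_comm θ d]
  have : ∀ x : E (Fin n), Complex.exp (Complex.I * (inner ℝ θ x : ℝ)) - 1 =
    -(1 - Complex.exp (Complex.I * (inner ℝ θ x : ℝ))) := fun x => by ring
  simp only [this, integral_neg]
  ring

/-- An exponent is determined by small times `t`, for which `t a` and `t b` lie in the strip
where `exp` is injective. -/
theorem eq_of_exp_smul_eq {a b : ℂ}
    (h : ∀ t : ℝ≥0, Complex.exp ((t : ℝ) * a) = Complex.exp ((t : ℝ) * b)) : a = b := by
  set r : ℝ := 1 / (|a.im| + |b.im| + 1) with hr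
  have hr0 : 0 < r := by positivity
  have hle : ∀ y : ℝ, |y| ≤ |a.im| + |b.im| → |r * y| < Real.pi := by
    intro y hy
    rw [abs_mul, abs_of_pos hr0, hr, one_div, inv_mul_eq_div]
    refine lt_of_lt_of_le ?_ (by linarith [Real.pi_gt_three] : (1 : ℝ) ≤ Real.pi)
    rw [div_lt_one (by positivity)]
    linarith
  have ha := abs_lt.1 (hle a.im (by linarith [abs_nonneg b.im]))
  have hb := abs_lt.1 (hle b.im (by linarith [abs_nonneg a.im]))
  have := Complex.exp_inj_of_neg_pi_lt_of_le_pi (x := (r : ℂ) * a) (y := (r : ℂ) * b)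
    (by simpa using ha.1) (by simpa using ha.2.le) (by simpa using hb.1) (by simpa using hb.2.le)
    (h ⟨r, hr0.le⟩)
  exact mul_left_cancel₀ (by exact_mod_cast hr0.ne') this

/-! ### Uniqueness of drift and Lévy measure for jumps of finite variation -/

theorem integrable_exp_inner_sub_one {m : Measure (E (Fin n))}
    (hm : Integrable (fun x => min 1 ‖x‖) m) (θ : E (Fin n)) :
    Integrable (fun x => Complex.exp (Complex.I * (inner ℝ θ x : ℝ)) - 1) m := by
  refine (hm.const_mul (max 2 ‖θ‖)).mono' (Measurable.aestronglyMeasurable (by fun_prop))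
    (ae_of_all _ fun x => ?_)
  have := norm_one_sub_exp_neg_le_max_mul_min (w := -(Complex.I * (inner ℝ θ x : ℝ)))
    (K := ‖θ‖) (r := ‖x‖) (by simp) (by simpa using norm_inner_le_norm (𝕜 := ℝ) θ x)
    (norm_nonneg x)
  rwa [neg_neg, norm_sub_rev] at this

/-- `θ ↦ ∫ (e^{i⟨θ, x⟩} - 1) m(dx)`, the exponent of a jump part of finite variation. -/
def jumpExponent (m : Measure (E (Fin n))) (θ : E (Fin n)) : ℂ :=
  ∫ x, (Complex.exp (Complex.I * (inner ℝ θ x : ℝ)) - 1) ∂m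

theorem integral_exp_mul_one_sub_cos {m : Measure (E (Fin n))}
    (hm : Integrable (fun x => min 1 ‖x‖) m) (θ h : E (Fin n)) :
    ∫ x, (1 - Real.cos (inner ℝ h x)) • Complex.exp ((inner ℝ x θ : ℝ) * Complex.I) ∂m =
      jumpExponent m θ - (jumpExponent m (θ + h) + jumpExponent m (θ - h)) / 2 := by
  have h0 := integrable_exp_inner_sub_one hm θ
  have h1 := integrable_exp_inner_sub_one hm (θ + h)
  have h2 := integrable_exp_inner_sub_one hm (θ - h)
  have h12 : Integrable (fun x => ((Complex.exp (Complex.I * (inner ℝ (θ + h) x : ℝ)) - 1) +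
      (Complex.exp (Complex.I * (inner ℝ (θ - h) x : ℝ)) - 1)) / 2) m := (h1.add h2).div_const 2
  unfold jumpExponent
  rw [← integral_add h1 h2, ← integral_div, ← integral_sub h0 h12]
  refine integral_congr_ae (ae_of_all _ fun x => ?_)
  simp only [inner_add_left, inner_sub_left, Complex.real_smul, real_inner_comm θ x]
  push_cast
  rw [Complex.cos, mul_add, mul_sub, Complex.exp_add, Complex.exp_sub, neg_mul, Complex.exp_neg]
  have : Complex.exp (inner ℝ h x * Complex.I) ≠ 0 := Complex.exp_ne_zero _
  rw [mul_comm (Complex.I) (inner ℝ h x : ℂ), mul_comm (Complex.I) (inner ℝ θ x : ℂ)]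
  field_simp
  ring

end

section

variable {n : ℕ}

theorem restrict_eq_of_withDensity_eq {α : Type*} [MeasurableSpace α] {μ ν : Measure α}
    {f : α → ℝ≥0∞} (hf : Measurable f) (hf' : ∀ x, f x ≠ ∞)
    (h : μ.withDensity f = ν.withDensity f) :
    μ.restrict {x | f x ≠ 0} = ν.restrict {x | f x ≠ 0} := by
  have hs : MeasurableSet {x | f x ≠ 0} := (hf (measurableSet_singleton 0)).compl
  have key : ∀ m : Measure α, ((m.withDensity f).restrict {x | f x ≠ 0}).withDensity f⁻¹ =
      m.restrict {x | f x ≠ 0} := by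
    intro m
    rw [restrict_withDensity hs]
    exact withDensity_inv_same hf (ae_restrict_of_forall_mem hs fun x hx => hx)
      (ae_of_all _ hf')
  rw [← key μ, ← key ν, h]

theorem one_sub_cos_le_min (y : ℝ) : 1 - Real.cos y ≤ 2 * min 1 |y| := by
  rcases le_total 1 |y| with h | h
  · rw [min_eq_left h]; linarith [Real.neg_one_le_cos y]
  · rw [min_eq_right h]
    have := Real.one_sub_sq_div_two_le_cos (x := y)
    nlinarith [abs_nonneg y, sq_abs y]

/-- A drift and a Lévy measure of finite variation are determined by the exponent. Second
differences of the exponent are Fourier transforms of the finite measures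
`(1 - cos ⟨h, x⟩) m(dx)`. -/
theorem measure_eq_of_jumpExponent_eq {m₁ m₂ : Measure (E (Fin n))}
    (h₁ : Integrable (fun x => min 1 ‖x‖) m₁) (h₂ : Integrable (fun x => min 1 ‖x‖) m₂)
    (hz₁ : m₁ {0} = 0) (hz₂ : m₂ {0} = 0) {a b : E (Fin n)}
    (h : ∀ θ, Complex.I * (inner ℝ a θ : ℝ) + jumpExponent m₁ θ =
      Complex.I * (inner ℝ b θ : ℝ) + jumpExponent m₂ θ) : m₁ = m₂ ∧ a = b := by
  have hdens : ∀ v : E (Fin n),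
      m₁.withDensity (fun x => ENNReal.ofReal (1 - Real.cos (inner ℝ v x))) =
        m₂.withDensity (fun x => ENNReal.ofReal (1 - Real.cos (inner ℝ v x))) := by
    intro v
    have hfin : ∀ m : Measure (E (Fin n)), Integrable (fun x => min 1 ‖x‖) m →
        IsFiniteMeasure (m.withDensity fun x => ENNReal.ofReal (1 - Real.cos (inner ℝ v x))) := by
      intro m hm
      refine isFiniteMeasure_withDensity_ofReal (Integrable.hasFiniteIntegral ?_)
      refine (hm.const_mul (2 * max 1 ‖v‖)).mono' (by fun_prop) (ae_of_all _ fun x => ?_)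
      rw [Real.norm_of_nonneg (by linarith [Real.cos_le_one (inner ℝ v x)])]
      refine (one_sub_cos_le_min _).trans ?_
      rw [mul_assoc]
      gcongr
      have hi := abs_real_inner_le_norm v x
      rcases le_total 1 ‖x‖ with hx | hx
      · rw [min_eq_left hx, mul_one]
        exact (min_le_left _ _).trans (le_max_left _ _)
      · rw [min_eq_right hx]
        refine (min_le_right _ _).trans (hi.trans ?_)
        gcongr
        exact le_max_right _ _
    have := hfin m₁ h₁
    have := hfin m₂ h₂
    refine Measure.ext_of_charFun (funext fun θ => ?_)
    have hchar : ∀ m : Measure (E (Fin n)), Integrable (fun x => min 1 ‖x‖) m →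
        charFun (m.withDensity fun x => ENNReal.ofReal (1 - Real.cos (inner ℝ v x))) θ =
        jumpExponent m θ - (jumpExponent m (θ + v) + jumpExponent m (θ - v)) / 2 := by
      intro m hm
      rw [← integral_exp_mul_one_sub_cos hm, charFun_apply,
        integral_withDensity_eq_integral_toReal_smul (by fun_prop) (ae_of_all _ fun _ => by simp)]
      refine integral_congr_ae (ae_of_all _ fun x => ?_)
      simp only [ENNReal.toReal_ofReal
        (show 0 ≤ 1 - Real.cos (inner ℝ v x) by linarith [Real.cos_le_one (inner ℝ v x)])]
    rw [hchar m₁ h₁, hchar m₂ h₂]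
    have e0 := h θ
    have e1 := h (θ + v)
    have e2 := h (θ - v)
    simp only [inner_add_right, inner_sub_right] at e1 e2
    push_cast at e1 e2
    linear_combination e0 - e1 / 2 - e2 / 2
  have hm : m₁ = m₂ := by
    -- for `v = 2⁻ᵏ eᵢ` the sets `{cos ⟨v, x⟩ ≠ 1}` cover the complement of the origin
    set vec : Fin n × ℕ → E (Fin n) := fun p =>
      (1 / 2 : ℝ) ^ p.2 • EuclideanSpace.single p.1 (1 : ℝ) with hvec
    have hinner : ∀ p x, inner ℝ (vec p) x = (1 / 2 : ℝ) ^ p.2 * x p.1 := by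
      intro p x
      rw [hvec, inner_smul_left, EuclideanSpace.inner_single_left]
      simp
    set S : Fin n × ℕ → Set (E (Fin n)) := fun p =>
      {x | ENNReal.ofReal (1 - Real.cos (inner ℝ (vec p) x)) ≠ 0} with hS
    have hr : ∀ p, m₁.restrict (S p) = m₂.restrict (S p) := fun p =>
      restrict_eq_of_withDensity_eq (by fun_prop) (fun x => by simp) (hdens (vec p))
    have hU : m₁.restrict (⋃ p, S p) = m₂.restrict (⋃ p, S p) :=
      Measure.restrict_iUnion_congr.2 hr
    have hcover : ({0} : Set (E (Fin n)))ᶜ ⊆ ⋃ p, S p := by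
      intro x hx
      obtain ⟨i, hi⟩ : ∃ i, x i ≠ 0 := by
        by_contra! hcon
        exact hx (by ext i; simpa using hcon i)
      obtain ⟨k, hk⟩ := exists_pow_lt_of_lt_one (show 0 < 1 / |x i| by positivity)
        (show (1 / 2 : ℝ) < 1 by norm_num)
      refine mem_iUnion.2 ⟨(i, k), ?_⟩
      simp only [hS, mem_ofPred_eq, ne_eq, ENNReal.ofReal_eq_zero, not_le, hinner]
      have hlt : |(1 / 2 : ℝ) ^ k * x i| < 1 := by
        rw [abs_mul, abs_of_pos (by positivity)]
        rwa [lt_div_iff₀ (by positivity)] at hk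
      have hne : (1 / 2 : ℝ) ^ k * x i ≠ 0 := by positivity
      have hcos : Real.cos ((1 / 2 : ℝ) ^ k * x i) < 1 := by
        rcases lt_or_eq_of_le (Real.cos_le_one ((1 / 2 : ℝ) ^ k * x i)) with h | h
        · exact h
        · exfalso
          have hb := abs_lt.1 hlt
          refine hne ((Real.cos_eq_one_iff_of_lt_of_lt ?_ ?_).1 h) <;>
            linarith [Real.pi_gt_three]
      linarith
    have hfull : ∀ m : Measure (E (Fin n)), m {0} = 0 → m.restrict (⋃ p, S p) = m := by
      intro m hm
      refine Measure.restrict_eq_self_of_ae_mem ?_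
      rw [ae_iff]
      exact measure_mono_null (fun x hx => by
        by_contra hx0
        exact hx (hcover hx0)) hm
    rw [← hfull m₁ hz₁, ← hfull m₂ hz₂, hU]
  refine ⟨hm, ?_⟩
  subst hm
  refine ext_inner_right ℝ fun θ => ?_
  have := add_right_cancel (h θ)
  exact_mod_cast mul_left_cancel₀ Complex.I_ne_zero this

theorem IsSubordinator.ae_nonneg {Ω : Type*} [MeasurableSpace Ω] {P : Measure Ω}
    {T : ℝ≥0 → Ω → E (Fin n)} (hT : IsSubordinator P T) (t : ℝ≥0) :
    ∀ᵐ ω ∂P, ∀ i, 0 ≤ T t ω i := by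
  filter_upwards [hT.mono, hT.isLevyProcess.zero] with ω h1 h2 i
  have := h1 0 t zero_le i
  rw [h2] at this
  simpa using this

theorem IsLevyMeasure.finite_compl_unitBall {m : Measure (E (Fin n))} (hm : IsLevyMeasure m) :
    m (unitBall (Fin n))ᶜ < ∞ := by
  have hs : MeasurableSet (unitBall (Fin n))ᶜ := Metric.isClosed_closedBall.measurableSet.compl
  refine lt_of_le_of_lt ?_ hm.finite
  rw [← lintegral_indicator_one hs]
  refine lintegral_mono fun x => ?_
  by_cases hx : x ∈ (unitBall (Fin n))ᶜ
  · rw [indicator_of_mem hx]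
    have : 1 < ‖x‖ := by simpa [unitBall] using hx
    rw [min_eq_right (one_le_pow₀ this.le)]
    simp
  · rw [indicator_of_notMem hx]; exact zero_le

theorem integrable_min_of_integrableOn {m : Measure (E (Fin n))} (hm : IsLevyMeasure m)
    (hi : IntegrableOn (fun x => x) (unitBall (Fin n)) m) :
    Integrable (fun x => min 1 ‖x‖) m := by
  have hs : MeasurableSet (unitBall (Fin n)) := Metric.isClosed_closedBall.measurableSet
  rw [← integrableOn_univ, ← union_compl_self (unitBall (Fin n))]
  refine IntegrableOn.union ?_ ?_
  · refine hi.norm.mono' (by fun_prop) (ae_of_all _ fun x => ?_)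
    rw [Real.norm_of_nonneg (by positivity)]
    exact min_le_right _ _
  · refine Measure.integrableOn_of_bounded (M := 1) hm.finite_compl_unitBall.ne (by fun_prop)
      (ae_of_all _ fun x => ?_)
    rw [Real.norm_of_nonneg (by positivity)]
    exact min_le_left _ _

theorem levyExponent_of_integrable_min {m : Measure (E (Fin n))}
    (hm : Integrable (fun x => min 1 ‖x‖) m)
    (hi : IntegrableOn (fun x => x) (unitBall (Fin n)) m) (d θ : E (Fin n)) :
    levyExponent (d + ∫ x in unitBall (Fin n), x ∂m) 0 m θ =
      Complex.I * (inner ℝ d θ : ℝ) + jumpExponent m θ := by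
  have hs : MeasurableSet (unitBall (Fin n)) := Metric.isClosed_closedBall.measurableSet
  have h1 := integrable_exp_inner_sub_one hm θ
  have h2 : IntegrableOn (fun x => Complex.I * (inner ℝ θ x : ℝ)) (unitBall (Fin n)) m :=
    (((innerSL ℝ θ).integrable_comp hi).ofReal).const_mul _
  have h3 : ∫ x in unitBall (Fin n), Complex.I * (inner ℝ θ x : ℝ) ∂m =
      Complex.I * (inner ℝ (∫ x in unitBall (Fin n), x ∂m) θ : ℝ) := by
    rw [integral_const_mul, integral_complex_ofReal]
    congr 2
    rw [real_inner_comm]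
    exact (innerSL ℝ θ).integral_comp_comm hi
  unfold levyExponent
  rw [integral_sub h1 ((integrable_indicator_iff hs).2 h2), integral_indicator hs, h3,
    inner_add_left]
  simp [form, jumpExponent]
  ring

/-- The drift and the Lévy measure of a Thorin subordinator are determined by its Laplace
transform. -/
theorem thorin_triplet {Ω : Type*} [MeasurableSpace Ω] {P : Measure Ω}
    [IsProbabilityMeasure P] {T : ℝ≥0 → Ω → E (Fin n)} {d d' : E (Fin n)}
    {U 𝒯 : Measure (E (Fin n))} (hT : IsThorinSubordinator P T d U)
    (hT' : IsSubordinatorWith P T d' 𝒯) : 𝒯 = thorinLevy U ∧ d' = d := by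
  have hm := integrable_min_of_integrableOn hT'.hasTriplet.isLevyMeasure hT'.integrable
  refine measure_eq_of_jumpExponent_eq hm (integrable_min_thorinLevy hT.isThorinMeasure)
    hT'.hasTriplet.isLevyMeasure.zero (isLevyMeasure_thorinLevy hT.isThorinMeasure).zero fun θ => ?_
  refine eq_of_exp_smul_eq fun t => ?_
  rw [← levyExponent_of_integrable_min hm hT'.integrable, ← hT'.hasTriplet.charFun_eq]
  exact charFun_of_thorin_laplace (hT.isSubordinator.isLevyProcess.measurable t)
    (hT.isSubordinator.ae_nonneg t) hT.isThorinMeasure (hT.laplace t) θ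

end

section

variable {n : ℕ}

/-! ### Normal laws at multivariate times -/

/-- `min (u i) (u j)` is the length of `[0, u i] ∩ [0, u j]`. -/
theorem posSemidef_min {ι : Type*} [Finite ι] {u : ι → ℝ} (hu : ∀ i, 0 ≤ u i) :
    (Matrix.of fun i j => min (u i) (u j)).PosSemidef := by
  have : (Matrix.of fun i j => min (u i) (u j)) =
      Matrix.of fun i j => volume.real (Icc 0 (u i) ∩ Icc 0 (u j)) := by
    ext i j
    simp [Icc_inter_Icc, hu i, hu j]
  rw [this]
  exact posSemidef_matrix_measure_inter (fun _ => measurableSet_Icc)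
    (fun _ => isCompact_Icc.measure_ne_top)

theorem posSemidef_outerMat {S : Matrix (Fin n) (Fin n) ℝ} (hS : S.PosSemidef) {t : E (Fin n)}
    (ht : ∀ i, 0 ≤ t i) : (outerMat t S).PosSemidef :=
  hS.hadamard (posSemidef_min (u := t.ofLp) ht)

/-- Subtracting the smallest entry of `u` from the kernel `min` leaves a positive semidefinite
kernel, so that `u ◇ S` dominates a positive multiple of `S` on the coordinates in `J`. -/
theorem posDef_blockJ {S : Matrix (Fin n) (Fin n) ℝ} (hS : S.PosDef) {J : Finset (Fin n)}
    {u : E (Fin n)} (hu : u ∈ coneJ J) : (blockJ J S u).PosDef := by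
  obtain ⟨δ, hδ, hle⟩ : ∃ δ > 0, ∀ j : J, δ ≤ u j := by
    rcases isEmpty_or_nonempty J with h | h
    · exact ⟨1, one_pos, fun j => (h.false j).elim⟩
    · obtain ⟨j, hj⟩ := Finite.exists_min fun j : J => u j
      exact ⟨u j, hu.1 j j.2, hj⟩
  have hSJ : (S.submatrix (Subtype.val : J → Fin n) (Subtype.val : J → Fin n)).PosDef :=
    Matrix.PosDef.submatrix hS Subtype.coe_injective
  have h : blockJ J S u =
      δ • (S.submatrix (Subtype.val : J → Fin n) (Subtype.val : J → Fin n)) +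
      Matrix.hadamard (S.submatrix (Subtype.val : J → Fin n) (Subtype.val : J → Fin n))
        (Matrix.of fun i j : J => min (u i - δ) (u j - δ)) := by
    ext i j
    simp only [blockJ, outerMat, Matrix.submatrix_apply, Matrix.of_apply, Matrix.add_apply,
      Matrix.smul_apply, smul_eq_mul, Matrix.hadamard_apply, min_sub_sub_right]
    ring
  rw [h]
  exact (hSJ.smul hδ).add_posSemidef (hSJ.posSemidef.hadamard
    (posSemidef_min (u := fun i : J => u i - δ) fun i => sub_nonneg.2 (hle i)))

/-- The coordinatewise positive part. -/
def posPart (t : E (Fin n)) : E (Fin n) := WithLp.toLp 2 fun k => max (t k) 0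

theorem posPart_of_nonneg {t : E (Fin n)} (ht : ∀ i, 0 ≤ t i) : posPart t = t := by
  ext i; simp [posPart, ht i]

theorem posPart_nonneg (t : E (Fin n)) (i : Fin n) : 0 ≤ posPart t i := by simp [posPart]

section
open scoped MatrixOrder Matrix.Norms.L2Operator

theorem continuous_sqrt_outerMat {S : Matrix (Fin n) (Fin n) ℝ} (hS : S.PosSemidef) :
    Continuous fun t : E (Fin n) => CFC.sqrt (outerMat (posPart t) S) := by
  refine CFC.continuousOn_sqrt.comp_continuous ?_ fun t =>
    (posSemidef_outerMat hS (posPart_nonneg t)).nonneg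
  unfold outerMat posPart
  fun_prop

/-- `N(m, A)` is the image of the standard normal law under `x ↦ m + A^{1/2} x`, and the square
root depends continuously on `A`. -/
theorem measurable_multivariateGaussian_outer (μ : E (Fin n)) {S : Matrix (Fin n) (Fin n) ℝ}
    (hS : S.PosSemidef) : Measurable fun t : E (Fin n) =>
      multivariateGaussian (outerVec (posPart t) μ) (outerMat (posPart t) S) := by
  have hc : Continuous fun p : E (Fin n) × E (Fin n) => outerVec (posPart p.1) μ +
      Matrix.toEuclideanCLM (𝕜 := ℝ) (CFC.sqrt (outerMat (posPart p.1) S)) p.2 := by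
    have h1 : Continuous fun p : E (Fin n) × E (Fin n) => outerVec (posPart p.1) μ := by
      unfold outerVec posPart; fun_prop
    have h2 : Continuous fun p : E (Fin n) × E (Fin n) =>
        WithLp.toLp 2 ((CFC.sqrt (outerMat (posPart p.1) S)).mulVec p.2.ofLp) := by
      have := (continuous_sqrt_outerMat hS).comp (continuous_fst (X := E (Fin n)) (Y := E (Fin n)))
      refine (PiLp.continuous_toLp 2 _).comp ?_
      exact Continuous.matrix_mulVec this (by fun_prop)
    refine h1.add ?_
    convert h2 using 2 with p
    rfl
  have h3 := (Measure.measurable_map _ hc.measurable).comp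
    (Measurable.map_prodMk_left (ν := stdGaussian (E (Fin n))) (α := E (Fin n)))
  convert h3 using 2 with t
  simp only [Function.comp]
  rw [Measure.map_map hc.measurable (by fun_prop)]
  rfl

end

/-- The Markov kernel `t ↦ N(t ◇ μ, t ◇ S)`; negative coordinates of `t` are replaced by `0`, so
that `t ◇ S` is positive semidefinite for all `t`. -/
def gaussKernel (μ : E (Fin n)) {S : Matrix (Fin n) (Fin n) ℝ} (hS : S.PosSemidef) :
    Kernel (E (Fin n)) (E (Fin n)) :=
  ⟨_, measurable_multivariateGaussian_outer μ hS⟩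

variable {μ : E (Fin n)} {S : Matrix (Fin n) (Fin n) ℝ} {hS : S.PosSemidef}

instance : IsMarkovKernel (gaussKernel μ hS) :=
  ⟨fun t => inferInstanceAs (IsProbabilityMeasure
    (multivariateGaussian (outerVec (posPart t) μ) (outerMat (posPart t) S)))⟩

theorem gaussKernel_apply {t : E (Fin n)} (ht : ∀ i, 0 ≤ t i) :
    gaussKernel μ hS t = multivariateGaussian (outerVec t μ) (outerMat t S) := by
  change multivariateGaussian (outerVec (posPart t) μ) (outerMat (posPart t) S) = _
  rw [posPart_of_nonneg ht]

theorem integral_exp_gaussKernel {t : E (Fin n)} (ht : ∀ i, 0 ≤ t i) (θ : E (Fin n)) :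
    ∫ x, Complex.exp (Complex.I * (inner ℝ θ x : ℝ)) ∂(gaussKernel μ hS t) =
      Complex.exp (Complex.I * (inner ℝ (outerVec t μ) θ : ℝ) -
        (1 / 2) * (form (outerMat t S) θ θ : ℝ)) := by
  have h := charFun_multivariateGaussian (μ := outerVec t μ) (posSemidef_outerMat hS ht) θ
  rw [charFun_apply] at h
  rw [gaussKernel_apply ht, real_inner_comm]
  simp only [mul_comm Complex.I, form]
  simp only [real_inner_comm] at h
  rw [h]
  congr 1
  ring

theorem integral_norm_sq_multivariateGaussian {ι : Type*} [Fintype ι] [DecidableEq ι]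
    {m : EuclideanSpace ℝ ι} {A : Matrix ι ι ℝ} (hA : A.PosSemidef) :
    Integrable (fun x => ‖x‖ ^ 2) (multivariateGaussian m A) ∧
    ∫ x, ‖x‖ ^ 2 ∂(multivariateGaussian m A) = ‖m‖ ^ 2 + A.trace := by
  have hL : MemLp id 2 (multivariateGaussian m A) := IsGaussian.memLp_two_id
  have hi : ∀ i, MemLp (fun x : EuclideanSpace ℝ ι => x i) 2 (multivariateGaussian m A) := by
    intro i
    refine hL.mono (by fun_prop) (ae_of_all _ fun x => ?_)
    exact PiLp.norm_apply_le x i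
  have hmean : ∀ i, ∫ x, x i ∂(multivariateGaussian m A) = m i := by
    intro i
    have := (measurePreserving_eval_multivariateGaussian (μ := m) hA (i := i)).map_eq
    rw [← integral_map (φ := fun x : EuclideanSpace ℝ ι => x i) (f := fun y => y) (by fun_prop)
      (by fun_prop), this]
    simp
  have hsq : ∀ i, ∫ x, (x i) ^ 2 ∂(multivariateGaussian m A) = m i ^ 2 + A i i := by
    intro i
    have h1 := variance_eval_multivariateGaussian (μ := m) hA i
    rw [variance_eq_sub (hi i), hmean] at h1
    simp only [Pi.pow_apply] at h1
    linarith
  constructor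
  · simpa using hL.integrable_norm_pow (by norm_num)
  · simp only [EuclideanSpace.real_norm_sq_eq]
    rw [integral_finsetSum _ fun i _ => (hi i).integrable_sq]
    simp only [hsq, Finset.sum_add_distrib, Matrix.trace, Matrix.diag_apply]

theorem norm_outerVec_le (t μ : E (Fin n)) : ‖outerVec t μ‖ ≤ ‖μ‖ * ‖t‖ := by
  refine le_of_sq_le_sq ?_ (by positivity)
  rw [mul_pow, EuclideanSpace.real_norm_sq_eq, EuclideanSpace.real_norm_sq_eq μ, Finset.sum_mul]
  refine Finset.sum_le_sum fun i _ => ?_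
  simp only [outerVec]
  rw [mul_pow, mul_comm]
  refine mul_le_mul_of_nonneg_left ?_ (sq_nonneg _)
  rw [← sq_abs]
  exact pow_le_pow_left₀ (abs_nonneg _) (abs_coord_le_norm t i) 2

theorem integral_norm_sq_gaussKernel_le {t : E (Fin n)} (ht : ∀ i, 0 ≤ t i) :
    Integrable (fun x => ‖x‖ ^ 2) (gaussKernel μ hS t) ∧
    ∫ x, ‖x‖ ^ 2 ∂(gaussKernel μ hS t) ≤ ‖μ‖ ^ 2 * ‖t‖ ^ 2 + S.trace * ‖t‖ := by
  rw [gaussKernel_apply ht]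
  obtain ⟨h1, h2⟩ := integral_norm_sq_multivariateGaussian (m := outerVec t μ)
    (posSemidef_outerMat hS ht)
  refine ⟨h1, ?_⟩
  rw [h2]
  gcongr
  · rw [← mul_pow]
    gcongr
    exact norm_outerVec_le t μ
  · rw [Matrix.trace, Matrix.trace, Finset.sum_mul]
    refine Finset.sum_le_sum fun i _ => ?_
    simp only [outerMat, Matrix.diag_apply, Matrix.of_apply, min_self]
    gcongr
    · exact hS.diag_nonneg
    · exact (le_abs_self _).trans (abs_coord_le_norm t i)

theorem integrable_id_gaussKernel (t : E (Fin n)) :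
    Integrable (fun x => x) (gaussKernel μ hS t) :=
  (IsGaussian.memLp_two_id (μ := multivariateGaussian (outerVec (posPart t) μ)
    (outerMat (posPart t) S))).integrable (by norm_num)

theorem integral_id_gaussKernel {t : E (Fin n)} (ht : ∀ i, 0 ≤ t i) :
    ∫ x, x ∂(gaussKernel μ hS t) = outerVec t μ := by
  rw [gaussKernel_apply ht, integral_id_multivariateGaussian]

end

section

variable {n : ℕ}

/-! ### Brownian motion at a multivariate time point -/

/-- Extension of the order statistics of `t` to a monotone sequence `0 = τ₀ ≤ τ₁ ≤ …`. -/
def sortedTime (t : E (Fin n)) (j : ℕ) : ℝ≥0 :=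
  (Finset.univ.filter fun i : Fin n => (i : ℕ) < j).sup fun i => (ordered t i).toNNReal

/-- The position of the coordinate `k` in the ordering of the coordinates of `t`. -/
def sortPos (t : E (Fin n)) (k : Fin n) : Fin n := (Tuple.sort t.ofLp).symm k

theorem monotone_sortedTime (t : E (Fin n)) : Monotone (sortedTime t) := fun i j hij =>
  Finset.sup_mono fun k hk => by
    simp only [Finset.mem_filter, Finset.mem_univ, true_and] at hk ⊢
    omega

theorem sortedTime_zero (t : E (Fin n)) : sortedTime t 0 = 0 := by
  simp [sortedTime]

theorem sortedTime_sortPos (t : E (Fin n)) (k : Fin n) :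
    sortedTime t (sortPos t k + 1) = (t k).toNNReal := by
  have hk : ordered t (sortPos t k) = t k := by simp [ordered, sortPos]
  refine le_antisymm (Finset.sup_le fun i hi => ?_) ?_
  · simp only [Finset.mem_filter, Finset.mem_univ, true_and] at hi
    rw [← hk]
    exact Real.toNNReal_le_toNNReal (Tuple.monotone_sort t.ofLp (by
      rw [Fin.le_def]; omega))
  · rw [← hk]
    exact Finset.le_sup (f := fun i => (ordered t i).toNNReal) (by simp)

theorem sum_ite_sub_eq {M : Type*} [AddCommGroup M] (a : ℕ → M) {p : ℕ} (hp : p < n) :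
    ∑ j : Fin n, (if (j : ℕ) ≤ p then a (j + 1) - a j else 0) = a (p + 1) - a 0 := by
  rw [Fin.sum_univ_eq_sum_range (fun j => if j ≤ p then a (j + 1) - a j else 0) n,
    ← Finset.sum_filter, ← Finset.sum_range_sub]
  refine Finset.sum_congr ?_ fun _ _ => rfl
  ext j
  simp only [Finset.mem_filter, Finset.mem_range]
  omega

/-- The vector `θ` restricted to the coordinates whose time exceeds the `j` smallest ones. -/
def tailVec (t θ : E (Fin n)) (j : ℕ) : E (Fin n) :=
  WithLp.toLp 2 fun k => if j ≤ (sortPos t k : ℕ) then θ k else 0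

/-- Summation by parts: `⟨θ, a(t)⟩` in terms of the increments of `a` over the spacings of `t`. -/
theorem sum_inner_tailVec (t θ : E (Fin n)) (a : ℕ → E (Fin n)) :
    ∑ j : Fin n, inner ℝ (tailVec t θ j) (a (j + 1) - a j) =
      ∑ k, θ k * (a (sortPos t k + 1) k - a 0 k) := by
  simp only [PiLp.inner_apply, RCLike.inner_apply, conj_trivial, tailVec]
  rw [Finset.sum_comm]
  refine Finset.sum_congr rfl fun k _ => ?_
  rw [← sum_ite_sub_eq (fun j => a j k) (sortPos t k).isLt, Finset.mul_sum]
  refine Finset.sum_congr rfl fun j _ => ?_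
  split_ifs
  · simp [mul_comm]
  · simp

theorem sum_sortedTime_mul_form (S : Matrix (Fin n) (Fin n) ℝ) {t : E (Fin n)}
    (ht : ∀ i, 0 ≤ t i) (θ : E (Fin n)) :
    ∑ j : Fin n, ((sortedTime t (j + 1) : ℝ) - sortedTime t j) *
      form S (tailVec t θ j) (tailVec t θ j) = form (outerMat t S) θ θ := by
  simp only [form, dotProduct, Matrix.mulVec, Finset.mul_sum]
  rw [Finset.sum_comm]
  refine Finset.sum_congr rfl fun k _ => ?_
  rw [Finset.sum_comm]
  refine Finset.sum_congr rfl fun l _ => ?_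
  have hmin : (sortedTime t (min (sortPos t k : ℕ) (sortPos t l) + 1) : ℝ) = min (t k) (t l) := by
    have h := (monotone_sortedTime t).map_min (a := (sortPos t k : ℕ) + 1) (b := sortPos t l + 1)
    rw [min_add_add_right, sortedTime_sortPos, sortedTime_sortPos] at h
    rw [h]
    simp [ht k, ht l]
  have h := sum_ite_sub_eq (n := n) (fun j => (sortedTime t j : ℝ))
    (p := min (sortPos t k : ℕ) (sortPos t l)) (lt_of_le_of_lt (min_le_left _ _) (sortPos t k).isLt)
  rw [hmin, sortedTime_zero, NNReal.coe_zero, sub_zero] at h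
  simp only [outerMat, Matrix.of_apply]
  rw [← h, Finset.mul_sum, Finset.sum_mul, Finset.mul_sum]
  refine Finset.sum_congr rfl fun j _ => ?_
  simp only [tailVec, le_min_iff]
  by_cases h1 : (j : ℕ) ≤ sortPos t k <;> by_cases h2 : (j : ℕ) ≤ sortPos t l <;> simp [h1, h2]
  ring

theorem sum_sortedTime_mul_inner (μ : E (Fin n)) {t : E (Fin n)} (ht : ∀ i, 0 ≤ t i)
    (θ : E (Fin n)) :
    ∑ j : Fin n, ((sortedTime t (j + 1) : ℝ) - sortedTime t j) * inner ℝ μ (tailVec t θ j) =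
      inner ℝ (outerVec t μ) θ := by
  have h := sum_inner_tailVec t θ fun j => (sortedTime t j : ℝ) • μ
  simp only [← sub_smul, inner_smul_right] at h
  simp only [real_inner_comm (tailVec t θ _) μ, h]
  simp only [PiLp.inner_apply, RCLike.inner_apply, conj_trivial, outerVec]
  refine Finset.sum_congr rfl fun k _ => ?_
  rw [sortedTime_sortPos, sortedTime_zero]
  simp [ht k]

variable {Ω : Type*} [MeasurableSpace Ω] {P : Measure Ω} {B : ℝ≥0 → Ω → E (Fin n)}
  {μ : E (Fin n)} {S : Matrix (Fin n) (Fin n) ℝ}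

theorem measurable_multiTime (hB : ∀ t, Measurable (B t)) (t : E (Fin n)) :
    Measurable (multiTime B t) := by
  unfold multiTime
  refine (PiLp.continuous_toLp 2 _).measurable.comp (measurable_pi_lambda _ fun k => ?_)
  have := hB (t k).toNNReal
  fun_prop

theorem integral_exp_increment (hB : IsBrownianMotion P B μ S) {a b : ℝ≥0} (hab : a ≤ b)
    (θ : E (Fin n)) :
    ∫ ω, Complex.exp ((inner ℝ θ (B b ω - B a ω) : ℝ) * Complex.I) ∂P =
      Complex.exp ((((b : ℝ) - a) * inner ℝ μ θ : ℝ) * Complex.I -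
        (1 / 2) * ((((b : ℝ) - a) * form S θ θ : ℝ) : ℂ)) := by
  have hm := hB.isLevyProcess.measurable
  have h1 := hB.isLevyProcess.stationary a (b - a)
  rw [add_tsub_cancel_of_le hab] at h1
  have h2 := hB.charFun_eq (b - a) θ
  have hsub : Measurable fun ω => B b ω - B a ω := (hm b).sub (hm a)
  rw [← h1, charFun_apply, integral_map hsub.aemeasurable
    (Measurable.aestronglyMeasurable (by fun_prop))] at h2
  simp only [real_inner_comm θ] at h2 ⊢
  rw [h2]
  congr 1
  simp only [levyExponent, integral_zero_measure, NNReal.coe_sub hab, add_zero, real_inner_comm θ]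
  push_cast
  ring

/-- The value of a Brownian motion at a multivariate time point `t` is normal with mean `t ◇ μ` and
covariance matrix `t ◇ S`: write it by means of the independent increments over the spacings of
the ordered coordinates of `t`. -/
theorem map_multiTime [IsProbabilityMeasure P] (hB : IsBrownianMotion P B μ S) {t : E (Fin n)}
    (ht : ∀ i, 0 ≤ t i) :
    P.map (multiTime B t) = gaussKernel μ hB.posSemidef t := by
  have hm := hB.isLevyProcess.measurable
  have hmt := measurable_multiTime hm t
  have : IsProbabilityMeasure (P.map (multiTime B t)) :=
    Measure.isProbabilityMeasure_map hmt.aemeasurable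
  refine Measure.ext_of_charFun (funext fun θ => ?_)
  have hR : charFun (gaussKernel μ hB.posSemidef t) θ =
      Complex.exp (Complex.I * (inner ℝ (outerVec t μ) θ : ℝ) -
        (1 / 2) * (form (outerMat t S) θ θ : ℝ)) := by
    rw [← integral_exp_gaussKernel (hS := hB.posSemidef) ht, charFun_apply]
    simp only [real_inner_comm θ, mul_comm Complex.I]
  have hind : iIndepFun
      (fun (j : Fin n) ω => B (sortedTime t (j + 1)) ω - B (sortedTime t j) ω) P :=
    (hB.isLevyProcess.indep.nat (monotone_sortedTime t)).precomp Fin.val_injective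
  have hsub : ∀ j : Fin n,
      Measurable fun ω => B (sortedTime t (j + 1)) ω - B (sortedTime t j) ω :=
    fun j => (hm _).sub (hm _)
  have hprod := iIndepFun.integral_fun_prod_comp
    (X := fun (j : Fin n) ω => B (sortedTime t (j + 1)) ω - B (sortedTime t j) ω) hind
    (f := fun j x => Complex.exp ((inner ℝ (tailVec t θ j) x : ℝ) * Complex.I))
    (fun j : Fin n => (hsub j).aemeasurable)
    (fun j => Measurable.aestronglyMeasurable (by fun_prop))
  simp only [integral_exp_increment hB (monotone_sortedTime t (Nat.le_succ _)),
    ← Complex.exp_sum, Finset.sum_sub_distrib, ← Finset.sum_mul, ← Finset.mul_sum,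
    ← Complex.ofReal_sum, sum_sortedTime_mul_inner μ ht, sum_sortedTime_mul_form S ht] at hprod
  rw [hR, mul_comm Complex.I, ← hprod, charFun_apply, integral_map hmt.aemeasurable
    (Measurable.aestronglyMeasurable (by fun_prop))]
  refine integral_congr_ae ?_
  filter_upwards [hB.isLevyProcess.zero] with ω h0
  rw [sum_inner_tailVec t θ fun j => B (sortedTime t j) ω]
  congr 3
  simp only [PiLp.inner_apply, RCLike.inner_apply, conj_trivial, multiTime]
  refine Finset.sum_congr rfl fun k _ => ?_
  rw [sortedTime_sortPos, sortedTime_zero, h0]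
  simp

end

section

variable {n : ℕ} {μ : E (Fin n)} {S : Matrix (Fin n) (Fin n) ℝ} {hS : S.PosSemidef}

/-! ### Exponents of mixtures of normal laws -/

theorem integral_min_norm_sq_gaussKernel_le {t : E (Fin n)} (ht : ∀ i, 0 ≤ t i) :
    ∫ x, min 1 (‖x‖ ^ 2) ∂(gaussKernel μ hS t) ≤ (1 + ‖μ‖ ^ 2 + S.trace) * min 1 ‖t‖ := by
  have htr := hS.trace_nonneg
  have hi : Integrable (fun x : E (Fin n) => min 1 (‖x‖ ^ 2)) (gaussKernel μ hS t) := by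
    refine (integrable_const (1 : ℝ)).mono' (by fun_prop) (ae_of_all _ fun x => ?_)
    rw [Real.norm_of_nonneg (by positivity)]
    exact min_le_left _ _
  rcases le_total 1 ‖t‖ with h | h
  · rw [min_eq_left h, mul_one]
    calc _ ≤ ∫ _x, (1 : ℝ) ∂(gaussKernel μ hS t) :=
          integral_mono hi (integrable_const _) fun x => min_le_left _ _
      _ = 1 := by simp
      _ ≤ _ := by nlinarith [sq_nonneg ‖μ‖]
  · rw [min_eq_right h]
    obtain ⟨h1, h2⟩ := integral_norm_sq_gaussKernel_le (μ := μ) (hS := hS) ht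
    calc _ ≤ ∫ x, ‖x‖ ^ 2 ∂(gaussKernel μ hS t) := integral_mono hi h1 fun x => min_le_right _ _
      _ ≤ ‖μ‖ ^ 2 * ‖t‖ ^ 2 + S.trace * ‖t‖ := h2
      _ ≤ ‖μ‖ ^ 2 * ‖t‖ + S.trace * ‖t‖ := by
          gcongr
          nlinarith [norm_nonneg t]
      _ ≤ _ := by nlinarith [norm_nonneg t]

/-- Truncation sets for the pairs of jumps `(t, x)`: they lie in `‖x‖ ≤ 1` and contain
a neighbourhood of the origin. The unit ball of pairs and the set `‖x‖ ≤ 1` are the two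
examples of use; the first one truncates the jumps of `(T, B ⊙ T)`, the second one those of
`B ⊙ T`. -/
structure IsTruncation (D : Set (E (Fin n) × E (Fin n))) : Prop where
  measurableSet : MeasurableSet D
  norm_le : ∀ p ∈ D, ‖p.2‖ ≤ 1
  mem : ∀ p : E (Fin n) × E (Fin n), ‖p.1‖ ≤ 1 / 2 → ‖p.2‖ ≤ 1 / 2 → p ∈ D

/-- The truncated mean `∫_{D_t} x N(t ◇ μ, t ◇ S)(dx)`. -/
def truncMean (μ : E (Fin n)) {S : Matrix (Fin n) (Fin n) ℝ} (hS : S.PosSemidef)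
    (D : Set (E (Fin n) × E (Fin n))) (t : E (Fin n)) : E (Fin n) :=
  ∫ x, D.indicator (fun p => p.2) (t, x) ∂(gaussKernel μ hS t)

variable {D : Set (E (Fin n) × E (Fin n))}

theorem integrable_trunc_gaussKernel (hD : IsTruncation D) (t : E (Fin n)) :
    Integrable (fun x => D.indicator (fun p => p.2) (t, x)) (gaussKernel μ hS t) := by
  refine (integrable_const (1 : ℝ)).mono' ?_ (ae_of_all _ fun x => ?_)
  · exact ((measurable_snd.indicator hD.measurableSet).comp
      measurable_prodMk_left).aestronglyMeasurable
  · by_cases h : (t, x) ∈ D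
    · rw [indicator_of_mem h]; exact hD.norm_le _ h
    · rw [indicator_of_notMem h]; simp

/-- For small `t` the truncated mean differs from the mean `t ◇ μ` by at most
`∫ 2 ‖x‖² N(t ◇ μ, t ◇ S)(dx)`, which is of order `‖t‖`. -/
theorem norm_truncMean_le (hD : IsTruncation D) {t : E (Fin n)} (ht : ∀ i, 0 ≤ t i) :
    ‖truncMean μ hS D t‖ ≤ (2 + ‖μ‖ + 2 * ‖μ‖ ^ 2 + 2 * S.trace) * min 1 ‖t‖ := by
  have htr := hS.trace_nonneg
  have hi := integrable_trunc_gaussKernel (μ := μ) (hS := hS) hD t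
  rcases lt_or_ge (1 / 2) ‖t‖ with h | h
  · have h1 : ‖truncMean μ hS D t‖ ≤ 1 := by
      refine (norm_integral_le_of_norm_le_const (C := 1) (ae_of_all _ fun x => ?_)).trans (by simp)
      by_cases h : (t, x) ∈ D
      · rw [indicator_of_mem h]; exact hD.norm_le _ h
      · rw [indicator_of_notMem h]; simp
    have h2 : 1 / 2 ≤ min 1 ‖t‖ := le_min (by norm_num) h.le
    nlinarith [norm_nonneg μ, sq_nonneg ‖μ‖]
  · rw [min_eq_right (by linarith)]
    obtain ⟨hq1, hq2⟩ := integral_norm_sq_gaussKernel_le (μ := μ) (hS := hS) ht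
    have h1 : truncMean μ hS D t = outerVec t μ -
        ∫ x, (x - D.indicator (fun p => p.2) (t, x)) ∂(gaussKernel μ hS t) := by
      rw [integral_sub (integrable_id_gaussKernel t) hi, integral_id_gaussKernel ht]
      simp [truncMean]
    have h2 : ‖∫ x, (x - D.indicator (fun p => p.2) (t, x)) ∂(gaussKernel μ hS t)‖ ≤
        2 * (‖μ‖ ^ 2 * ‖t‖ ^ 2 + S.trace * ‖t‖) := by
      refine le_trans (norm_integral_le_of_norm_le (hq1.const_mul 2) (ae_of_all _ fun x => ?_)) ?_
      · by_cases hx : (t, x) ∈ D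
        · rw [indicator_of_mem hx]; simp
        · rw [indicator_of_notMem hx, sub_zero]
          have : 1 / 2 < ‖x‖ := by
            by_contra! hc
            exact hx (hD.mem _ h hc)
          nlinarith
      · rw [integral_const_mul]
        gcongr
    rw [h1]
    have h3 := norm_outerVec_le t μ
    have h4 : ‖t‖ ^ 2 ≤ ‖t‖ := by nlinarith [norm_nonneg t]
    calc _ ≤ ‖outerVec t μ‖ + _ := norm_sub_le _ _
      _ ≤ ‖μ‖ * ‖t‖ + 2 * (‖μ‖ ^ 2 * ‖t‖ + S.trace * ‖t‖) := by
          refine add_le_add h3 (h2.trans ?_)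
          gcongr
      _ ≤ _ := by nlinarith [norm_nonneg t]

variable {𝒯 : Measure (E (Fin n))}

theorem stronglyMeasurable_truncMean (hD : IsTruncation D) :
    StronglyMeasurable (truncMean μ hS D) := by
  have : StronglyMeasurable (Function.uncurry fun t x : E (Fin n) =>
      D.indicator (fun p => p.2) (t, x)) :=
    (measurable_snd.indicator hD.measurableSet).stronglyMeasurable
  exact this.integral_kernel_prod_right

theorem integrable_truncMean (hm : Integrable (fun t => min 1 ‖t‖) 𝒯)
    (hpos : ∀ᵐ t ∂𝒯, ∀ i, 0 ≤ t i) (hD : IsTruncation D) :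
    Integrable (truncMean μ hS D) 𝒯 := by
  refine (hm.const_mul (2 + ‖μ‖ + 2 * ‖μ‖ ^ 2 + 2 * S.trace)).mono'
    (stronglyMeasurable_truncMean hD).aestronglyMeasurable ?_
  filter_upwards [hpos] with t ht using norm_truncMean_le hD ht

variable [SFinite 𝒯]

theorem integrable_min_norm_sq_compProd (hm : Integrable (fun t => min 1 ‖t‖) 𝒯)
    (hpos : ∀ᵐ t ∂𝒯, ∀ i, 0 ≤ t i) :
    Integrable (fun p => min 1 (‖p.2‖ ^ 2)) (𝒯 ⊗ₘ gaussKernel μ hS) := by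
  have hmeas : Measurable fun p : E (Fin n) × E (Fin n) => min 1 (‖p.2‖ ^ 2) := by fun_prop
  rw [Measure.integrable_compProd_iff hmeas.aestronglyMeasurable]
  refine ⟨ae_of_all _ fun t => ?_, ?_⟩
  · refine (integrable_const (1 : ℝ)).mono' (by fun_prop) (ae_of_all _ fun x => ?_)
    rw [Real.norm_of_nonneg (by positivity)]
    exact min_le_left _ _
  · refine (hm.const_mul (1 + ‖μ‖ ^ 2 + S.trace)).mono' ?_ ?_
    · have : StronglyMeasurable (Function.uncurry fun t x : E (Fin n) =>
          ‖min 1 (‖x‖ ^ 2)‖) := Measurable.stronglyMeasurable (by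
            unfold Function.uncurry; fun_prop)
      exact (this.integral_kernel_prod_right (κ := gaussKernel μ hS)).aestronglyMeasurable
    · filter_upwards [hpos] with t ht
      rw [Real.norm_of_nonneg (integral_nonneg fun _ => norm_nonneg _)]
      refine le_trans (le_of_eq ?_) (integral_min_norm_sq_gaussKernel_le (μ := μ) (hS := hS) ht)
      refine integral_congr_ae (ae_of_all _ fun x => ?_)
      exact Real.norm_of_nonneg (by positivity)

theorem integrable_min_fst_compProd (hm : Integrable (fun t => min 1 ‖t‖) 𝒯) :
    Integrable (fun p => min 1 ‖p.1‖) (𝒯 ⊗ₘ gaussKernel μ hS) := by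
  have h := hm
  rw [← Measure.fst_compProd 𝒯 (gaussKernel μ hS)] at h
  exact h.comp_measurable measurable_fst

/-- The compensated integrand of the Lévy exponent, with truncation set `D`. -/
def compensated (D : Set (E (Fin n) × E (Fin n))) (θ : E (Fin n))
    (p : E (Fin n) × E (Fin n)) : ℂ :=
  Complex.exp (Complex.I * (inner ℝ θ p.2 : ℝ)) - 1 -
    D.indicator (fun p => Complex.I * (inner ℝ θ p.2 : ℝ)) p

theorem measurable_compensated (hD : IsTruncation D) (θ : E (Fin n)) :
    Measurable (compensated D θ) := by
  unfold compensated
  have : Measurable (D.indicator (fun p => Complex.I * (inner ℝ θ p.2 : ℝ))) :=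
    Measurable.indicator (by fun_prop) hD.measurableSet
  fun_prop

theorem norm_exp_I_sub_one_le_two (y : ℝ) : ‖Complex.exp (Complex.I * y) - 1‖ ≤ 2 := by
  refine (norm_sub_le _ _).trans ?_
  rw [mul_comm, Complex.norm_exp_ofReal_mul_I, norm_one]
  norm_num

theorem norm_exp_I_sub_one_sub_le (y : ℝ) :
    ‖Complex.exp (Complex.I * y) - 1 - Complex.I * y‖ ≤ y ^ 2 := by
  have h : ∀ z : ℝ, HasDerivAt (fun z : ℝ => Complex.exp (Complex.I * z) - 1 - Complex.I * z)
      (Complex.I * (Complex.exp (Complex.I * z) - 1)) z := by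
    intro z
    have h1 : HasDerivAt (fun z : ℝ => Complex.I * (z : ℂ)) (Complex.I * 1) z := by
      simpa using (Complex.ofRealCLM.hasDerivAt (x := z)).const_mul Complex.I
    refine ((h1.cexp.sub_const 1).sub h1).congr_deriv ?_
    ring
  have := Convex.norm_image_sub_le_of_norm_hasDerivWithin_le (C := |y|)
    (s := Metric.closedBall (0 : ℝ) |y|) (x := 0) (y := y) (fun z _ => (h z).hasDerivWithinAt)
    (fun z hz => by
      rw [norm_mul, Complex.norm_I, one_mul]
      refine Real.norm_exp_I_mul_ofReal_sub_one_le.trans ?_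
      simpa using hz) (convex_closedBall _ _) (by simp) (by simp)
  simpa [← sq] using this

theorem norm_compensated_le (hD : IsTruncation D) (θ : E (Fin n)) (p : E (Fin n) × E (Fin n)) :
    ‖compensated D θ p‖ ≤ (‖θ‖ ^ 2 + 8) * (min 1 ‖p.1‖ + min 1 (‖p.2‖ ^ 2)) := by
  have h0 : 0 ≤ min 1 ‖p.1‖ := by positivity
  have h0' : 0 ≤ min 1 (‖p.2‖ ^ 2) := by positivity
  unfold compensated
  by_cases hp : p ∈ D
  · rw [indicator_of_mem hp]
    have h1 := hD.norm_le p hp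
    have h2 : min 1 (‖p.2‖ ^ 2) = ‖p.2‖ ^ 2 := min_eq_right (by nlinarith [norm_nonneg p.2])
    refine (norm_exp_I_sub_one_sub_le _).trans ?_
    have h3 : (inner ℝ θ p.2) ^ 2 ≤ ‖θ‖ ^ 2 * ‖p.2‖ ^ 2 := by
      rw [← mul_pow, ← sq_abs]
      gcongr
      exact abs_real_inner_le_norm θ p.2
    rw [h2]
    nlinarith [sq_nonneg ‖θ‖, sq_nonneg ‖p.2‖]
  · rw [indicator_of_notMem hp, sub_zero]
    refine (norm_exp_I_sub_one_le_two _).trans ?_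
    have : 1 / 4 ≤ min 1 ‖p.1‖ + min 1 (‖p.2‖ ^ 2) := by
      rcases lt_or_ge (1 / 2) ‖p.1‖ with h | h
      · have : 1 / 4 ≤ min 1 ‖p.1‖ := le_min (by norm_num) (by linarith)
        linarith
      · have h2 : 1 / 2 < ‖p.2‖ := by
          by_contra! hc
          exact hp (hD.mem _ h hc)
        have : 1 / 4 ≤ min 1 (‖p.2‖ ^ 2) := le_min (by norm_num) (by nlinarith)
        linarith
    nlinarith [sq_nonneg ‖θ‖]

theorem integrable_compensated (hm : Integrable (fun t => min 1 ‖t‖) 𝒯)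
    (hpos : ∀ᵐ t ∂𝒯, ∀ i, 0 ≤ t i) (hD : IsTruncation D) (θ : E (Fin n)) :
    Integrable (compensated D θ) (𝒯 ⊗ₘ gaussKernel μ hS) :=
  (((integrable_min_fst_compProd hm).add (integrable_min_norm_sq_compProd hm hpos)).const_mul
    (‖θ‖ ^ 2 + 8)).mono' (measurable_compensated hD θ).aestronglyMeasurable
    (ae_of_all _ fun p => norm_compensated_le hD θ p)

/-- The characteristic exponent of a Brownian motion at the multivariate time `t`, with
opposite sign. -/
def gaussExponent (μ : E (Fin n)) (S : Matrix (Fin n) (Fin n) ℝ) (θ t : E (Fin n)) : ℂ :=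
  (1 / 2) * (form (outerMat t S) θ θ : ℝ) - Complex.I * (inner ℝ (outerVec t μ) θ : ℝ)

theorem integral_compensated_gaussKernel (hD : IsTruncation D) {t : E (Fin n)}
    (ht : ∀ i, 0 ≤ t i) (θ : E (Fin n)) :
    ∫ x, compensated D θ (t, x) ∂(gaussKernel μ hS t) =
      Complex.exp (-gaussExponent μ S θ t) - 1 -
        Complex.I * (inner ℝ θ (truncMean μ hS D t) : ℝ) := by
  have h1 : Integrable (fun x => Complex.exp (Complex.I * (inner ℝ θ x : ℝ)))
      (gaussKernel μ hS t) := by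
    refine (integrable_const (1 : ℝ)).mono' (Measurable.aestronglyMeasurable (by fun_prop))
      (ae_of_all _ fun x => ?_)
    rw [mul_comm, Complex.norm_exp_ofReal_mul_I]
  have h2 := integrable_trunc_gaussKernel (μ := μ) (hS := hS) hD t
  have h3 : Integrable (fun x => Complex.I *
      (inner ℝ θ (D.indicator (fun p => p.2) (t, x)) : ℝ)) (gaussKernel μ hS t) :=
    (((innerSL ℝ θ).integrable_comp h2).ofReal).const_mul _
  have h4 : ∀ x, compensated D θ (t, x) = Complex.exp (Complex.I * (inner ℝ θ x : ℝ)) - 1 -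
      Complex.I * (inner ℝ θ (D.indicator (fun p => p.2) (t, x)) : ℝ) := by
    intro x
    unfold compensated
    by_cases hx : (t, x) ∈ D <;> simp [hx]
  have h5 : ∫ x, inner ℝ θ (D.indicator (fun p => p.2) (t, x)) ∂(gaussKernel μ hS t) =
      inner ℝ θ (truncMean μ hS D t) := (innerSL ℝ θ).integral_comp_comm h2
  have h6 : Integrable (fun x => Complex.exp (Complex.I * (inner ℝ θ x : ℝ)) - 1)
      (gaussKernel μ hS t) := h1.sub (integrable_const _)
  simp only [h4]
  rw [integral_sub h6 h3, integral_sub h1 (integrable_const _),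
    integral_exp_gaussKernel ht, integral_const_mul, integral_complex_ofReal, h5]
  simp [gaussExponent]

/-- Mixing normal laws over the jumps of a subordinator: the truncated means are absorbed by the
drift, whatever the truncation set is. -/
theorem integral_compensated_compProd (hm : Integrable (fun t => min 1 ‖t‖) 𝒯)
    (hpos : ∀ᵐ t ∂𝒯, ∀ i, 0 ≤ t i) (hD : IsTruncation D) (θ : E (Fin n)) :
    Complex.I * (inner ℝ (∫ t, truncMean μ hS D t ∂𝒯) θ : ℝ) +
      ∫ p, compensated D θ p ∂(𝒯 ⊗ₘ gaussKernel μ hS) =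
      ∫ t, (Complex.exp (-gaussExponent μ S θ t) - 1) ∂𝒯 := by
  have h1 := integrable_compensated (μ := μ) (hS := hS) hm hpos hD θ
  have h2 := integrable_truncMean (μ := μ) (hS := hS) hm hpos hD
  have h3 : Integrable (fun t => Complex.I * (inner ℝ θ (truncMean μ hS D t) : ℝ)) 𝒯 :=
    (((innerSL ℝ θ).integrable_comp h2).ofReal).const_mul _
  have h4 : ∫ t, Complex.I * (inner ℝ θ (truncMean μ hS D t) : ℝ) ∂𝒯 =
      Complex.I * (inner ℝ (∫ t, truncMean μ hS D t ∂𝒯) θ : ℝ) := by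
    rw [integral_const_mul, integral_complex_ofReal, real_inner_comm]
    congr 2
    exact (innerSL ℝ θ).integral_comp_comm h2
  have h5 : Integrable (fun t => ∫ x, compensated D θ (t, x) ∂(gaussKernel μ hS t)) 𝒯 :=
    h1.integral_compProd
  rw [Measure.integral_compProd h1, ← h4, ← integral_add h3 h5]
  · refine integral_congr_ae ?_
    filter_upwards [hpos] with t ht
    rw [integral_compensated_gaussKernel hD ht]
    ring

end

section

variable {n : ℕ} {μ : E (Fin n)} {S : Matrix (Fin n) (Fin n) ℝ}

/-! ### The Lévy measure as a mixture of normal laws over the jumps of the subordinator -/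

theorem measurable_gaussKernel_smul (hS : S.PosSemidef) {s : Set (E (Fin n))}
    (hs : MeasurableSet s) :
    Measurable fun p : E (Fin n) × ℝ => gaussKernel μ hS (p.2 • p.1) s :=
  (Kernel.measurable_coe (gaussKernel μ hS) hs).comp (by fun_prop)

theorem measurable_gaussKernel_ray (hS : S.PosSemidef) {s : Set (E (Fin n))}
    (hs : MeasurableSet s) (u : E (Fin n)) :
    Measurable fun g : ℝ => gaussKernel μ hS (g • u) s := by
  have h : Measurable fun g : ℝ => g • u := by fun_prop
  exact (Kernel.measurable_coe (gaussKernel μ hS) hs).comp h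

/-- The law `N(g u ◇ μ, g u ◇ S)`, as a kernel in `g`. -/
def rayKernel (μ : E (Fin n)) (hS : S.PosSemidef) (u : E (Fin n)) : Kernel ℝ (E (Fin n)) :=
  (gaussKernel μ hS).comap (fun g : ℝ => g • u) (by fun_prop)

instance (hS : S.PosSemidef) (u : E (Fin n)) : IsMarkovKernel (rayKernel μ hS u) := by
  unfold rayKernel; infer_instance

/-- The Gamma Lévy measure `b e^{-bg} dg/g`, with `b = ‖u‖²`. -/
def gammaLevy (u : E (Fin n)) : Measure ℝ :=
  (volume.restrict (Ioi (0 : ℝ))).withDensity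
    fun g => ENNReal.ofReal (‖u‖ ^ 2 * Real.exp (-‖u‖ ^ 2 * g) / g)

theorem measurable_gammaDensity (u : E (Fin n)) :
    Measurable fun g : ℝ => ‖u‖ ^ 2 * Real.exp (-‖u‖ ^ 2 * g) / g := by
  fun_prop

theorem ae_gammaLevy_pos (u : E (Fin n)) : ∀ᵐ g ∂(gammaLevy u), 0 < g :=
  (withDensity_absolutelyContinuous _ _).ae_le
    (ae_restrict_of_forall_mem measurableSet_Ioi fun _ hg => hg)

theorem outerVec_smul (g : ℝ) (u μ : E (Fin n)) : outerVec (g • u) μ = g • outerVec u μ := by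
  ext i; simp [outerVec, mul_assoc]

theorem outerMat_smul {g : ℝ} (hg : 0 ≤ g) (u : E (Fin n)) (S : Matrix (Fin n) (Fin n) ℝ) :
    outerMat (g • u) S = g • outerMat u S := by
  ext i j
  simp only [outerMat, Matrix.of_apply, Matrix.smul_apply, PiLp.smul_apply, smul_eq_mul,
    ← mul_min_of_nonneg _ _ hg]
  ring

theorem rayKernel_apply {hS : S.PosSemidef} {u : E (Fin n)} (hu : ∀ i, 0 ≤ u i) {g : ℝ}
    (hg : 0 ≤ g) :
    rayKernel μ hS u g = multivariateGaussian (g • outerVec u μ) (g • outerMat u S) := by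
  rw [← outerVec_smul, ← outerMat_smul hg]
  exact gaussKernel_apply (hS := hS) (t := g • u) fun i => mul_nonneg hg (hu i)

theorem vgAt_eq (hS : S.PosSemidef) {u : E (Fin n)} (hu : ∀ i, 0 ≤ u i) :
    vgAt μ S u = (rayKernel μ hS u ∘ₘ gammaLevy u).restrict {0}ᶜ := by
  unfold vgAt vgLevyMeasure
  congr 1
  refine Measure.bind_congr_right ?_
  filter_upwards [ae_gammaLevy_pos u] with g hg
  exact (rayKernel_apply hu hg.le).symm

theorem lintegral_gammaLevy (u : E (Fin n)) {f : ℝ → ℝ≥0∞} (hf : Measurable f) :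
    ∫⁻ g, f g ∂(gammaLevy u) = ∫⁻ g in Ioi (0 : ℝ),
      ENNReal.ofReal (‖u‖ ^ 2 * Real.exp (-‖u‖ ^ 2 * g) / g) * f g := by
  rw [gammaLevy, lintegral_withDensity_eq_lintegral_mul _
    (measurable_gammaDensity u).ennreal_ofReal hf]
  rfl

theorem comp_gammaLevy_apply (hS : S.PosSemidef) (u : E (Fin n)) {s : Set (E (Fin n))}
    (hs : MeasurableSet s) :
    (rayKernel μ hS u ∘ₘ gammaLevy u) s = ∫⁻ g in Ioi (0 : ℝ),
      ENNReal.ofReal (‖u‖ ^ 2 * Real.exp (-‖u‖ ^ 2 * g) / g) * gaussKernel μ hS (g • u) s := by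
  have hm : Measurable fun g : ℝ => gaussKernel μ hS (g • u) s :=
    measurable_gaussKernel_ray hS hs u
  rw [Measure.bind_apply hs (Kernel.aemeasurable _)]
  exact lintegral_gammaLevy u hm

theorem measurable_comp_gammaLevy (hS : S.PosSemidef) :
    Measurable fun u : E (Fin n) => (rayKernel μ hS u ∘ₘ gammaLevy u).restrict {0}ᶜ := by
  refine Measure.measurable_of_measurable_coe _ fun s hs => ?_
  have hs' : MeasurableSet (s ∩ {0}ᶜ) := hs.inter (measurableSet_singleton _).compl
  simp only [Measure.restrict_apply hs, comp_gammaLevy_apply hS _ hs']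
  refine Measurable.lintegral_prod_right' (f := fun p : E (Fin n) × ℝ =>
    ENNReal.ofReal (‖p.1‖ ^ 2 * Real.exp (-‖p.1‖ ^ 2 * p.2) / p.2) *
      gaussKernel μ hS (p.2 • p.1) (s ∩ {0}ᶜ)) ?_
  exact Measurable.mul (by fun_prop) (measurable_gaussKernel_smul hS hs')

variable {U : Measure (E (Fin n))}

/-- The mixture of variance-gamma Lévy measures is the mixture of the normal laws
`N(t ◇ μ, t ◇ S)` over the jumps `t = g u` of the Thorin subordinator. -/
theorem vggLevyMeasure_eq (hS : S.PosSemidef) (hU : IsThorinMeasure U) :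
    vggLevyMeasure μ S U = (gaussKernel μ hS ∘ₘ thorinLevy U).restrict {0}ᶜ := by
  have := hU.sigmaFinite
  have hae : vgAt μ S =ᵐ[U.withDensity fun u => ENNReal.ofReal (1 / ‖u‖ ^ 2)]
      fun u => (rayKernel μ hS u ∘ₘ gammaLevy u).restrict {0}ᶜ := by
    refine (withDensity_absolutelyContinuous _ _).ae_le ?_
    filter_upwards [ae_orthantStar hU] with u hu using vgAt_eq hS hu.1
  unfold vggLevyMeasure
  rw [Measure.bind_congr_right hae]
  ext s hs
  have hs' : MeasurableSet (s ∩ {0}ᶜ) := hs.inter (measurableSet_singleton _).compl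
  have hm := measurable_comp_gammaLevy (μ := μ) hS
  have hm' : Measurable fun u => ((rayKernel μ hS u ∘ₘ gammaLevy u).restrict {0}ᶜ) s :=
    (Measure.measurable_coe hs).comp hm
  have hd : Measurable fun u : E (Fin n) => ENNReal.ofReal (1 / ‖u‖ ^ 2) := by fun_prop
  rw [Measure.bind_apply hs hm.aemeasurable, Measure.restrict_apply hs,
    Measure.bind_apply hs' (Kernel.aemeasurable _),
    lintegral_thorinLevy (Kernel.measurable_coe _ hs'),
    lintegral_withDensity_eq_lintegral_mul _ hd hm']
  refine lintegral_congr_ae ?_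
  filter_upwards [ae_orthantStar hU] with u hu
  have hu' : 0 < ‖u‖ := norm_pos_iff.2 hu.2
  have hmu : Measurable fun g : ℝ => gaussKernel μ hS (g • u) (s ∩ {0}ᶜ) :=
    measurable_gaussKernel_ray hS hs' u
  simp only [Pi.mul_apply, Measure.restrict_apply hs, comp_gammaLevy_apply hS _ hs']
  rw [← lintegral_const_mul _ (by fun_prop)]
  refine setLIntegral_congr_fun measurableSet_Ioi fun g hg => ?_
  rw [← mul_assoc, ← ENNReal.ofReal_mul (by positivity)]
  congr 2
  field_simp

/-! ### Truncated means along rays -/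

/-- Truncation at `‖x‖ ≤ 1`. -/
def sndBall (n : ℕ) : Set (E (Fin n) × E (Fin n)) := {p | p.2 ∈ unitBall (Fin n)}

theorem measurableSet_unitBall {ι : Type} [Fintype ι] : MeasurableSet (unitBall ι) :=
  Metric.isClosed_closedBall.measurableSet

theorem isTruncation_sndBall : IsTruncation (sndBall n) where
  measurableSet := measurable_snd measurableSet_unitBall
  norm_le p hp := by simpa [sndBall, unitBall] using hp
  mem p _ h := by
    simp only [sndBall, unitBall, Metric.mem_closedBall, dist_zero_right, mem_ofPred_eq]
    linarith

/-- By `‖x‖ ≤ √g + ‖x‖² / √g`, the first moment at time `g u` is of order `√g` for small `g`, which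
is integrable with respect to `e^{-bg} dg/g`. -/
theorem integral_norm_gaussKernel_smul_le (hS : S.PosSemidef) {u : E (Fin n)}
    (hu : ∀ i, 0 ≤ u i) {g : ℝ} (hg : 0 < g) :
    ∫ x, ‖(unitBall (Fin n)).indicator (fun x => x) x‖ ∂(gaussKernel μ hS (g • u)) ≤
      (1 + S.trace * ‖u‖) * g ^ (1 / 2 : ℝ) + (‖μ‖ ^ 2 * ‖u‖ ^ 2) * g ^ (3 / 2 : ℝ) := by
  obtain ⟨h1, h2⟩ := integral_norm_sq_gaussKernel_le (μ := μ) (hS := hS) (t := g • u)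
    fun i => mul_nonneg hg.le (hu i)
  have hi := integrable_trunc_gaussKernel (μ := μ) (hS := hS) isTruncation_sndBall (g • u)
  have h3 : (g ^ (1 / 2 : ℝ)) * (g ^ (1 / 2 : ℝ)) = g := by
    rw [← Real.rpow_add hg]; norm_num
  have h4 : g ^ (3 / 2 : ℝ) = g * g ^ (1 / 2 : ℝ) := by
    rw [show (3 / 2 : ℝ) = 1 + 1 / 2 by norm_num, Real.rpow_add hg, Real.rpow_one]
  set r := g ^ (1 / 2 : ℝ) with hr
  have hr0 : 0 < r := Real.rpow_pos_of_pos hg _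
  have hle : ∀ x : E (Fin n), ‖(unitBall (Fin n)).indicator (fun x => x) x‖ ≤
      r + r⁻¹ * ‖x‖ ^ 2 := by
    intro x
    have h5 : ‖(unitBall (Fin n)).indicator (fun x => x) x‖ ≤ ‖x‖ :=
      norm_indicator_le_norm_self _ _
    refine h5.trans ?_
    have h6 : r * (r + r⁻¹ * ‖x‖ ^ 2) = r ^ 2 + ‖x‖ ^ 2 := by field_simp
    have h7 : r * ‖x‖ ≤ r * (r + r⁻¹ * ‖x‖ ^ 2) := by
      rw [h6]; nlinarith [sq_nonneg (r - ‖x‖), norm_nonneg x]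
    exact le_of_mul_le_mul_left h7 hr0
  calc _ ≤ ∫ x, (r + r⁻¹ * ‖x‖ ^ 2) ∂(gaussKernel μ hS (g • u)) :=
        integral_mono hi.norm ((integrable_const _).add (h1.const_mul _)) hle
    _ = r + r⁻¹ * ∫ x, ‖x‖ ^ 2 ∂(gaussKernel μ hS (g • u)) := by
        rw [integral_add (integrable_const _) (h1.const_mul _), integral_const_mul]
        simp
    _ ≤ r + r⁻¹ * (‖μ‖ ^ 2 * ‖g • u‖ ^ 2 + S.trace * ‖g • u‖) := by gcongr
    _ = _ := by
        rw [norm_smul, Real.norm_of_nonneg hg.le, h4, ← h3]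
        field_simp
        ring

theorem integrable_comp_gammaLevy (hS : S.PosSemidef) {u : E (Fin n)}
    (hu : u ∈ orthantStar (Fin n)) :
    Integrable ((unitBall (Fin n)).indicator fun x => x) (rayKernel μ hS u ∘ₘ gammaLevy u) := by
  have hu' : 0 < ‖u‖ := norm_pos_iff.2 hu.2
  have hmeas : Measurable ((unitBall (Fin n)).indicator fun x : E (Fin n) => x) :=
    measurable_id.indicator measurableSet_unitBall
  rw [Measure.integrable_comp_iff hmeas.aestronglyMeasurable]
  refine ⟨ae_of_all _ fun g =>
    integrable_trunc_gaussKernel (μ := μ) (hS := hS) isTruncation_sndBall (g • u), ?_⟩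
  have hI : ∀ a : ℝ, -1 < a → IntegrableOn (fun g : ℝ => g ^ a * Real.exp (-‖u‖ ^ 2 * g))
      (Ioi 0) := by
    intro a ha
    have := integrableOn_rpow_mul_exp_neg_mul_rpow ha one_pos (show 0 < ‖u‖ ^ 2 by positivity)
    simpa using this
  set A := 1 + S.trace * ‖u‖
  set C := ‖μ‖ ^ 2 * ‖u‖ ^ 2
  have hb : IntegrableOn (fun g : ℝ => ‖u‖ ^ 2 * A * (g ^ (-1 / 2 : ℝ) * Real.exp (-‖u‖ ^ 2 * g)) +
      ‖u‖ ^ 2 * C * (g ^ (1 / 2 : ℝ) * Real.exp (-‖u‖ ^ 2 * g))) (Ioi 0) :=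
    ((hI _ (by norm_num)).const_mul _).add ((hI _ (by norm_num)).const_mul _)
  have hm : StronglyMeasurable fun g => ∫ y, ‖(unitBall (Fin n)).indicator (fun x => x) y‖
      ∂(rayKernel μ hS u g) := by
    have : StronglyMeasurable (Function.uncurry fun (_ : ℝ) (y : E (Fin n)) =>
        ‖(unitBall (Fin n)).indicator (fun x => x) y‖) :=
      (hmeas.norm.comp measurable_snd).stronglyMeasurable
    exact this.integral_kernel_prod_right
  rw [gammaLevy, integrable_withDensity_iff_integrable_smul' (by fun_prop)
    (ae_of_all _ fun _ => by simp)]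
  refine Integrable.mono' hb ?_ (ae_restrict_of_forall_mem measurableSet_Ioi fun g hg => ?_)
  · exact (Measurable.smul (measurable_gammaDensity u).ennreal_ofReal.ennreal_toReal
      hm.measurable).aestronglyMeasurable
  · have hg : 0 < g := hg
    rw [ENNReal.toReal_ofReal (by positivity), norm_smul, Real.norm_of_nonneg (by positivity),
      Real.norm_of_nonneg (integral_nonneg fun _ => norm_nonneg _)]
    have h1 := integral_norm_gaussKernel_smul_le (μ := μ) hS hu.1 hg
    have h2 : g ^ (1 / 2 : ℝ) = g * g ^ (-1 / 2 : ℝ) := by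
      nth_rewrite 2 [← Real.rpow_one g]
      rw [← Real.rpow_add hg]; norm_num
    have h3 : g ^ (3 / 2 : ℝ) = g * g ^ (1 / 2 : ℝ) := by
      rw [show (3 / 2 : ℝ) = 1 + 1 / 2 by norm_num, Real.rpow_add hg, Real.rpow_one]
    calc _ ≤ ‖u‖ ^ 2 * Real.exp (-‖u‖ ^ 2 * g) / g *
          (A * g ^ (1 / 2 : ℝ) + C * g ^ (3 / 2 : ℝ)) := by
          refine mul_le_mul_of_nonneg_left h1 (by positivity)
      _ = _ := by
          rw [h3]
          nth_rewrite 1 [h2]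
          field_simp

theorem integral_kernel_comp {α β F : Type*} [MeasurableSpace α] [MeasurableSpace β]
    [NormedAddCommGroup F] [NormedSpace ℝ F] {m : Measure α} {κ : Kernel α β} {f : β → F}
    (hf : Integrable f (κ ∘ₘ m)) : ∫ y, f y ∂(κ ∘ₘ m) = ∫ x, ∫ y, f y ∂(κ x) ∂m := by
  rw [Measure.comp_eq_comp_const_apply] at hf ⊢
  rw [Kernel.integral_comp hf, Kernel.const_apply]

theorem restrict_unitBall_diff (m : Measure (E (Fin n))) :
    (m.restrict {0}ᶜ).restrict (unitBall (Fin n) \ {0}) =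
      m.restrict (unitBall (Fin n) \ {0}) := by
  rw [Measure.restrict_restrict (measurableSet_unitBall.diff (measurableSet_singleton _))]
  congr 1
  ext x
  simp only [mem_inter_iff, Set.mem_sdiff, mem_singleton_iff, mem_compl_iff]
  tauto

theorem indicator_unitBall_diff :
    ((unitBall (Fin n) \ {0}).indicator fun x : E (Fin n) => x) =
      (unitBall (Fin n)).indicator fun x => x := by
  ext1 x
  by_cases h0 : x = 0
  · by_cases h1 : (0 : E (Fin n)) ∈ unitBall (Fin n) <;> simp [h0, h1]
  · by_cases h1 : x ∈ unitBall (Fin n) <;> simp [h0, h1]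

theorem integrableOn_unitBall_diff_iff (m : Measure (E (Fin n))) :
    IntegrableOn (fun y => y) (unitBall (Fin n) \ {0}) (m.restrict {0}ᶜ) ↔
      Integrable ((unitBall (Fin n)).indicator fun x => x) m := by
  rw [← indicator_unitBall_diff, integrable_indicator_iff
    (measurableSet_unitBall.diff (measurableSet_singleton _)), IntegrableOn,
    restrict_unitBall_diff, IntegrableOn]

theorem integral_unitBall_diff (m : Measure (E (Fin n))) :
    ∫ y in unitBall (Fin n) \ {0}, y ∂(m.restrict {0}ᶜ) =
      ∫ y, (unitBall (Fin n)).indicator (fun x => x) y ∂m := by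
  rw [← indicator_unitBall_diff, integral_indicator
    (measurableSet_unitBall.diff (measurableSet_singleton _)), restrict_unitBall_diff]

theorem smul_integral_vgAt (hS : S.PosSemidef) {u : E (Fin n)} (hu : u ∈ orthantStar (Fin n)) :
    (1 / ‖u‖ ^ 2) • ∫ y in unitBall (Fin n) \ {0}, y ∂(vgAt μ S u) =
      ∫ g in Ioi (0 : ℝ), (Real.exp (-‖u‖ ^ 2 * g) / g) •
        truncMean μ hS (sndBall n) (g • u) := by
  have hu' : 0 < ‖u‖ := norm_pos_iff.2 hu.2
  rw [vgAt_eq hS hu.1, integral_unitBall_diff,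
    integral_kernel_comp (integrable_comp_gammaLevy hS hu), gammaLevy,
    integral_withDensity_eq_integral_toReal_smul (by fun_prop) (ae_of_all _ fun _ => by simp),
    ← integral_smul]
  refine setIntegral_congr_fun measurableSet_Ioi fun g hg => ?_
  have hg : 0 < g := hg
  rw [ENNReal.toReal_ofReal (by positivity), smul_smul]
  congr 1
  field_simp

end

section

variable {n : ℕ} {μ : E (Fin n)} {S : Matrix (Fin n) (Fin n) ℝ}

/-! ### The weakly subordinated process -/

theorem norm_pair_sq (x y : E (Fin n)) : ‖pair x y‖ ^ 2 = ‖x‖ ^ 2 + ‖y‖ ^ 2 := by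
  simp [EuclideanSpace.real_norm_sq_eq, pair]

theorem inner_pair (a b x y : E (Fin n)) :
    inner ℝ (pair a b) (pair x y) = inner ℝ a x + inner ℝ b y := by
  simp [PiLp.inner_apply, pair]

theorem inner_pair_zero (θ : E (Fin n)) (z : E (Fin n ⊕ Fin n)) :
    inner ℝ (pair 0 θ) z = inner ℝ θ (second z) := by
  simp [PiLp.inner_apply, pair, second]

theorem form_fromBlocks (A : Matrix (Fin n) (Fin n) ℝ) (θ : E (Fin n)) :
    form (Matrix.fromBlocks 0 0 0 A) (pair 0 θ) (pair 0 θ) = form A θ θ := by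
  simp [form, pair, Matrix.fromBlocks_mulVec, dotProduct, Function.comp_def]

theorem measurable_pair : Measurable fun p : E (Fin n) × E (Fin n) => pair p.1 p.2 := by
  refine (WithLp.measurable_toLp 2 _).comp (measurable_pi_iff.2 ?_)
  rintro (i | i)
  · simp only [Sum.elim_inl]; fun_prop
  · simp only [Sum.elim_inr]; fun_prop

theorem measurable_second : Measurable (second : E (Fin n ⊕ Fin n) → E (Fin n)) := by
  refine (WithLp.measurable_toLp 2 _).comp (measurable_pi_iff.2 fun i => ?_)
  fun_prop

/-- Truncation at `‖(t, x)‖ ≤ 1`. -/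
def pairBall (n : ℕ) : Set (E (Fin n) × E (Fin n)) :=
  {p | pair p.1 p.2 ∈ unitBall (Fin n ⊕ Fin n)}

theorem isTruncation_pairBall : IsTruncation (pairBall n) where
  measurableSet := measurable_pair measurableSet_unitBall
  norm_le p hp := by
    have h : ‖pair p.1 p.2‖ ≤ 1 := by simpa [pairBall, unitBall] using hp
    have h2 := norm_pair_sq p.1 p.2
    nlinarith [norm_nonneg p.2, norm_nonneg (pair p.1 p.2), sq_nonneg ‖p.1‖]
  mem p h1 h2 := by
    simp only [pairBall, unitBall, Metric.mem_closedBall, dist_zero_right, mem_ofPred_eq]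
    have h3 := norm_pair_sq p.1 p.2
    nlinarith [norm_nonneg p.1, norm_nonneg p.2, norm_nonneg (pair p.1 p.2)]

theorem outerMeasure_zero (t : E (Fin n)) : outerMeasure t 0 = 0 := by
  simp [outerMeasure, projMeasure]

theorem compensation_zero (t : E (Fin n)) : compensation t 0 = 0 := by
  simp [compensation]

variable {Ω : Type*} [MeasurableSpace Ω] {P : Measure Ω} [IsProbabilityMeasure P]
  {B : ℝ≥0 → Ω → E (Fin n)} {𝒯 : Measure (E (Fin n))} {d : E (Fin n)}

theorem weakDrift₂_eq (hB : IsBrownianMotion P B μ S) (hpos : ∀ᵐ t ∂𝒯, ∀ i, 0 ≤ t i) :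
    weakDrift₂ P B μ 0 d 𝒯 = outerVec d μ + ∫ t, truncMean μ hB.posSemidef (pairBall n) t ∂𝒯 := by
  rw [weakDrift₂, compensation_zero, zero_add]
  congr 1
  refine integral_congr_ae ?_
  filter_upwards [hpos] with t ht
  have hm := measurable_multiTime hB.isLevyProcess.measurable t
  have hs : MeasurableSet {x : E (Fin n) | (t, x) ∈ pairBall n} :=
    measurable_prodMk_left isTruncation_pairBall.measurableSet
  rw [truncMean, ← map_multiTime hB ht]
  have h : (fun x => (pairBall n).indicator (fun p => p.2) (t, x)) =
      {x : E (Fin n) | (t, x) ∈ pairBall n}.indicator fun x => x := by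
    ext1 x
    simp only [indicator, mem_ofPred_eq]
  rw [h, integral_indicator hs]
  exact (setIntegral_map hs (f := fun x => x) measurable_id.aestronglyMeasurable
    hm.aemeasurable).symm

theorem weakLevyMeasure_eq [SFinite 𝒯] (hB : IsBrownianMotion P B μ S)
    (hpos : ∀ᵐ t ∂𝒯, ∀ i, 0 ≤ t i) :
    weakLevyMeasure P B 0 d 𝒯 =
      (𝒯 ⊗ₘ gaussKernel μ hB.posSemidef).map fun p => pair p.1 p.2 := by
  rw [weakLevyMeasure, outerMeasure_zero, Measure.map_zero, zero_add]
  set κ := (Kernel.id ×ₖ gaussKernel μ hB.posSemidef).map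
    (fun p : E (Fin n) × E (Fin n) => pair p.1 p.2) with hκ
  have h : (fun t => P.map fun ω => pair t (multiTime B t ω)) =ᵐ[𝒯] κ := by
    filter_upwards [hpos] with t ht
    have hm := measurable_multiTime hB.isLevyProcess.measurable t
    rw [hκ, Kernel.map_apply _ measurable_pair, Kernel.prod_apply, Kernel.id_apply,
      Measure.dirac_prod, Measure.map_map measurable_pair measurable_prodMk_left,
      ← map_multiTime hB ht, Measure.map_map (measurable_pair.comp measurable_prodMk_left) hm]
    rfl
  rw [Measure.bind_congr_right h, Measure.compProd_eq_comp_prod,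
    Measure.map_comp _ _ measurable_pair]

/-- The characteristic exponent of `B ⊙ T`, for `T` with drift `d` and Lévy measure `𝒯`. -/
def subordinatedExponent (μ : E (Fin n)) (S : Matrix (Fin n) (Fin n) ℝ) (d : E (Fin n))
    (𝒯 : Measure (E (Fin n))) (θ : E (Fin n)) : ℂ :=
  Complex.I * (inner ℝ (outerVec d μ) θ : ℝ) - (1 / 2) * (form (outerMat d S) θ θ : ℝ) +
    ∫ t, (Complex.exp (-gaussExponent μ S θ t) - 1) ∂𝒯

/-- The exponent of `(T, B ⊙ T)` at `(0, θ)`. -/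
theorem levyExponent_weak [SFinite 𝒯] (hm : Integrable (fun t => min 1 ‖t‖) 𝒯)
    (hpos : ∀ᵐ t ∂𝒯, ∀ i, 0 ≤ t i) (hB : IsBrownianMotion P B μ S) (a θ : E (Fin n)) :
    levyExponent (pair a (weakDrift₂ P B μ 0 d 𝒯)) (Matrix.fromBlocks 0 0 0 (outerMat d S))
      (weakLevyMeasure P B 0 d 𝒯) (pair 0 θ) = subordinatedExponent μ S d 𝒯 θ := by
  rw [levyExponent, weakDrift₂_eq hB hpos, weakLevyMeasure_eq hB hpos, form_fromBlocks,
    inner_pair, inner_zero_right, zero_add, subordinatedExponent,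
    ← integral_compensated_compProd (μ := μ) (hS := hB.posSemidef) hm hpos isTruncation_pairBall θ,
    integral_map measurable_pair.aemeasurable]
  · have h : ∀ p : E (Fin n) × E (Fin n),
        Complex.exp (Complex.I * (inner ℝ (pair 0 θ) (pair p.1 p.2) : ℝ)) - 1 -
          (unitBall (Fin n ⊕ Fin n)).indicator
            (fun x => Complex.I * (inner ℝ (pair 0 θ) x : ℝ)) (pair p.1 p.2) =
        compensated (pairBall n) θ p := by
      intro p
      simp only [compensated, indicator, pairBall, mem_ofPred_eq, inner_pair, inner_zero_left,
        zero_add]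
      congr
    simp only [h, inner_add_left]
    push_cast
    ring
  · have : Measurable ((unitBall (Fin n ⊕ Fin n)).indicator
        (fun x => Complex.I * (inner ℝ (pair 0 θ) x : ℝ))) :=
      Measurable.indicator (by fun_prop) measurableSet_unitBall
    exact Measurable.aestronglyMeasurable (by fun_prop)

theorem levyExponent_mixture [SFinite 𝒯] (hm : Integrable (fun t => min 1 ‖t‖) 𝒯)
    (hpos : ∀ᵐ t ∂𝒯, ∀ i, 0 ≤ t i) (hS : S.PosSemidef) (θ : E (Fin n)) :
    levyExponent (outerVec d μ + ∫ t, truncMean μ hS (sndBall n) t ∂𝒯) (outerMat d S)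
      ((gaussKernel μ hS ∘ₘ 𝒯).restrict {0}ᶜ) θ = subordinatedExponent μ S d 𝒯 θ := by
  have hmeas : Measurable fun x : E (Fin n) => Complex.exp (Complex.I * (inner ℝ θ x : ℝ)) - 1 -
      (unitBall (Fin n)).indicator (fun x => Complex.I * (inner ℝ θ x : ℝ)) x := by
    have : Measurable ((unitBall (Fin n)).indicator
        (fun x => Complex.I * (inner ℝ θ x : ℝ))) :=
      Measurable.indicator (by fun_prop) measurableSet_unitBall
    fun_prop
  rw [levyExponent, subordinatedExponent,
    ← integral_compensated_compProd (μ := μ) (hS := hS) hm hpos isTruncation_sndBall θ,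
    setIntegral_eq_integral_of_forall_compl_eq_zero, ← Measure.snd_compProd, Measure.snd,
    integral_map measurable_snd.aemeasurable hmeas.aestronglyMeasurable]
  · have h : ∀ p : E (Fin n) × E (Fin n),
        Complex.exp (Complex.I * (inner ℝ θ p.2 : ℝ)) - 1 -
          (unitBall (Fin n)).indicator (fun x => Complex.I * (inner ℝ θ x : ℝ)) p.2 =
        compensated (sndBall n) θ p := by
      intro p
      simp only [compensated, indicator, sndBall, mem_ofPred_eq]
      congr
    simp only [h, inner_add_left]
    push_cast
    ring
  · intro x hx
    have : x = 0 := by simpa using hx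
    simp [this, indicator]

theorem isLevyMeasure_mixture [SFinite 𝒯] (hm : Integrable (fun t => min 1 ‖t‖) 𝒯)
    (hpos : ∀ᵐ t ∂𝒯, ∀ i, 0 ≤ t i) (hS : S.PosSemidef) :
    IsLevyMeasure ((gaussKernel μ hS ∘ₘ 𝒯).restrict {0}ᶜ) where
  zero := by
    rw [Measure.restrict_apply (measurableSet_singleton _)]; simp
  finite := by
    have h := (integrable_min_norm_sq_compProd (μ := μ) (hS := hS) hm hpos).lintegral_lt_top
    refine lt_of_le_of_lt (lintegral_mono' Measure.restrict_le_self le_rfl) ?_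
    rw [← Measure.snd_compProd, Measure.snd, lintegral_map (by fun_prop) measurable_snd]
    simpa only [min_comm] using h

/-! ### The characteristic exponent and the drift -/

theorem measurable_form_outerMat (S : Matrix (Fin n) (Fin n) ℝ) (θ : E (Fin n)) :
    Measurable fun t : E (Fin n) => form (outerMat t S) θ θ := by
  simp only [form, dotProduct, Matrix.mulVec, outerMat, Matrix.of_apply]
  fun_prop

theorem measurable_gaussExponent (S : Matrix (Fin n) (Fin n) ℝ) (μ θ : E (Fin n)) :
    Measurable (gaussExponent μ S θ) := by
  have h1 := measurable_form_outerMat S θ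
  have h2 : Measurable fun t : E (Fin n) => inner ℝ (outerVec t μ) θ := by
    simp only [PiLp.inner_apply, outerVec]
    fun_prop
  unfold gaussExponent
  fun_prop

theorem form_nonneg {ι : Type} [Fintype ι] {A : Matrix ι ι ℝ} (hA : A.PosSemidef) (x : E ι) :
    0 ≤ form A x x := by
  simpa [form] using hA.dotProduct_mulVec_nonneg x.ofLp

theorem abs_form_outerMat_le (S : Matrix (Fin n) (Fin n) ℝ) {t : E (Fin n)} (ht : ∀ i, 0 ≤ t i)
    (θ : E (Fin n)) :
    |form (outerMat t S) θ θ| ≤ (∑ i, ∑ j, |θ i| * (|S i j| * |θ j|)) * ‖t‖ := by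
  simp only [form, dotProduct, Matrix.mulVec, outerMat, Matrix.of_apply, Finset.sum_mul,
    Finset.mul_sum]
  refine (Finset.abs_sum_le_sum_abs _ _).trans (Finset.sum_le_sum fun i _ => ?_)
  refine (Finset.abs_sum_le_sum_abs _ _).trans (Finset.sum_le_sum fun j _ => ?_)
  have h : |min (t i) (t j)| ≤ ‖t‖ := by
    rw [abs_of_nonneg (le_min (ht i) (ht j))]
    exact (min_le_left _ _).trans ((le_abs_self _).trans (abs_coord_le_norm t i))
  rw [abs_mul, abs_mul, abs_mul, show |θ i| * (|S i j| * |min (t i) (t j)| * |θ j|) =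
    |θ i| * (|S i j| * |θ j|) * |min (t i) (t j)| by ring]
  gcongr

theorem norm_gaussExponent_le (S : Matrix (Fin n) (Fin n) ℝ) {t : E (Fin n)}
    (ht : ∀ i, 0 ≤ t i) (μ θ : E (Fin n)) :
    ‖gaussExponent μ S θ t‖ ≤
      ((∑ i, ∑ j, |θ i| * (|S i j| * |θ j|)) + ‖μ‖ * ‖θ‖) * ‖t‖ := by
  have h1 := abs_form_outerMat_le S ht θ
  have h2 : |inner ℝ (outerVec t μ) θ| ≤ ‖μ‖ * ‖t‖ * ‖θ‖ :=
    (abs_real_inner_le_norm _ _).trans (by gcongr; exact norm_outerVec_le t μ)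
  unfold gaussExponent
  refine (norm_sub_le _ _).trans ?_
  rw [norm_mul, norm_mul, Complex.norm_I, Complex.norm_real, Complex.norm_real, Real.norm_eq_abs,
    Real.norm_eq_abs]
  norm_num
  nlinarith [abs_nonneg (form (outerMat t S) θ θ)]

theorem gaussExponent_re (S : Matrix (Fin n) (Fin n) ℝ) (μ θ t : E (Fin n)) :
    (gaussExponent μ S θ t).re = 1 / 2 * form (outerMat t S) θ θ := by
  simp [gaussExponent, Complex.mul_re]

theorem gaussExponent_smul (S : Matrix (Fin n) (Fin n) ℝ) (μ θ t : E (Fin n)) {g : ℝ}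
    (hg : 0 < g) : gaussExponent μ S θ (g • t) = gaussExponent μ S θ t * g := by
  have h : form (g • outerMat t S) θ θ = g * form (outerMat t S) θ θ := by
    simp [form, Matrix.smul_mulVec, dotProduct_smul]
  rw [gaussExponent, gaussExponent, outerVec_smul, outerMat_smul hg.le, h, real_inner_smul_left]
  push_cast
  ring

variable {U : Measure (E (Fin n))}

theorem subordinatedExponent_thorinLevy (hS : S.PosSemidef) (hU : IsThorinMeasure U)
    (θ : E (Fin n)) :
    Integrable (fun u => Complex.log (((‖u‖ ^ 2 : ℝ) -
      Complex.I * (inner ℝ (outerVec u μ) θ : ℝ) +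
      (1 / 2) * (form (outerMat u S) θ θ : ℝ)) / (‖u‖ ^ 2 : ℝ))) U ∧
    subordinatedExponent μ S d (thorinLevy U) θ =
      Complex.I * (inner ℝ (outerVec d μ) θ : ℝ) - (1 / 2) * (form (outerMat d S) θ θ : ℝ) -
        ∫ u, Complex.log (((‖u‖ ^ 2 : ℝ) - Complex.I * (inner ℝ (outerVec u μ) θ : ℝ) +
          (1 / 2) * (form (outerMat u S) θ θ : ℝ)) / (‖u‖ ^ 2 : ℝ)) ∂U := by
  obtain ⟨-, h2, h3⟩ := integral_one_sub_exp_neg_thorinLevy hU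
    (measurable_gaussExponent S μ θ)
    (fun u hu => by
      have := form_nonneg (posSemidef_outerMat hS hu.1) θ
      rw [gaussExponent_re]
      positivity)
    (fun u hu => norm_gaussExponent_le S hu.1 μ θ)
    (fun u _ g hg => gaussExponent_smul S μ θ u hg)
  have h : (fun u => Complex.log (((‖u‖ ^ 2 : ℝ) -
      Complex.I * (inner ℝ (outerVec u μ) θ : ℝ) +
      (1 / 2) * (form (outerMat u S) θ θ : ℝ)) / (‖u‖ ^ 2 : ℝ))) =ᵐ[U]
      fun u => Complex.log (1 + gaussExponent μ S θ u / (‖u‖ ^ 2 : ℝ)) := by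
    filter_upwards [ae_orthantStar hU] with u hu
    have hu' : ((‖u‖ ^ 2 : ℝ) : ℂ) ≠ 0 := by
      exact_mod_cast pow_ne_zero 2 (norm_ne_zero_iff.2 hu.2)
    congr 1
    rw [gaussExponent]
    field_simp
    ring
  refine ⟨h2.congr h.symm, ?_⟩
  rw [integral_congr_ae h, ← h3, subordinatedExponent, sub_eq_add_neg _ (∫ x, _ ∂_),
    ← integral_neg]
  simp only [neg_sub]

/-- The drift correction as an integral over the jumps of `T`, and along the mixture. -/
theorem drift_eq (hS : S.PosSemidef) (hU : IsThorinMeasure U) :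
    Integrable (fun u => (1 / ‖u‖ ^ 2) • ∫ y in unitBall (Fin n) \ {0}, y ∂(vgAt μ S u)) U ∧
    ∫ t, truncMean μ hS (sndBall n) t ∂(thorinLevy U) =
      ∫ u, (1 / ‖u‖ ^ 2) • (∫ y in unitBall (Fin n) \ {0}, y ∂(vgAt μ S u)) ∂U := by
  have := hU.sigmaFinite
  have hpos : ∀ᵐ t ∂(thorinLevy U), ∀ i, 0 ≤ t i := by
    filter_upwards [ae_thorinLevy_orthantStar (ae_orthantStar hU)] with t ht using ht.1
  have hi := integrable_truncMean (μ := μ) (hS := hS) (integrable_min_thorinLevy hU) hpos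
    isTruncation_sndBall
  have h : (fun u => (1 / ‖u‖ ^ 2) • ∫ y in unitBall (Fin n) \ {0}, y ∂(vgAt μ S u)) =ᵐ[U]
      fun u => ∫ g in Ioi (0 : ℝ), (Real.exp (-‖u‖ ^ 2 * g) / g) •
        truncMean μ hS (sndBall n) (g • u) := by
    filter_upwards [ae_orthantStar hU] with u hu using smul_integral_vgAt hS hu
  refine ⟨(integrable_polar_of_integrable_thorinLevy hi).integral_prod_left.congr h.symm, ?_⟩
  rw [integral_thorinLevy hi, integral_congr_ae h]

/-- Fubini along the mixture, which requires the integral on the left to exist. -/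
theorem integral_vggLevyMeasure (hS : S.PosSemidef) (hU : IsThorinMeasure U)
    (h : IntegrableOn (fun y => y) (unitBall (Fin n) \ {0}) (vggLevyMeasure μ S U)) :
    ∫ y in unitBall (Fin n) \ {0}, y ∂(vggLevyMeasure μ S U) =
      ∫ t, truncMean μ hS (sndBall n) t ∂(thorinLevy U) := by
  rw [vggLevyMeasure_eq hS hU] at h ⊢
  rw [integrableOn_unitBall_diff_iff] at h
  rw [integral_unitBall_diff, integral_kernel_comp h]
  rfl

variable {ΩB ΩT ΩZ ΩY : Type*} [MeasurableSpace ΩB] [MeasurableSpace ΩT]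
  [MeasurableSpace ΩZ] [MeasurableSpace ΩY] {PB : Measure ΩB} {B : ℝ≥0 → ΩB → E (Fin n)}
  {PT : Measure ΩT} {T : ℝ≥0 → ΩT → E (Fin n)} {PZ : Measure ΩZ}
  {Z : ℝ≥0 → ΩZ → E (Fin n ⊕ Fin n)} {PY : Measure ΩY} {Y : ℝ≥0 → ΩY → E (Fin n)}

theorem charFun_of_isVGG [IsProbabilityMeasure PB] [IsProbabilityMeasure PT]
    (hY : IsVGG PB B PT T PZ Z PY Y d μ S U) (t : ℝ≥0) (θ : E (Fin n)) :
    charFun (PY.map (Y t)) θ =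
      Complex.exp ((t : ℝ) * subordinatedExponent μ S d (thorinLevy U) θ) := by
  obtain ⟨d', 𝒯, hw⟩ := hY.weak
  obtain ⟨rfl, rfl⟩ := thorin_triplet hY.thorin hw.subordinator
  have hU := hY.thorin.isThorinMeasure
  have := hU.sigmaFinite
  have hpos : ∀ᵐ t ∂(thorinLevy U), ∀ i, 0 ≤ t i := by
    filter_upwards [ae_thorinLevy_orthantStar (ae_orthantStar hU)] with t ht using ht.1
  have hlaw : PY.map (Y t) = PZ.map fun ω => second (Z t ω) :=
    (hY.law.comp (measurable_pi_apply t)).map_eq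
  have hZ := hw.hasTriplet.charFun_eq t (pair 0 θ)
  rw [levyExponent_weak (integrable_min_thorinLevy hU) hpos hY.brownian] at hZ
  have hm : AEMeasurable (fun ω => second (Z t ω)) PZ :=
    (measurable_second.comp (hw.hasTriplet.isLevyProcess.measurable t)).aemeasurable
  rw [← hZ, hlaw, charFun_apply, charFun_apply, integral_map hm
      (Measurable.aestronglyMeasurable (by fun_prop)),
    integral_map (hw.hasTriplet.isLevyProcess.measurable t).aemeasurable
      (Measurable.aestronglyMeasurable (by fun_prop))]
  simp only [real_inner_comm (pair 0 θ), inner_pair_zero, real_inner_comm θ]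

theorem hasTriplet_of_isVGG [IsProbabilityMeasure PB] [IsProbabilityMeasure PT]
    (hY : IsVGG PB B PT T PZ Z PY Y d μ S U) :
    HasTriplet PY Y
      (outerVec d μ + ∫ t, truncMean μ hY.brownian.posSemidef (sndBall n) t ∂(thorinLevy U))
      (outerMat d S) (vggLevyMeasure μ S U) := by
  have hS := hY.brownian.posSemidef
  have hU := hY.thorin.isThorinMeasure
  have := hU.sigmaFinite
  have hpos : ∀ᵐ t ∂(thorinLevy U), ∀ i, 0 ≤ t i := by
    filter_upwards [ae_thorinLevy_orthantStar (ae_orthantStar hU)] with t ht using ht.1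
  refine ⟨hY.levy, posSemidef_outerMat hS hY.thorin.drift_nonneg, ?_, fun t θ => ?_⟩
  · rw [vggLevyMeasure_eq hS hU]
    exact isLevyMeasure_mixture (integrable_min_thorinLevy hU) hpos hS
  · rw [vggLevyMeasure_eq hS hU, levyExponent_mixture (integrable_min_thorinLevy hU) hpos hS,
      charFun_of_isVGG hY]

end

section

/-! ### Lebesgue densities of nondegenerate normal laws -/

variable {ι : Type} [Fintype ι]

theorem lintegral_pi_prod (ν : ι → Measure ℝ) [∀ i, SigmaFinite (ν i)] {f : ℝ → ℝ≥0∞}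
    (hf : Measurable f) (hi : ∀ i, ∫⁻ x, f x ∂(ν i) ≠ ∞) (hfin : ∀ x, f x ≠ ∞) :
    ∫⁻ x : ι → ℝ, ∏ i, f (x i) ∂(Measure.pi ν) = ∏ i, ∫⁻ x, f x ∂(ν i) := by
  have h1 : ∀ i, Integrable (fun x => (f x).toReal) (ν i) := fun i =>
    integrable_toReal_of_lintegral_ne_top hf.aemeasurable (hi i)
  have h2 : Integrable (fun x : ι → ℝ => ∏ i, (f (x i)).toReal) (Measure.pi ν) :=
    Integrable.fintype_prod (f := fun _ x => (f x).toReal) h1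
  have h3 := integral_fintype_prod_eq_prod (μ := ν) fun _ x => (f x).toReal
  have h4 : ∀ x, ENNReal.ofReal (f x).toReal = f x := fun x => ENNReal.ofReal_toReal (hfin x)
  have h5 := congrArg ENNReal.ofReal h3
  rw [ofReal_integral_eq_lintegral_ofReal h2 (ae_of_all _ fun _ =>
      Finset.prod_nonneg fun _ _ => ENNReal.toReal_nonneg),
    ENNReal.ofReal_prod_of_nonneg (fun _ _ => integral_nonneg fun _ => ENNReal.toReal_nonneg)] at h5
  simp only [fun i => ofReal_integral_eq_lintegral_ofReal (h1 i)
      (ae_of_all _ fun _ => ENNReal.toReal_nonneg),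
    ENNReal.ofReal_prod_of_nonneg (fun _ _ => ENNReal.toReal_nonneg), h4] at h5
  exact h5

theorem pi_gaussianReal_eq :
    Measure.pi (fun _ : ι => gaussianReal 0 1) =
      (volume : Measure (ι → ℝ)).withDensity fun x => ∏ i, gaussianPDF 0 1 (x i) := by
  refine (Measure.pi_eq fun s hs => ?_)
  have hsm : MeasurableSet (univ.pi s) := MeasurableSet.univ_pi hs
  have h1 : (1 : ℝ≥0) ≠ 0 := one_ne_zero
  rw [withDensity_apply _ hsm, volume_pi, Measure.restrict_pi_pi,
    lintegral_pi_prod _ (measurable_gaussianPDF 0 1) (fun i => ?_) fun x => ENNReal.ofReal_ne_top]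
  · simp only [gaussianReal_apply 0 h1]
  · rw [← gaussianReal_apply 0 h1]
    exact measure_ne_top _ _

/-- The Lebesgue density of `N(m, A)`, for `A` positive definite. -/
def normalDensity [DecidableEq ι] (m : E ι) (A : Matrix ι ι ℝ) (y : E ι) : ℝ :=
  (2 * Real.pi) ^ (-(Fintype.card ι : ℝ) / 2) * (Real.sqrt A.det)⁻¹ *
    Real.exp (-(1 / 2) * form A⁻¹ (y - m) (y - m))

theorem prod_gaussianPDF (x : ι → ℝ) :
    ∏ i, gaussianPDF 0 1 (x i) = ENNReal.ofReal
      ((2 * Real.pi) ^ (-(Fintype.card ι : ℝ) / 2) * Real.exp (-(1 / 2) * (x ⬝ᵥ x))) := by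
  simp only [gaussianPDF]
  rw [← ENNReal.ofReal_prod_of_nonneg fun _ _ => gaussianPDFReal_nonneg _ _ _]
  simp only [gaussianPDFReal, Finset.prod_mul_distrib, ← Real.exp_sum]
  congr 2
  · simp only [NNReal.coe_one, mul_one, Finset.prod_const, Finset.card_univ]
    rw [Real.sqrt_eq_rpow, ← Real.rpow_neg (by positivity), ← Real.rpow_natCast,
      ← Real.rpow_mul (by positivity)]
    congr 1; ring
  · simp [dotProduct, Finset.mul_sum, sq]
    rw [← Finset.sum_neg_distrib]
    exact Finset.sum_congr rfl fun i _ => by ring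

theorem lintegral_stdGaussian {f : E ι → ℝ≥0∞} (hf : Measurable f) :
    ∫⁻ x, f x ∂(stdGaussian (E ι)) = ∫⁻ x : ι → ℝ, ENNReal.ofReal
      ((2 * Real.pi) ^ (-(Fintype.card ι : ℝ) / 2) * Real.exp (-(1 / 2) * (x ⬝ᵥ x))) *
        f (WithLp.toLp 2 x) := by
  have hm := WithLp.measurable_toLp 2 (ι → ℝ)
  have hp := measurable_gaussianPDF 0 1
  have hd : Measurable fun x : ι → ℝ => ∏ i, gaussianPDF 0 1 (x i) := by fun_prop
  rw [← map_pi_eq_stdGaussian, lintegral_map hf hm, pi_gaussianReal_eq,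
    lintegral_withDensity_eq_lintegral_mul _ hd (g := fun x => f (WithLp.toLp 2 x)) (hf.comp hm)]
  simp only [Pi.mul_apply, prod_gaussianPDF]

open scoped MatrixOrder in
/-- Change of variables `y = m + A^{1/2} x` in the standard normal density. -/
theorem lintegral_multivariateGaussian [DecidableEq ι] (m : E ι) {A : Matrix ι ι ℝ}
    (hA : A.PosDef) {f : E ι → ℝ≥0∞} (hf : Measurable f) :
    ∫⁻ x, f x ∂(multivariateGaussian m A) = ∫⁻ y : ι → ℝ,
      ENNReal.ofReal (normalDensity m A (WithLp.toLp 2 y)) * f (WithLp.toLp 2 y) := by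
  set R := CFC.sqrt A with hR
  have hRR : R * R = A := CFC.sqrt_mul_sqrt_self A hA.posSemidef.nonneg
  have hRt : R.transpose = R := by
    have := (CFC.sqrt_nonneg A).isSelfAdjoint
    simpa [IsSelfAdjoint, Matrix.star_eq_conjTranspose] using this
  have hdet : R.det * R.det = A.det := by rw [← Matrix.det_mul, hRR]
  have hdet0 : R.det ≠ 0 := by
    intro h; rw [h, zero_mul] at hdet; exact hA.det_pos.ne hdet
  have habs : |R.det⁻¹| = (Real.sqrt A.det)⁻¹ := by
    rw [abs_inv, ← hdet, Real.sqrt_mul_self_eq_abs]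
  have hm := WithLp.measurable_toLp 2 (ι → ℝ)
  set c := (2 * Real.pi) ^ (-(Fintype.card ι : ℝ) / 2) with hc
  have hc0 : 0 ≤ c := by positivity
  set G : (ι → ℝ) → ℝ≥0∞ := fun y => ENNReal.ofReal (c * Real.exp (-(1 / 2) *
    (y ⬝ᵥ A⁻¹.mulVec y))) * f (m + WithLp.toLp 2 y) with hG
  have hGm : Measurable G := by
    have h1 : Measurable fun y : ι → ℝ => y ⬝ᵥ A⁻¹.mulVec y := by
      simp only [dotProduct, Matrix.mulVec]; fun_prop
    have h2 : Measurable fun y : ι → ℝ => f (m + WithLp.toLp 2 y) :=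
      hf.comp (measurable_const.add hm)
    fun_prop
  have hinv : ∀ x : ι → ℝ, R.mulVec x ⬝ᵥ A⁻¹.mulVec (R.mulVec x) = x ⬝ᵥ x := by
    intro x
    have hu : IsUnit R.det := isUnit_iff_ne_zero.2 hdet0
    rw [← hRR, Matrix.mul_inv_rev, Matrix.mulVec_mulVec, Matrix.mul_assoc,
      Matrix.nonsing_inv_mul _ hu, Matrix.mul_one, ← Matrix.vecMul_transpose R, hRt,
      ← Matrix.dotProduct_mulVec, Matrix.mulVec_mulVec, Matrix.mul_nonsing_inv _ hu,
      Matrix.one_mulVec]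
  have hstep : ∫⁻ x, f x ∂(multivariateGaussian m A) = ∫⁻ x : ι → ℝ, G (Matrix.toLin' R x) := by
    have hmm : Measurable fun x : E ι => m + Matrix.toEuclideanCLM (𝕜 := ℝ) R x := by fun_prop
    rw [multivariateGaussian, lintegral_map hf hmm,
      lintegral_stdGaussian (f := fun x => f (m + Matrix.toEuclideanCLM (𝕜 := ℝ) R x))
        (hf.comp hmm)]
    refine lintegral_congr fun x => ?_
    simp only [hG, Matrix.toLin'_apply, hinv]
    rfl
  have hlin : Measurable (Matrix.toLin' R) := (LinearMap.continuous_on_pi _).measurable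
  rw [hstep, ← lintegral_map hGm hlin, Real.map_matrix_volume_pi_eq_smul_volume_pi hdet0,
    lintegral_smul_measure, habs, ← lintegral_sub_right_eq_self G m.ofLp, smul_eq_mul,
    ← lintegral_const_mul _ (by fun_prop)]
  refine lintegral_congr fun y => ?_
  have e1 : m + WithLp.toLp 2 (y - m.ofLp) = WithLp.toLp 2 y := by ext i; simp
  simp only [hG, e1]
  rw [← mul_assoc, ← ENNReal.ofReal_mul (by positivity)]
  congr 2
  rw [normalDensity, form]
  simp only [WithLp.ofLp_sub]
  ring

end

section

/-! ### The Bessel integral -/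

theorem integrableOn_rpow_mul_exp_neg_div {β γ : ℝ} (hβ : 0 < β) (hγ : 0 < γ) (ρ : ℝ) :
    IntegrableOn (fun g : ℝ => g ^ (-ρ - 1) * Real.exp (-β / g - γ * g)) (Ioi 0) := by
  obtain ⟨k, hk⟩ := exists_nat_gt ρ
  have h1 : IntegrableOn (fun g : ℝ => (k.factorial / β ^ k) *
      (g ^ (-ρ - 1 + k) * Real.exp (-γ * g))) (Ioi 0) := by
    have := integrableOn_rpow_mul_exp_neg_mul_rpow (s := -ρ - 1 + k) (by linarith) one_pos hγ
    simp only [Real.rpow_one] at this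
    exact this.const_mul _
  refine Integrable.mono' h1 (Measurable.aestronglyMeasurable (by fun_prop))
    (ae_restrict_of_forall_mem measurableSet_Ioi fun g hg => ?_)
  have hg : 0 < g := hg
  rw [Real.norm_of_nonneg (by positivity)]
  -- `e^{-β/g} ≤ k! (g/β)^k` makes the integrand integrable near the origin
  have h2 : Real.exp (-β / g) ≤ k.factorial / β ^ k * g ^ k := by
    have h3 := Real.pow_div_factorial_le_exp (x := β / g) (by positivity) k
    rw [neg_div, Real.exp_neg, inv_le_comm₀ (Real.exp_pos _) (by positivity)]
    refine le_trans (le_of_eq ?_) h3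
    rw [div_pow]
    field_simp
  rw [Real.rpow_add hg, Real.rpow_natCast, sub_eq_add_neg (-β / g), Real.exp_add, ← neg_mul]
  calc _ ≤ g ^ (-ρ - 1) * ((k.factorial / β ^ k * g ^ k) * Real.exp (-γ * g)) := by gcongr
    _ = _ := by ring

/-- The substitution `x = γ g` in the integral that defines `K_ρ`. -/
theorem besselKK_eq {q γ ρ : ℝ} (hq : 0 < q) (hγ : 0 < γ) :
    besselKK ρ (q * Real.sqrt (2 * γ)) = 1 / 2 * q ^ (2 * ρ) *
      ∫ g in Ioi (0 : ℝ), g ^ (-ρ - 1) * Real.exp (-(q ^ 2 / 2) / g - γ * g) := by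
  set s := Real.sqrt (2 * γ) with hs
  have hs0 : 0 < s := Real.sqrt_pos.2 (by positivity)
  have hs2 : s ^ 2 = 2 * γ := Real.sq_sqrt (by positivity)
  have h1 := integral_comp_mul_left_Ioi
    (fun x : ℝ => x ^ (-ρ - 1) * Real.exp (-((q * s) ^ 2 / 4) / x - x)) 0 hγ
  rw [mul_zero, smul_eq_mul, eq_inv_mul_iff_mul_eq₀ hγ.ne'] at h1
  have h2 : ∫ x in Ioi (0 : ℝ), (γ * x) ^ (-ρ - 1) *
      Real.exp (-((q * s) ^ 2 / 4) / (γ * x) - γ * x) =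
      γ ^ (-ρ - 1) * ∫ g in Ioi (0 : ℝ), g ^ (-ρ - 1) * Real.exp (-(q ^ 2 / 2) / g - γ * g) := by
    rw [← integral_const_mul]
    refine setIntegral_congr_fun measurableSet_Ioi fun g hg => ?_
    have hg : 0 < g := hg
    have h3 : -((q * s) ^ 2 / 4) / (γ * g) = -(q ^ 2 / 2) / g := by
      rw [mul_pow, hs2]; field_simp; ring
    simp only [h3]
    rw [Real.mul_rpow hγ.le hg.le, mul_assoc]
  rw [h2] at h1
  rw [besselKK, besselK, ← h1]
  have h4 : (q * s) ^ ρ * ((q * s) / 2) ^ ρ = q ^ (2 * ρ) * γ ^ ρ := by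
    rw [← Real.mul_rpow (by positivity) (by positivity), two_mul, Real.rpow_add hq,
      ← Real.mul_rpow hq.le hq.le, ← Real.mul_rpow (by positivity) hγ.le]
    congr 1
    nlinarith
  have h5 : γ ^ ρ * (γ * γ ^ (-ρ - 1)) = 1 := by
    rw [Real.rpow_sub hγ, Real.rpow_neg hγ.le, Real.rpow_one]
    have := (Real.rpow_pos_of_pos hγ ρ).ne'
    field_simp
  set I := ∫ g in Ioi (0 : ℝ), g ^ (-ρ - 1) * Real.exp (-(q ^ 2 / 2) / g - γ * g)
  calc _ = 1 / 2 * ((q * s) ^ ρ * ((q * s) / 2) ^ ρ) * ((γ * γ ^ (-ρ - 1)) * I) := by ring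
    _ = 1 / 2 * q ^ (2 * ρ) * (γ ^ ρ * (γ * γ ^ (-ρ - 1))) * I := by rw [h4]; ring
    _ = _ := by rw [h5, mul_one]

variable {ι : Type} [Fintype ι] {A : Matrix ι ι ℝ}

theorem form_pos (hA : A.PosDef) {y : E ι} (hy : y ≠ 0) : 0 < form A y y := by
  have : y.ofLp ≠ 0 := fun h => hy (by ext i; simp [h])
  simpa [form] using hA.dotProduct_mulVec_pos this

theorem form_comm (hA : A.IsSymm) (x y : E ι) : form A x y = form A y x := by
  rw [form, form, Matrix.dotProduct_mulVec, ← Matrix.mulVec_transpose, hA, dotProduct_comm]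

variable [DecidableEq ι]

theorem normalDensity_smul (hA : A.PosDef) {g : ℝ} (hg : 0 < g) (m y : E ι) :
    normalDensity (g • m) (g • A) y =
      (2 * Real.pi) ^ (-(Fintype.card ι : ℝ) / 2) * (Real.sqrt A.det)⁻¹ *
        Real.exp (form A⁻¹ y m) * (g ^ (-(Fintype.card ι : ℝ) / 2) *
        Real.exp (-(form A⁻¹ y y / 2) / g - form A⁻¹ m m / 2 * g)) := by
  have hsymm : A⁻¹.IsSymm := by
    have := hA.inv.isHermitian
    simpa [Matrix.IsHermitian, Matrix.IsSymm] using this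
  have h1 : (g • A)⁻¹ = g⁻¹ • A⁻¹ := by
    have := Matrix.inv_smul' A (Units.mk0 g hg.ne') (isUnit_iff_ne_zero.2 hA.det_pos.ne')
    simpa [Units.smul_def] using this
  have h2 : form (g⁻¹ • A⁻¹) (y - g • m) (y - g • m) =
      form A⁻¹ y y / g - 2 * form A⁻¹ y m + g * form A⁻¹ m m := by
    have h3 : form (g⁻¹ • A⁻¹) (y - g • m) (y - g • m) = g⁻¹ * (form A⁻¹ y y -
        g * form A⁻¹ y m - g * form A⁻¹ m y + g ^ 2 * form A⁻¹ m m) := by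
      simp only [form, WithLp.ofLp_sub, WithLp.ofLp_smul, Matrix.smul_mulVec, Matrix.mulVec_sub,
        Matrix.mulVec_smul, dotProduct_smul, dotProduct_sub, sub_dotProduct, smul_dotProduct,
        smul_eq_mul]
      ring
    rw [h3, form_comm hsymm m y]
    field_simp
    ring
  have h4 : (Real.sqrt (g • A).det)⁻¹ =
      (Real.sqrt A.det)⁻¹ * g ^ (-(Fintype.card ι : ℝ) / 2) := by
    rw [Matrix.det_smul, Real.sqrt_mul (by positivity), mul_inv, mul_comm, Real.sqrt_eq_rpow
      (g ^ _), ← Real.rpow_natCast, ← Real.rpow_mul hg.le, ← Real.rpow_neg hg.le]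
    congr 2; ring
  rw [normalDensity, h1, h2, h4]
  have h5 : Real.exp (-(1 / 2) * (form A⁻¹ y y / g - 2 * form A⁻¹ y m + g * form A⁻¹ m m)) =
      Real.exp (form A⁻¹ y m) * Real.exp (-(form A⁻¹ y y / 2) / g - form A⁻¹ m m / 2 * g) := by
    rw [← Real.exp_add]; congr 1; ring
  rw [h5]; ring

/-- The Lévy density of a variance-gamma process with nondegenerate covariance matrix: after
completion of the square, the integral over the Gamma time is a Bessel integral. -/
theorem lintegral_normalDensity (hA : A.PosDef) {y : E ι} (hy : y ≠ 0) (m : E ι) {b : ℝ}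
    (hb : 0 < b) :
    ∫⁻ g in Ioi (0 : ℝ), ENNReal.ofReal (Real.exp (-b * g) / g) *
      ENNReal.ofReal (normalDensity (g • m) (g • A) y) =
    ENNReal.ofReal (2 / (2 * Real.pi) ^ ((Fintype.card ι : ℝ) / 2) *
      besselKK ((Fintype.card ι : ℝ) / 2)
        (formNorm A⁻¹ y * Real.sqrt (2 * b + formNorm A⁻¹ m ^ 2)) *
      Real.exp (form A⁻¹ y m) / (Real.sqrt A.det * formNorm A⁻¹ y ^ Fintype.card ι)) := by
  set ρ := (Fintype.card ι : ℝ) / 2 with hρ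
  have hy0 : 0 < form A⁻¹ y y := form_pos hA.inv hy
  have hm0 : 0 ≤ form A⁻¹ m m := form_nonneg hA.inv.posSemidef m
  set γ := b + form A⁻¹ m m / 2 with hγ
  have hγ0 : 0 < γ := by positivity
  have hq : formNorm A⁻¹ y ^ 2 = form A⁻¹ y y := Real.sq_sqrt hy0.le
  have hq0 : 0 < formNorm A⁻¹ y := Real.sqrt_pos.2 hy0
  have hqm : 2 * b + formNorm A⁻¹ m ^ 2 = 2 * γ := by
    rw [formNorm, Real.sq_sqrt hm0, hγ]; ring
  set c := (2 * Real.pi) ^ (-ρ) * (Real.sqrt A.det)⁻¹ * Real.exp (form A⁻¹ y m) with hc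
  have hint := integrableOn_rpow_mul_exp_neg_div (β := form A⁻¹ y y / 2) (by positivity) hγ0 ρ
  have h1 : ∫⁻ g in Ioi (0 : ℝ), ENNReal.ofReal (Real.exp (-b * g) / g) *
      ENNReal.ofReal (normalDensity (g • m) (g • A) y) =
      ∫⁻ g in Ioi (0 : ℝ), ENNReal.ofReal (c * (g ^ (-ρ - 1) *
        Real.exp (-(form A⁻¹ y y / 2) / g - γ * g))) := by
    refine setLIntegral_congr_fun measurableSet_Ioi fun g hg => ?_
    have hg : 0 < g := hg
    rw [← ENNReal.ofReal_mul (by positivity), normalDensity_smul hA hg, Real.rpow_sub hg,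
      Real.rpow_one, neg_div, ← hρ]
    congr 1
    have h2 : Real.exp (-(form A⁻¹ y y / 2) / g - γ * g) = Real.exp (-b * g) *
        Real.exp (-(form A⁻¹ y y / 2) / g - form A⁻¹ m m / 2 * g) := by
      rw [← Real.exp_add]; congr 1; rw [hγ]; ring
    rw [h2, hc]
    field_simp
  rw [h1, ← ofReal_integral_eq_lintegral_ofReal (hint.const_mul c)
    (ae_restrict_of_forall_mem measurableSet_Ioi fun g hg => by
      have hg : 0 < g := hg
      simp only [Pi.zero_apply]; positivity), integral_const_mul, hqm, besselKK_eq hq0 hγ0, hq]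
  congr 1
  have h3 : formNorm A⁻¹ y ^ (2 * ρ) = formNorm A⁻¹ y ^ Fintype.card ι := by
    rw [← Real.rpow_natCast]; congr 1; rw [hρ]; ring
  have h4 : (2 * Real.pi) ^ (-ρ) = ((2 * Real.pi) ^ ρ)⁻¹ := Real.rpow_neg (by positivity) _
  rw [h3, hc, h4]
  generalize (∫ g in Ioi (0 : ℝ), g ^ (-ρ - 1) *
    Real.exp (-(form A⁻¹ y y / 2) / g - γ * g)) = I
  field_simp

end

section

variable {n : ℕ} {J : Finset (Fin n)} {μ u : E (Fin n)} {S : Matrix (Fin n) (Fin n) ℝ}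

/-! ### Normal laws on coordinate subspaces -/

/-- The embedding of `ℝ^J` into `ℝⁿ` as the coordinate subspace of `J`. -/
def embedJ (J : Finset (Fin n)) (x : J → ℝ) : E (Fin n) :=
  WithLp.toLp 2 fun k : Fin n => if h : k ∈ J then x ⟨k, h⟩ else 0

theorem measurable_embedJ : Measurable (embedJ J) := by
  refine (WithLp.measurable_toLp 2 _).comp (measurable_pi_iff.2 fun k => ?_)
  by_cases h : k ∈ J
  · simp only [h, dite_true]; fun_prop
  · simp only [h, dite_false]; fun_prop

theorem lebesgueJ_eq (J : Finset (Fin n)) :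
    lebesgueJ J = (volume : Measure (J → ℝ)).map (embedJ J) := rfl

theorem restrictJ_embedJ (x : J → ℝ) : restrictJ J (embedJ J x) = WithLp.toLp 2 x := by
  ext k; simp [restrictJ, embedJ]

theorem sum_dite_mem (f : Fin n → ℝ) (hf : ∀ k ∉ J, f k = 0) : ∑ k, f k = ∑ k : J, f k := by
  rw [Finset.sum_coe_sort J f]
  exact (Finset.sum_subset (Finset.subset_univ J) fun k _ hk => hf k hk).symm

theorem inner_embedJ (x : J → ℝ) (θ : E (Fin n)) :
    inner ℝ (embedJ J x) θ = inner ℝ (WithLp.toLp 2 x) (restrictJ J θ) := by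
  simp only [PiLp.inner_apply]
  rw [sum_dite_mem (J := J) (fun k => inner ℝ ((embedJ J x) k) (θ k))
    fun k hk => by simp [embedJ, hk]]
  simp [embedJ, restrictJ]

theorem inner_restrictJ {x : E (Fin n)} (hx : ∀ k ∉ J, x k = 0) (θ : E (Fin n)) :
    inner ℝ (restrictJ J θ) (restrictJ J x) = inner ℝ θ x := by
  simp only [PiLp.inner_apply]
  rw [sum_dite_mem (J := J) (fun k => inner ℝ (θ k) (x k)) fun k hk => by simp [hx k hk]]
  simp [restrictJ]

theorem coneJ_nonneg (hu : u ∈ coneJ J) (i : Fin n) : 0 ≤ u i := by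
  by_cases hi : i ∈ J
  · exact (hu.1 i hi).le
  · exact (hu.2 i hi).ge

theorem outerMat_eq_zero (hu : u ∈ coneJ J) {k l : Fin n} (h : k ∉ J ∨ l ∉ J) :
    outerMat u S k l = 0 := by
  have : min (u k) (u l) = 0 := by
    rcases h with h | h
    · rw [hu.2 k h]; exact min_eq_left (coneJ_nonneg hu l)
    · rw [hu.2 l h]; exact min_eq_right (coneJ_nonneg hu k)
  simp [outerMat, this]

theorem form_blockJ (hu : u ∈ coneJ J) (θ : E (Fin n)) :
    form (blockJ J S u) (restrictJ J θ) (restrictJ J θ) = form (outerMat u S) θ θ := by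
  simp only [form, dotProduct, Matrix.mulVec]
  rw [sum_dite_mem (J := J) (fun k => θ k * ∑ l, outerMat u S k l * θ l) fun k hk => by
    simp [outerMat_eq_zero hu (Or.inl hk)]]
  refine Finset.sum_congr rfl fun k _ => ?_
  rw [sum_dite_mem (J := J) (fun l => outerMat u S k l * θ l) fun l hl => by
    simp [outerMat_eq_zero hu (Or.inr hl)]]
  rfl

/-- For `u ∈ C_J` the law `N(g u ◇ μ, g u ◇ S)` lives on the coordinate subspace of `J`. -/
theorem multivariateGaussian_coneJ (hS : S.PosDef) (hu : u ∈ coneJ J) {g : ℝ} (hg : 0 < g) :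
    multivariateGaussian (g • outerVec u μ) (g • outerMat u S) =
      (multivariateGaussian (g • restrictJ J (outerVec u μ)) (g • blockJ J S u)).map
        fun x => embedJ J x.ofLp := by
  have hm : Measurable fun x : E J => embedJ J x.ofLp :=
    measurable_embedJ.comp (WithLp.measurable_ofLp 2 _)
  have := Measure.isProbabilityMeasure_map hm.aemeasurable
    (μ := multivariateGaussian (g • restrictJ J (outerVec u μ)) (g • blockJ J S u))
  refine Measure.ext_of_charFun ?_
  ext θ
  have h1 : (g • outerMat u S).PosSemidef :=
    (posSemidef_outerMat hS.posSemidef (coneJ_nonneg hu)).smul hg.le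
  have h2 : (g • blockJ J S u).PosSemidef := (posDef_blockJ hS hu).posSemidef.smul hg.le
  have h3 : charFun ((multivariateGaussian (g • restrictJ J (outerVec u μ))
      (g • blockJ J S u)).map fun x => embedJ J x.ofLp) θ =
      charFun (multivariateGaussian (g • restrictJ J (outerVec u μ)) (g • blockJ J S u))
        (restrictJ J θ) := by
    rw [charFun_apply, charFun_apply, integral_map hm.aemeasurable
      (Measurable.aestronglyMeasurable (by fun_prop))]
    simp only [inner_embedJ]
  rw [h3, charFun_multivariateGaussian h1, charFun_multivariateGaussian h2, real_inner_smul_right,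
    real_inner_smul_right, inner_restrictJ fun k hk => by simp [outerVec, hu.2 k hk]]
  have h4 := form_blockJ (S := S) hu θ
  simp only [form] at h4
  simp only [Matrix.smul_mulVec, dotProduct_smul, h4]

theorem gaussKernel_smul_coneJ (hS : S.PosDef) (hu : u ∈ coneJ J) {g : ℝ} (hg : 0 < g)
    {s : Set (E (Fin n))} (hs : MeasurableSet s) :
    gaussKernel μ hS.posSemidef (g • u) s = ∫⁻ y : J → ℝ, ENNReal.ofReal
      (normalDensity (g • restrictJ J (outerVec u μ)) (g • blockJ J S u) (WithLp.toLp 2 y)) *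
        s.indicator 1 (embedJ J y) := by
  have hm : Measurable fun x : E J => embedJ J x.ofLp :=
    measurable_embedJ.comp (WithLp.measurable_ofLp 2 _)
  have h1 : Measurable (s.indicator (1 : E (Fin n) → ℝ≥0∞)) := measurable_one.indicator hs
  rw [gaussKernel_apply fun i => mul_nonneg hg.le (coneJ_nonneg hu i), outerVec_smul,
    outerMat_smul hg.le, multivariateGaussian_coneJ hS hu hg, ← lintegral_indicator_one hs,
    lintegral_map h1 hm, lintegral_multivariateGaussian _ ((posDef_blockJ hS hu).smul hg)
      (f := fun x => s.indicator 1 (embedJ J x.ofLp)) (h1.comp hm)]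

/-! ### Measurability of the kernels `ν_J` -/

section Measurability

variable {α ι : Type} [MeasurableSpace α] [Fintype ι] {A : α → Matrix ι ι ℝ}

theorem measurable_form (hA : ∀ k l, Measurable fun a => A a k l) {x y : α → E ι}
    (hx : ∀ k, Measurable fun a => x a k) (hy : ∀ k, Measurable fun a => y a k) :
    Measurable fun a => form (A a) (x a) (y a) :=
  Finset.measurable_sum _ fun i _ => (hx i).mul
    (Finset.measurable_sum _ fun j _ => (hA i j).mul (hy j))

variable [DecidableEq ι]

theorem measurable_matrix_det (hA : ∀ k l, Measurable fun a => A a k l) :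
    Measurable fun a => (A a).det := by
  have hm : Measurable fun a => (fun i j => A a i j : ι → ι → ℝ) :=
    measurable_pi_iff.2 fun i => measurable_pi_iff.2 fun j => hA i j
  have hc : Continuous fun M : ι → ι → ℝ => (Matrix.of M).det :=
    Continuous.matrix_det (A := fun M : ι → ι → ℝ => Matrix.of M) continuous_id
  exact hc.measurable.comp hm

theorem measurable_matrix_inv (hA : ∀ k l, Measurable fun a => A a k l) (k l : ι) :
    Measurable fun a => (A a)⁻¹ k l := by
  have hm : Measurable fun a => (fun i j => A a i j : ι → ι → ℝ) :=
    measurable_pi_iff.2 fun i => measurable_pi_iff.2 fun j => hA i j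
  have hc : Continuous fun M : ι → ι → ℝ => (Matrix.of M).adjugate k l :=
    (Continuous.matrix_adjugate (A := fun M : ι → ι → ℝ => Matrix.of M)
      continuous_id).matrix_elem k l
  simp only [Matrix.inv_def, Ring.inverse_eq_inv', Matrix.smul_apply, smul_eq_mul]
  exact (measurable_matrix_det hA).inv.mul (hc.measurable.comp hm)

theorem measurable_normalDensity {m y : α → E ι} (hA : ∀ k l, Measurable fun a => A a k l)
    (hm : ∀ k, Measurable fun a => m a k) (hy : ∀ k, Measurable fun a => y a k) :
    Measurable fun a => normalDensity (m a) (A a) (y a) := by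
  have hd : ∀ k, Measurable fun a => (y a - m a) k := fun k => (hy k).sub (hm k)
  have h1 := measurable_form (measurable_matrix_inv hA) hd hd
  have h2 := measurable_matrix_det hA
  unfold normalDensity
  fun_prop

theorem measurable_normalDensity_smul (m : E ι) (M : Matrix ι ι ℝ) :
    Measurable fun p : ℝ × (ι → ℝ) => ENNReal.ofReal
      (normalDensity (p.1 • m) (p.1 • M) (WithLp.toLp 2 p.2)) := by
  refine (measurable_normalDensity (A := fun p : ℝ × (ι → ℝ) => p.1 • M)
    (m := fun p => p.1 • m) (y := fun p => WithLp.toLp 2 p.2)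
    (fun k l => ?_) (fun k => ?_) fun k => ?_).ennreal_ofReal
  · exact measurable_fst.mul_const _
  · exact measurable_fst.mul_const _
  · exact (measurable_pi_apply k).comp measurable_snd

end Measurability

theorem measurable_blockJ (k l : J) :
    Measurable fun u : E (Fin n) => blockJ J S u k l := by
  simp only [blockJ, Matrix.submatrix_apply, outerMat, Matrix.of_apply]
  fun_prop

theorem measurable_besselKK (ρ : ℝ) : Measurable (besselKK ρ) := by
  have h : Measurable fun r : ℝ => ∫ x in Ioi (0 : ℝ),
      x ^ (-ρ - 1) * Real.exp (-(r ^ 2 / 4) / x - x) := by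
    have : StronglyMeasurable (Function.uncurry fun (r x : ℝ) =>
        x ^ (-ρ - 1) * Real.exp (-(r ^ 2 / 4) / x - x)) := by
      refine Measurable.stronglyMeasurable ?_
      unfold Function.uncurry
      fun_prop
    exact this.integral_prod_right.measurable
  unfold besselKK besselK
  fun_prop

theorem measurable_nuJ : Measurable fun p : E (Fin n) × E (Fin n) => nuJ μ S J p.1 p.2 := by
  have hA : ∀ k l : J, Measurable fun p : E (Fin n) × E (Fin n) => blockJ J S p.1 k l :=
    fun k l => (measurable_blockJ k l).comp measurable_fst
  have hm : ∀ k : J, Measurable fun p : E (Fin n) × E (Fin n) =>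
      restrictJ J (outerVec p.1 μ) k := fun k => by
    simp only [restrictJ, outerVec]; fun_prop
  have hz : ∀ k : J, Measurable fun p : E (Fin n) × E (Fin n) => restrictJ J p.2 k := fun k => by
    simp only [restrictJ]; fun_prop
  have hi := measurable_matrix_inv hA
  have h1 := measurable_form hi hz hz
  have h2 := measurable_form hi hm hm
  have h3 := measurable_form hi hz hm
  have h4 := measurable_matrix_det hA
  have h5 := measurable_besselKK ((J.card : ℝ) / 2)
  simp only [nuJ, formNorm]
  fun_prop

/-! ### The decomposition of the Lévy measure -/

theorem ae_embedJ_mem_spaceJ : ∀ᵐ y : J → ℝ, embedJ J y ∈ spaceJ J := by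
  have h : ∀ k : J, ∀ᵐ y : J → ℝ, y k ≠ 0 := fun k => by
    have : ∀ᵐ x : ℝ, x ≠ 0 := by simp [ae_iff]
    exact (Measure.quasiMeasurePreserving_eval (fun _ : J => (volume : Measure ℝ)) k).ae this
  filter_upwards [ae_all_iff.2 h] with y hy
  refine ⟨fun j hj => ?_, fun j hj => ?_⟩
  · simpa [embedJ, hj] using hy ⟨j, hj⟩
  · simp [embedJ, hj]

theorem measurableSet_spaceJ : MeasurableSet (spaceJ J) := by
  unfold spaceJ
  exact measurableSet_setOfPred.2 (by fun_prop)

theorem measurableSet_coneJ : MeasurableSet (coneJ J) := by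
  unfold coneJ
  exact measurableSet_setOfPred.2 (by fun_prop)

theorem lebesgueJ_compl_spaceJ : lebesgueJ J (spaceJ J)ᶜ = 0 := by
  rw [lebesgueJ_eq, Measure.map_apply measurable_embedJ measurableSet_spaceJ.compl]
  exact ae_embedJ_mem_spaceJ

theorem lintegral_normalDensity_nuJ (hS : S.PosDef) (hJ : J.Nonempty) (hu : u ∈ coneJ J)
    {y : J → ℝ} (hy : embedJ J y ∈ spaceJ J) :
    ∫⁻ g in Ioi (0 : ℝ), ENNReal.ofReal (Real.exp (-‖u‖ ^ 2 * g) / g) *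
      ENNReal.ofReal (normalDensity (g • restrictJ J (outerVec u μ)) (g • blockJ J S u)
        (WithLp.toLp 2 y)) = ENNReal.ofReal (nuJ μ S J u (embedJ J y)) := by
  obtain ⟨j, hj⟩ := hJ
  have hu0 : u ≠ 0 := fun h => (hu.1 j hj).ne' (by simp [h])
  have hy0 : (WithLp.toLp 2 y : E J) ≠ 0 := fun h => by
    refine hy.1 j hj ?_
    have : y ⟨j, hj⟩ = 0 := congrArg (fun z : E J => z ⟨j, hj⟩) h
    simpa [embedJ, hj] using this
  rw [lintegral_normalDensity (posDef_blockJ hS hu) hy0 _ (pow_pos (norm_pos_iff.2 hu0) 2)]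
  simp only [nuJ, restrictJ_embedJ, Fintype.card_coe]

variable {U : Measure (E (Fin n))}

theorem measurable_nuJ_comp {α : Type*} [MeasurableSpace α] {f g : α → E (Fin n)}
    (hf : Measurable f) (hg : Measurable g) :
    Measurable fun a => ENNReal.ofReal (nuJ μ S J (f a) (g a)) :=
  (measurable_nuJ.comp (hf.prodMk hg)).ennreal_ofReal

theorem measurable_gammaWeight (u : E (Fin n)) :
    Measurable fun g : ℝ => ENNReal.ofReal (Real.exp (-‖u‖ ^ 2 * g) / g) := by
  fun_prop

theorem lintegral_nuJ (hS : S.PosDef) (hJ : J.Nonempty) (hu : u ∈ coneJ J)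
    {s : Set (E (Fin n))} (hs : MeasurableSet s) :
    ∫⁻ y : J → ℝ, ENNReal.ofReal (nuJ μ S J u (embedJ J y)) * s.indicator 1 (embedJ J y) =
      ∫⁻ g in Ioi (0 : ℝ), ENNReal.ofReal (Real.exp (-‖u‖ ^ 2 * g) / g) *
        gaussKernel μ hS.posSemidef (g • u) s := by
  have h1 : Measurable fun y : J → ℝ => s.indicator (1 : E (Fin n) → ℝ≥0∞) (embedJ J y) :=
    (measurable_one.indicator hs).comp measurable_embedJ
  obtain ⟨N, hN, hNdef⟩ : ∃ N : ℝ × (J → ℝ) → ℝ≥0∞, Measurable N ∧ ∀ g y, ENNReal.ofReal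
      (normalDensity (g • restrictJ J (outerVec u μ)) (g • blockJ J S u)
        (WithLp.toLp 2 y)) = N (g, y) :=
    ⟨_, measurable_normalDensity_smul (restrictJ J (outerVec u μ)) (blockJ J S u),
      fun _ _ => rfl⟩
  obtain ⟨w, hw, hwdef⟩ : ∃ w : ℝ → ℝ≥0∞, Measurable w ∧
      ∀ g, ENNReal.ofReal (Real.exp (-‖u‖ ^ 2 * g) / g) = w g :=
    ⟨_, measurable_gammaWeight u, fun _ => rfl⟩
  have h2 : ∫⁻ g in Ioi (0 : ℝ), w g * gaussKernel μ hS.posSemidef (g • u) s =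
      ∫⁻ g in Ioi (0 : ℝ), (∫⁻ y : J → ℝ, w g * N (g, y) * s.indicator 1 (embedJ J y)) := by
    refine setLIntegral_congr_fun measurableSet_Ioi fun g hg => ?_
    have hNg : Measurable fun y : J → ℝ => N (g, y) * s.indicator 1 (embedJ J y) :=
      (hN.comp measurable_prodMk_left).mul h1
    simp only [gaussKernel_smul_coneJ hS hu hg hs, hNdef, mul_assoc]
    rw [lintegral_const_mul _ hNg]
  have h3 : Measurable fun p : ℝ × (J → ℝ) => w p.1 * N p * s.indicator 1 (embedJ J p.2) :=
    ((hw.comp measurable_fst).mul hN).mul (h1.comp measurable_snd)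
  simp only [hwdef]
  rw [h2, lintegral_lintegral_swap h3.aemeasurable]
  refine lintegral_congr_ae ?_
  filter_upwards [ae_embedJ_mem_spaceJ] with y hy
  have h4 : Measurable fun g : ℝ => w g * N (g, y) := hw.mul (hN.comp measurable_prodMk_right)
  rw [lintegral_mul_const _ h4]
  simp only [← lintegral_normalDensity_nuJ hS hJ hu hy, hwdef, hNdef]

theorem withDensity_densityJ_apply [SFinite U] (hS : S.PosDef) (hJ : J.Nonempty)
    {s : Set (E (Fin n))} (hs : MeasurableSet s) :
    ((lebesgueJ J).withDensity (densityJ μ S U J)) s =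
      ∫⁻ u in coneJ J, (∫⁻ g in Ioi (0 : ℝ), ENNReal.ofReal (Real.exp (-‖u‖ ^ 2 * g) / g) *
        gaussKernel μ hS.posSemidef (g • u) s) ∂U := by
  have hd : Measurable (densityJ μ S U J) :=
    Measurable.lintegral_prod_left' (μ := U.restrict (coneJ J))
      (measurable_nuJ_comp measurable_fst measurable_snd)
  have h1 : Measurable fun y : J → ℝ => s.indicator (1 : E (Fin n) → ℝ≥0∞) (embedJ J y) :=
    (measurable_one.indicator hs).comp measurable_embedJ
  have hn : Measurable fun p : (J → ℝ) × E (Fin n) =>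
      ENNReal.ofReal (nuJ μ S J p.2 (embedJ J p.1)) * s.indicator (1 : E (Fin n) → ℝ≥0∞)
        (embedJ J p.1) :=
    (measurable_nuJ_comp measurable_snd (measurable_embedJ.comp measurable_fst)).mul
      (h1.comp measurable_fst)
  have h2 : ((lebesgueJ J).withDensity (densityJ μ S U J)) s =
      ∫⁻ y : J → ℝ, (∫⁻ u in coneJ J, ENNReal.ofReal (nuJ μ S J u (embedJ J y)) *
        s.indicator (1 : E (Fin n) → ℝ≥0∞) (embedJ J y) ∂U) := by
    rw [withDensity_apply _ hs, ← lintegral_indicator hs, lebesgueJ_eq,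
      lintegral_map (hd.indicator hs) measurable_embedJ]
    refine lintegral_congr fun y => ?_
    rw [lintegral_mul_const _ (measurable_nuJ_comp (f := fun u => u)
      (g := fun _ => embedJ J y) measurable_id measurable_const)]
    by_cases hy : embedJ J y ∈ s
    · simp [hy, densityJ]
    · simp [hy]
  rw [h2, lintegral_lintegral_swap hn.aemeasurable]
  exact setLIntegral_congr_fun measurableSet_coneJ fun u hu => lintegral_nuJ hS hJ hu hs

theorem iUnion_coneJ :
    orthantStar (Fin n) = ⋃ J ∈ (Finset.univ.filter Finset.Nonempty : Finset (Finset (Fin n))),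
      coneJ J := by
  ext u
  simp only [Finset.mem_filter, Finset.mem_univ, true_and, mem_iUnion, exists_prop]
  constructor
  · intro hu
    refine ⟨Finset.univ.filter fun i => 0 < u i, ?_, fun j hj => by simpa using hj, fun j hj =>
      le_antisymm (by simpa using hj) (hu.1 j)⟩
    by_contra h
    refine hu.2 ?_
    ext i
    have : i ∉ Finset.univ.filter fun i => 0 < u i := by
      rw [Finset.not_nonempty_iff_eq_empty.1 h]; simp
    exact le_antisymm (by simpa using this) (hu.1 i)
  · rintro ⟨J, ⟨j, hj⟩, hu⟩
    exact ⟨coneJ_nonneg hu, fun h => (hu.1 j hj).ne' (by simp [h])⟩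

theorem pairwise_disjoint_coneJ {J K : Finset (Fin n)} (h : J ≠ K) :
    Disjoint (coneJ J) (coneJ K) := by
  rw [Set.disjoint_left]
  intro u hJ hK
  refine h (Finset.ext fun i => ⟨fun hi => ?_, fun hi => ?_⟩)
  · by_contra hc; exact (hJ.1 i hi).ne' (hK.2 i hc)
  · by_contra hc; exact (hK.1 i hi).ne' (hJ.2 i hc)

/-- The punctured orthant is the disjoint union of the cones `C_J`, `J` nonempty, and the jumps of
`Y` at the times `g u` with `u ∈ C_J` have the density `v_J` on the coordinate subspace of `J`. -/
theorem vggLevyMeasure_eq_sum (hS : S.PosDef) (hU : IsThorinMeasure U) :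
    vggLevyMeasure μ S U = ∑ J : Finset (Fin n) with J.Nonempty,
      (lebesgueJ J).withDensity (densityJ μ S U J) := by
  have := hU.sigmaFinite
  ext s hs
  have hs' : MeasurableSet (s ∩ {0}ᶜ) := hs.inter (measurableSet_singleton _).compl
  have hU' : U = U.restrict (orthantStar (Fin n)) :=
    (Measure.restrict_eq_self_of_ae_mem (ae_orthantStar hU)).symm
  rw [vggLevyMeasure_eq hS.posSemidef hU, Measure.restrict_apply hs,
    Measure.bind_apply hs' (Kernel.aemeasurable _), lintegral_thorinLevy
      (Kernel.measurable_coe _ hs')]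
  conv_lhs => rw [hU', iUnion_coneJ]
  rw [lintegral_biUnion_finset (fun J _ K _ h => pairwise_disjoint_coneJ h)
    fun J _ => measurableSet_coneJ, Measure.finsetSum_apply]
  refine Finset.sum_congr rfl fun J hJ => ?_
  have hJ : J.Nonempty := by simpa using hJ
  rw [← withDensity_densityJ_apply hS hJ hs']
  -- the origin lies outside `V_J`, and thus is a null set of Lebesgue measure on `ℝ_J`
  refine measure_congr (inter_ae_eq_left_of_ae_eq_univ (ae_eq_univ.2 ?_))
  rw [compl_compl]
  refine (withDensity_absolutelyContinuous _ _) (measure_mono_null ?_ lebesgueJ_compl_spaceJ)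
  obtain ⟨j, hj⟩ := hJ
  rintro x rfl hx
  exact hx.1 j hj rfl

end

end VGG

end

theorem theorem4p1 {n : ℕ} {ΩB ΩT ΩZ ΩY : Type*} [MeasurableSpace ΩB] [MeasurableSpace ΩT]
    [MeasurableSpace ΩZ] [MeasurableSpace ΩY]
    (PB : Measure ΩB) [IsProbabilityMeasure PB] (B : ℝ≥0 → ΩB → VGG.E (Fin n))
    (PT : Measure ΩT) [IsProbabilityMeasure PT] (T : ℝ≥0 → ΩT → VGG.E (Fin n))
    (PZ : Measure ΩZ) [IsProbabilityMeasure PZ] (Z : ℝ≥0 → ΩZ → VGG.E (Fin n ⊕ Fin n))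
    (PY : Measure ΩY) [IsProbabilityMeasure PY] (Y : ℝ≥0 → ΩY → VGG.E (Fin n))
    (d μ : VGG.E (Fin n)) (S : Matrix (Fin n) (Fin n) ℝ) (U : Measure (VGG.E (Fin n)))
    (hY : VGG.IsVGG PB B PT T PZ Z PY Y d μ S U) :
    -- the triplet of `Y`
    (∃ m₂ : VGG.E (Fin n),
      VGG.HasTriplet PY Y m₂ (VGG.outerMat d S) (VGG.vggLevyMeasure μ S U) ∧
      -- the drift, with `∫_{𝔻∖{0}} y 𝒴(dy)` read as an iterated integral along the mixture
      (∀ u ∈ VGG.orthantStar (Fin n),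
        IntegrableOn (fun y => y) (VGG.unitBall (Fin n) \ {0}) (VGG.vgAt μ S u)) ∧
      Integrable (fun u => (1 / ‖u‖ ^ 2) •
        ∫ y in VGG.unitBall (Fin n) \ {0}, y ∂(VGG.vgAt μ S u)) U ∧
      m₂ = VGG.outerVec d μ + ∫ u, (1 / ‖u‖ ^ 2) •
        (∫ y in VGG.unitBall (Fin n) \ {0}, y ∂(VGG.vgAt μ S u)) ∂U ∧
      -- the same with the integral in the usual sense, whenever that exists
      (IntegrableOn (fun y => y) (VGG.unitBall (Fin n) \ {0}) (VGG.vggLevyMeasure μ S U) →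
        m₂ = VGG.outerVec d μ +
          ∫ y in VGG.unitBall (Fin n) \ {0}, y ∂(VGG.vggLevyMeasure μ S U)) ∧
      -- the characteristic exponent
      ∀ θ : VGG.E (Fin n),
        Integrable (fun u => Complex.log (((‖u‖ ^ 2 : ℝ) -
          Complex.I * (inner ℝ (VGG.outerVec u μ) θ : ℝ) +
          (1 / 2) * (VGG.form (VGG.outerMat u S) θ θ : ℝ)) / (‖u‖ ^ 2 : ℝ))) U ∧
        VGG.levyExponent m₂ (VGG.outerMat d S) (VGG.vggLevyMeasure μ S U) θ =
          Complex.I * (inner ℝ (VGG.outerVec d μ) θ : ℝ) -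
            (1 / 2) * (VGG.form (VGG.outerMat d S) θ θ : ℝ) -
            ∫ u, Complex.log (((‖u‖ ^ 2 : ℝ) -
              Complex.I * (inner ℝ (VGG.outerVec u μ) θ : ℝ) +
              (1 / 2) * (VGG.form (VGG.outerMat u S) θ θ : ℝ)) / (‖u‖ ^ 2 : ℝ)) ∂U) ∧
    -- the decomposition of the Lévy measure for invertible covariance
    (IsUnit S → ∃ 𝒴 : Finset (Fin n) → Measure (VGG.E (Fin n)),
      VGG.vggLevyMeasure μ S U =
        ∑ J : Finset (Fin n) with J.Nonempty, 𝒴 J ∧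
      ∀ J : Finset (Fin n), J.Nonempty →
        𝒴 J (VGG.spaceJ J)ᶜ = 0 ∧
        𝒴 J ≪ VGG.lebesgueJ J ∧
        𝒴 J = (VGG.lebesgueJ J).withDensity (VGG.densityJ μ S U J)) := by
  have hS := hY.brownian.posSemidef
  have hU := hY.thorin.isThorinMeasure
  have := hU.sigmaFinite
  have hpos : ∀ᵐ t ∂(VGG.thorinLevy U), ∀ i, 0 ≤ t i := by
    filter_upwards [VGG.ae_thorinLevy_orthantStar (VGG.ae_orthantStar hU)] with t ht using ht.1
  refine ⟨⟨_, VGG.hasTriplet_of_isVGG hY, fun u hu => ?_, (VGG.drift_eq hS hU).1, ?_,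
    fun h => ?_, fun θ => ?_⟩, fun hinv => ?_⟩
  · rw [VGG.vgAt_eq hS hu.1, VGG.integrableOn_unitBall_diff_iff]
    exact VGG.integrable_comp_gammaLevy hS hu
  · rw [(VGG.drift_eq hS hU).2]
  · rw [VGG.integral_vggLevyMeasure hS hU h]
  · rw [VGG.vggLevyMeasure_eq hS hU,
      VGG.levyExponent_mixture (VGG.integrable_min_thorinLevy hU) hpos hS]
    exact VGG.subordinatedExponent_thorinLevy hS hU θ
  · have hS' : S.PosDef := hS.posDef_iff_isUnit.2 hinv
    refine ⟨fun J => (VGG.lebesgueJ J).withDensity (VGG.densityJ μ S U J),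
      VGG.vggLevyMeasure_eq_sum hS' hU, fun J _ => ⟨?_, withDensity_absolutelyContinuous _ _, rfl⟩⟩
    exact withDensity_absolutelyContinuous _ _ VGG.lebesgueJ_compl_spaceJ
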